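/- **Terms.** For $k\ge 0$ let $\vec y=(y_1,\dots,y_k)$ be Boolean variables. A *phase polynomial* in $\vec y$ is an element $P$ of $\mathbb R[y_1,\dots,y_k]/(1,\,y_i^2-y_i)$, i.e. a real polynomial modulo the additive subgroup generated by the polynomials with integer coefficients and the ideal generated by the $y_i^2-y_i$. A *Boolean polynomial* is an element of $\mathbb F_2[y_1,\dots,y_k]$ (addition is written $\oplus$); $\widehat Q$ is the phase polynomial defined by $\widehat 0=0$, $\widehat 1=1$, $\widehat y=y$, $\widehat{pq}=\hat p\,\hat q$, $\widehat{p\oplus q}=\hat p+\hat q-2\hat p\,\hat q$. A *term with discards* $n\to m$ is $$t=s\sum_{\vec y}e^{2i\pi P}\,|\vec O\rangle\,!\vec D\,\langle\vec I|,$$ where $s\in\mathbb R$, $P$ is a phase polynomial, $\vec O$ (ket) and $\vec I$ (bra) are lists of $m$ and $n$ Boolean polynomials, and $\vec D$ (discarded polynomials) is a finite set of Boolean polynomials. Terms are considered up to renaming of the summed variables. The *Clifford terms* $\mathbf{SOP}^{\mathrm{disc}}_{\mathrm{Clif}}(n,m)$ are those with $s=\frac1{\sqrt2^{\,p}}$,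 $p\in\mathbb Z$, with $P=\frac18P^{(0)}+\frac14P^{(1)}+\frac12P^{(2)}$ where $P^{(i)}$ has integer coefficients and degree at most $i$, and with all the polynomials in $\vec O,\vec D,\vec I$ of degree at most $1$. **Rules.** $\operatorname{mon}(Q)$ is the number of monomials of $Q$, and $[y\leftarrow Q]$ substitutes $Q$ in Boolean polynomials and $\widehat Q$ in phase polynomials. The rewrite rules are: * (Elim) $s\sum_{\vec y} e^{2i\pi P}|\vec O\rangle!\vec D\langle\vec I|\to 2s\sum_{\vec y\setminus\{y_0\}}e^{2i\pi P}|\vec O\rangle!\vec D\langle\vec I|$ if $y_0\notin\operatorname{Var}(P,\vec O,\vec D,\vec I)$. * (HH) $s\sum_{\vec y} e^{2i\pi(\frac{y_0}2(y_0'+\widehat Q)+R)}|\vec O\rangle!\vec D\langle\vec I|\to 2s\sum_{\vec y\setminus\{y_0,y_0'\}}\bigl(e^{2i\pi R}|\vec O\rangle!\vec D\langle\vec I|\bigr)[y_0'\leftarrow Q]$ if $y_0\ne y_0'$, $y_0\notin\operatorname{Var}(R,Q,\vec O,\vec D,\vec I)$ and $y_0'\notin\operatorname{Var}(Q)$. *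 ($\omega$) $s\sum_{\vec y} e^{2i\pi(\frac{y_0}4+\frac{y_0}2\widehat Q+R)}|\vec O\rangle!\vec D\langle\vec I|\to\sqrt2\,s\sum_{\vec y\setminus\{y_0\}}e^{2i\pi(\frac18-\frac14\widehat Q+R)}|\vec O\rangle!\vec D\langle\vec I|$ if $y_0\notin\operatorname{Var}(Q,R,\vec O,\vec D,\vec I)$. * ($\mathrm Z_!$) $s\sum e^{2i\pi(P+\alpha\widehat{D_1\cdots D_r})}|\vec O\rangle!\vec D\langle\vec I|\to s\sum e^{2i\pi P}|\vec O\rangle!\vec D\langle\vec I|$ if $\{D_1,\dots,D_r\}\subseteq\vec D$ and $\alpha\in\mathbb R$. * ($\mathrm H_!$) $s\sum_{\vec y} e^{2i\pi(P+\frac{y_0}2\widehat Q)}|\vec O\rangle!(\vec D\cup\{y_0\})\langle\vec I|\to\sqrt2\,s\sum_{\vec y\setminus\{y_0\}}e^{2i\pi P}|\vec O\rangle!(\vec D\cup\{Q\})\langle\vec I|$ if $y_0\notin\operatorname{Var}(P,Q,\vec O,\vec D,\vec I)$. * ($\oplus_!$) $s\sum e^{2i\pi P}|\vec O\rangle!(\vec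 D\cup\{D_1\cdots D_r\oplus D_{r+1}\})\langle\vec I|\to s\sum e^{2i\pi P}|\vec O\rangle!(\vec D\cup\{D_{r+1}\})\langle\vec I|$ if $\{D_1,\dots,D_r\}\subseteq\vec D$. * ($\mathrm{Cst}_!$) $s\sum e^{2i\pi P}|\vec O\rangle!(\vec D\cup\{c\})\langle\vec I|\to s\sum e^{2i\pi P}|\vec O\rangle!\vec D\langle\vec I|$ if $c\in\{0,1\}$. * (disc) $s\sum e^{2i\pi P}|\vec O\rangle!(\vec D\cup\{y_0\oplus D'\})\langle\vec I|\to s\sum\bigl(e^{2i\pi P}|\vec O\rangle!(\vec D\cup\{y_0\oplus D'\})\langle\vec I|\bigr)[y_0\leftarrow y_0\oplus D']$ if $y_0\notin\operatorname{Var}(D')$, $y_0\oplus D'\notin\vec D$ and $\vec D[y_0\leftarrow y_0\oplus D']$ has at most as many elements with $\operatorname{mon}\ge2$ as $\vec D$. * (ket) $s\sum e^{2i\pi P}|\vec O\rangle!\vec D\langle\vec I|\to s\sum e^{2i\pi P[y_0\leftarrow y_0\oplus A]}|\vec O[y_0\leftarrow y_0\oplus A]\rangle!\vec D\langle\vec I[y_0\leftarrow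 y_0\oplus A]|$ if $O_i=y_0\oplus A\oplus B$, $A\ne0$, $y_0\notin\operatorname{Var}(O_1,\dots,O_{i-1},A,B)$, and either $y_0\notin\operatorname{Var}(\vec D)$ or $\{y_0,A\}\subseteq\vec D\cup\{1\}$. * (bra) $s\sum e^{2i\pi P}|\vec O\rangle!\vec D\langle\vec I|\to s\sum e^{2i\pi P[y_0\leftarrow y_0\oplus A]}|\vec O\rangle!\vec D\langle\vec I[y_0\leftarrow y_0\oplus A]|$ if $I_i=y_0\oplus A\oplus B$, $A\ne0$, $y_0\notin\operatorname{Var}(\vec O,I_1,\dots,I_{i-1},A,B)$, and either $y_0\notin\operatorname{Var}(\vec D)$ or $\{y_0,A\}\subseteq\vec D\cup\{1\}$. * (Z) $s\sum_{\vec y} e^{2i\pi(\frac{y_0}2+R)}|\vec O\rangle!\vec D\langle\vec I|\to\sum_{y_0}e^{2i\pi\frac{y_0}2}|0,\dots,0\rangle!\{\}\langle0,\dots,0|$ if $y_0\notin\operatorname{Var}(R,\vec O,\vec D,\vec I)$ and ($R\neq0$ or some $O_i$ or $I_i$ is nonzero). Let $\sim$ be the equivalence relation on $\mathbf{SOP}^{\mathrm{disc}}_{\mathrm{Clif}}(n,m)$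 generated by these (unoriented) rules between Clifford terms. **Statement.** Equality in $\mathbf{SOP}^{\mathrm{disc}}_{\mathrm{Clif}}/{\sim}$ is decidable in polynomial time: there are a single program $M$ and a single polynomial $q$ such that for all $n,m\ge0$ and all written Clifford terms $t_1,t_2:n\to m$, the program $M$ started on $(t_1,t_2)$ halts after at most $$q\bigl(\text{size of the phase polynomials}+\text{combined size of the ket, bra and discarded polynomials}+\text{size of the headers}\bigr)$$ steps (the sizes of $t_1$ and $t_2$ being added) and answers *true* if $t_1\sim t_2$ and *false* otherwise. Here a Clifford term is written as the number $k$ of its summed variables, the exponent $p$ of its scalar, and its polynomials as lists of monomials, where numbers and variable indices are written in binary and sizes count binary digits; the header consists of $k$ and $p$. Programs are written in a while-language over binary trees (assignments of expressions built from variables, $\mathrm{nil}$, $\mathrm{cons}$, head and tail; composition; branching; loops), where the evaluation of each subexpression costs as many steps as its value has nodes. -/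

import Mathlib

open MvPolynomial

/-! ## Terms -/

/-- Phase polynomials (real coefficients) in the variables `y_0, …, y_(k-1)`.  They matter only
modulo `phaseNull k`. -/
abbrev PhasePoly (k : ℕ) : Type := MvPolynomial (Fin k) ℝ

/-- Boolean polynomials in the variables `y_0, …, y_(k-1)`; addition is `⊕`. -/
abbrev BoolPoly (k : ℕ) : Type := MvPolynomial (Fin k) (ZMod 2)

/-- The phase polynomials that are zero in `ℝ[X_1, …, X_k] / (1, X_i ^ 2 - X_i)`: sums of a
polynomial with integer coefficients and of an element of the ideal generated by the
`X_i ^ 2 - X_i`. -/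
noncomputable def phaseNull (k : ℕ) : AddSubgroup (PhasePoly k) :=
  (MvPolynomial.map (σ := Fin k) (Int.castRingHom ℝ)).toAddMonoidHom.range ⊔
    Submodule.toAddSubgroup (Ideal.span (Set.range fun i : Fin k => (X i ^ 2 - X i : PhasePoly k)))

/-- The operation `p, q ↦ p + q - 2 p q`, which is `⊕` on the values `0` and `1`. -/
noncomputable def phaseXor {k : ℕ} (p q : PhasePoly k) : PhasePoly k := p + q - 2 * p * q

instance phaseXor_comm {k : ℕ} : Std.Commutative (phaseXor (k := k)) :=
  ⟨fun a b => by unfold phaseXor; ring⟩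

instance phaseXor_assoc {k : ℕ} : Std.Associative (phaseXor (k := k)) :=
  ⟨fun a b c => by unfold phaseXor; ring⟩

/-- The immersion `Q ↦ Q̂` of Boolean polynomials into phase polynomials: monomials are kept and
`⊕` becomes `phaseXor`. -/
noncomputable def hat {k : ℕ} (Q : BoolPoly k) : PhasePoly k :=
  Q.support.fold phaseXor 0 fun d => monomial d 1

/-- A term `s ∑_{y_0, …, y_(k-1)} e ^ (2 i π P) |O⟩ !D ⟨I|` from `n` to `m`. -/
structure SOPTerm (n m : ℕ) where
  /-- number of summed variables -/
  k : ℕ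
  /-- scalar -/
  s : ℝ
  /-- phase polynomial -/
  P : PhasePoly k
  /-- output signature (ket) -/
  O : Fin m → BoolPoly k
  /-- discarded polynomials -/
  D : Finset (BoolPoly k)
  /-- input signature (bra) -/
  I : Fin n → BoolPoly k

/-! ## Substitutions

A fresh variable is always the variable `0`; the other variables are then shifted by one. -/

section Substitution

variable {k n : ℕ}

/-- Make room for a fresh variable `0`. -/
noncomputable def upP (P : PhasePoly k) : PhasePoly (k + 1) := rename Fin.succ P

/-- Make room for a fresh variable `0`. -/
noncomputable def upB (Q : BoolPoly k) : BoolPoly (k + 1) := rename Fin.succ Q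

/-- Remove the variable `0` by the substitution `y_0 ← Q̂`. -/
noncomputable def removeP (Q : BoolPoly k) (P : PhasePoly (k + 1)) : PhasePoly k :=
  bind₁ (Fin.cons (hat Q) X : Fin (k + 1) → PhasePoly k) P

/-- Remove the variable `0` by the substitution `y_0 ← Q`. -/
noncomputable def removeB (Q : BoolPoly k) (A : BoolPoly (k + 1)) : BoolPoly k :=
  bind₁ (Fin.cons Q X : Fin (k + 1) → BoolPoly k) A

/-- The substitution `y ← Q̂`, all variables being kept. -/
noncomputable def substP (y : Fin k) (Q : BoolPoly k) (P : PhasePoly k) : PhasePoly k :=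
  bind₁ (Function.update X y (hat Q)) P

/-- The substitution `y ← Q`, all variables being kept. -/
noncomputable def substB (y : Fin k) (Q : BoolPoly k) (A : BoolPoly k) : BoolPoly k :=
  bind₁ (Function.update X y Q) A

/-- Number of monomials. -/
noncomputable def mon (Q : BoolPoly k) : ℕ := Q.support.card

end Substitution

/-! ## The rewrite rules -/

/-- The rewrite rules for terms with discards.  The first two constructors say which terms are the
same morphism: the names of the summed variables are irrelevant, and the phase polynomial is taken
modulo `1` and `X_i ^ 2 = X_i`.  In the rules that remove variables, a side condition
`y_0 ∉ Var(…)` is expressed by taking the polynomials in question over the remaining variables. -/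
inductive SOPStep {n m : ℕ} : SOPTerm n m → SOPTerm n m → Prop
  | alpha {k : ℕ} (π : Equiv.Perm (Fin k)) (s : ℝ) (P : PhasePoly k) (O : Fin m → BoolPoly k)
      (D : Finset (BoolPoly k)) (I : Fin n → BoolPoly k) :
      SOPStep ⟨k, s, P, O, D, I⟩
        ⟨k, s, rename π P, fun i => rename π (O i), D.image (rename π), fun i => rename π (I i)⟩
  | phase {k : ℕ} (s : ℝ) (P P' : PhasePoly k) (O : Fin m → BoolPoly k)
      (D : Finset (BoolPoly k)) (I : Fin n → BoolPoly k) (h : P - P' ∈ phaseNull k) :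
      SOPStep ⟨k, s, P, O, D, I⟩ ⟨k, s, P', O, D, I⟩
  /-- (Elim) -/
  | elim {k : ℕ} (s : ℝ) (P : PhasePoly k) (O : Fin m → BoolPoly k)
      (D : Finset (BoolPoly k)) (I : Fin n → BoolPoly k) :
      SOPStep ⟨k + 1, s, upP P, fun i => upB (O i), D.image upB, fun i => upB (I i)⟩
        ⟨k, 2 * s, P, O, D, I⟩
  /-- (HH), where `y_0` is the variable `0` and `y_0'` the variable `1` of the left-hand side -/
  | hh {k : ℕ} (s : ℝ) (Q : BoolPoly k) (R : PhasePoly (k + 1)) (O : Fin m → BoolPoly (k + 1))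
      (D : Finset (BoolPoly (k + 1))) (I : Fin n → BoolPoly (k + 1)) :
      SOPStep
        ⟨k + 2, s, C (1 / 2) * X 0 * (X 1 + hat (upB (upB Q))) + upP R,
          fun i => upB (O i), D.image upB, fun i => upB (I i)⟩
        ⟨k, 2 * s, removeP Q R,
          fun i => removeB Q (O i), D.image (removeB Q), fun i => removeB Q (I i)⟩
  /-- (ω) -/
  | omega {k : ℕ} (s : ℝ) (Q : BoolPoly k) (R : PhasePoly k) (O : Fin m → BoolPoly k)
      (D : Finset (BoolPoly k)) (I : Fin n → BoolPoly k) :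
      SOPStep
        ⟨k + 1, s, C (1 / 4) * X 0 + C (1 / 2) * X 0 * hat (upB Q) + upP R,
          fun i => upB (O i), D.image upB, fun i => upB (I i)⟩
        ⟨k, √2 * s, C (1 / 8) - C (1 / 4) * hat Q + R, O, D, I⟩
  /-- (Z with a discard): phases that depend on discarded polynomials only -/
  | zGround {k : ℕ} (s : ℝ) (P : PhasePoly k) (α : ℝ) (T : Finset (BoolPoly k))
      (O : Fin m → BoolPoly k) (D : Finset (BoolPoly k)) (I : Fin n → BoolPoly k) (hT : T ⊆ D) :
      SOPStep ⟨k, s, P + C α * hat (∏ d ∈ T, d), O, D, I⟩ ⟨k, s, P, O, D, I⟩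
  /-- (H with a discard) -/
  | hGround {k : ℕ} (s : ℝ) (Q : BoolPoly k) (P : PhasePoly k) (O : Fin m → BoolPoly k)
      (D : Finset (BoolPoly k)) (I : Fin n → BoolPoly k) :
      SOPStep
        ⟨k + 1, s, upP P + C (1 / 2) * X 0 * hat (upB Q),
          fun i => upB (O i), insert (X 0) (D.image upB), fun i => upB (I i)⟩
        ⟨k, √2 * s, P, O, insert Q D, I⟩
  /-- (⊕ with a discard) -/
  | xorGround {k : ℕ} (s : ℝ) (P : PhasePoly k) (d : BoolPoly k) (T : Finset (BoolPoly k))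
      (O : Fin m → BoolPoly k) (D : Finset (BoolPoly k)) (I : Fin n → BoolPoly k) (hT : T ⊆ D) :
      SOPStep ⟨k, s, P, O, insert ((∏ e ∈ T, e) + d) D, I⟩ ⟨k, s, P, O, insert d D, I⟩
  /-- (Cst with a discard) -/
  | cstGround {k : ℕ} (s : ℝ) (P : PhasePoly k) (c : ZMod 2)
      (O : Fin m → BoolPoly k) (D : Finset (BoolPoly k)) (I : Fin n → BoolPoly k) :
      SOPStep ⟨k, s, P, O, insert (C c) D, I⟩ ⟨k, s, P, O, D, I⟩
  /-- (disc) -/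
  | disc {k : ℕ} (s : ℝ) (P : PhasePoly k) (y : Fin k) (D' : BoolPoly k)
      (O : Fin m → BoolPoly k) (D : Finset (BoolPoly k)) (I : Fin n → BoolPoly k)
      (hy : y ∉ D'.vars) (hD : X y + D' ∉ D)
      (hmon : ((D.image (substB y (X y + D'))).filter fun d => 2 ≤ mon d).card ≤
        (D.filter fun d => 2 ≤ mon d).card) :
      SOPStep ⟨k, s, P, O, insert (X y + D') D, I⟩
        ⟨k, s, substP y (X y + D') P, fun i => substB y (X y + D') (O i),
          (insert (X y + D') D).image (substB y (X y + D')),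
          fun i => substB y (X y + D') (I i)⟩
  /-- (ket), where `O_i = y ⊕ A ⊕ B` and the substitution is `y ← y ⊕ A` -/
  | ket {k : ℕ} (s : ℝ) (P : PhasePoly k) (i : Fin m) (y : Fin k) (A B : BoolPoly k)
      (O : Fin m → BoolPoly k) (D : Finset (BoolPoly k)) (I : Fin n → BoolPoly k)
      (hi : O i = X y + A + B) (hA : A ≠ 0)
      (hyO : ∀ j < i, y ∉ (O j).vars) (hyA : y ∉ A.vars) (hyB : y ∉ B.vars)
      (hD : (∀ d ∈ D, y ∉ d.vars) ∨ {X y, A} ⊆ insert 1 D) :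
      SOPStep ⟨k, s, P, O, D, I⟩
        ⟨k, s, substP y (X y + A) P, fun j => substB y (X y + A) (O j), D,
          fun j => substB y (X y + A) (I j)⟩
  /-- (bra), where `I_i = y ⊕ A ⊕ B` and the substitution is `y ← y ⊕ A` -/
  | bra {k : ℕ} (s : ℝ) (P : PhasePoly k) (i : Fin n) (y : Fin k) (A B : BoolPoly k)
      (O : Fin m → BoolPoly k) (D : Finset (BoolPoly k)) (I : Fin n → BoolPoly k)
      (hi : I i = X y + A + B) (hA : A ≠ 0)
      (hyO : ∀ j, y ∉ (O j).vars) (hyI : ∀ j < i, y ∉ (I j).vars)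
      (hyA : y ∉ A.vars) (hyB : y ∉ B.vars)
      (hD : (∀ d ∈ D, y ∉ d.vars) ∨ {X y, A} ⊆ insert 1 D) :
      SOPStep ⟨k, s, P, O, D, I⟩
        ⟨k, s, substP y (X y + A) P, O, D, fun j => substB y (X y + A) (I j)⟩
  /-- (Z) -/
  | zero {k : ℕ} (s : ℝ) (R : PhasePoly k) (O : Fin m → BoolPoly k)
      (D : Finset (BoolPoly k)) (I : Fin n → BoolPoly k)
      (h : R ∉ phaseNull k ∨ (∃ i, O i ≠ 0) ∨ ∃ i, I i ≠ 0) :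
      SOPStep
        ⟨k + 1, s, C (1 / 2) * X 0 + upP R, fun i => upB (O i), D.image upB, fun i => upB (I i)⟩
        ⟨1, 1, C (1 / 2) * X 0, fun _ => 0, ∅, fun _ => 0⟩

/-! ## The Clifford fragment -/

/-- The phase polynomial `1/8 P⁽⁰⁾ + 1/4 P⁽¹⁾ + 1/2 P⁽²⁾`. -/
noncomputable def cliffPhase {k : ℕ} (P₀ : ℤ) (P₁ P₂ : MvPolynomial (Fin k) ℤ) : PhasePoly k :=
  C (1 / 8) * C (P₀ : ℝ) + C (1 / 4) * MvPolynomial.map (Int.castRingHom ℝ) P₁ +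
    C (1 / 2) * MvPolynomial.map (Int.castRingHom ℝ) P₂

/-- The terms `1/√2^p ∑ e ^ (2 i π (1/8 P⁽⁰⁾ + 1/4 P⁽¹⁾ + 1/2 P⁽²⁾)) |O⟩ !D ⟨I|` where `P⁽ⁱ⁾` has
integer coefficients and degree at most `i`, and where `O`, `D` and `I` are linear (of degree at
most one). -/
structure SOPTerm.IsClifford {n m : ℕ} (t : SOPTerm n m) : Prop where
  scalar : ∃ p : ℤ, t.s = (1 / √2) ^ p
  phase : ∃ (P₀ : ℤ) (P₁ P₂ : MvPolynomial (Fin t.k) ℤ),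
    P₁.totalDegree ≤ 1 ∧ P₂.totalDegree ≤ 2 ∧ t.P - cliffPhase P₀ P₁ P₂ ∈ phaseNull t.k
  ket : ∀ i, (t.O i).totalDegree ≤ 1
  disc : ∀ d ∈ t.D, d.totalDegree ≤ 1
  bra : ∀ i, (t.I i).totalDegree ≤ 1

/-- The morphisms `n → m` of the Clifford fragment with discards, as terms. -/
abbrev CliffMor (n m : ℕ) : Type := {t : SOPTerm n m // t.IsClifford}

/-- One rewrite step between terms of the Clifford fragment. -/
def CliffStep {n m : ℕ} (t t' : CliffMor n m) : Prop := SOPStep t.1 t'.1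

/-- The morphisms `n → m` of the Clifford fragment with discards, modulo the equivalence relation
generated by the (unoriented) rewrite rules. -/
abbrev CliffQuot (n m : ℕ) : Type := Quot (CliffStep (n := n) (m := m))

/-! ## Written form of the terms of the Clifford fragment

Polynomials are written as lists of monomials, numbers in binary. -/

/-- A written linear Boolean polynomial: its constant term and a list of variables. -/
structure LinCode (k : ℕ) where
  cst : Bool
  vars : List (Fin k)

/-- A written term of the Clifford fragment with discards. -/
structure CliffCode (n m : ℕ) where
  /-- number of summed variables -/
  k : ℕ
  /-- the scalar is `1/√2^p` -/
  p : ℤ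
  /-- constant of the phase polynomial, in eighths -/
  cst : ℤ
  /-- linear monomials of the phase polynomial, in fourths -/
  lin : List (ℤ × Fin k)
  /-- quadratic monomials of the phase polynomial, in halves -/
  quad : List (ℤ × Fin k × Fin k)
  ket : Fin m → LinCode k
  disc : List (LinCode k)
  bra : Fin n → LinCode k

/-- The Boolean polynomial that is written. -/
noncomputable def LinCode.toPoly {k : ℕ} (a : LinCode k) : BoolPoly k :=
  C (if a.cst then 1 else 0) + (a.vars.map X).sum

namespace CliffCode

variable {n m : ℕ}

/-- The linear part of the phase polynomial, multiplied by 4. -/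
noncomputable def linPoly (c : CliffCode n m) : MvPolynomial (Fin c.k) ℤ :=
  (c.lin.map fun a => C a.1 * X a.2).sum

/-- The quadratic part of the phase polynomial, multiplied by 2. -/
noncomputable def quadPoly (c : CliffCode n m) : MvPolynomial (Fin c.k) ℤ :=
  (c.quad.map fun a => C a.1 * (X a.2.1 * X a.2.2)).sum

/-- The term that is written. -/
noncomputable def toTerm (c : CliffCode n m) : SOPTerm n m where
  k := c.k
  s := (1 / √2) ^ c.p
  P := cliffPhase c.cst c.linPoly c.quadPoly
  O := fun i => (c.ket i).toPoly
  D := (c.disc.map LinCode.toPoly).toFinset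
  I := fun i => (c.bra i).toPoly

end CliffCode

theorem totalDegree_listSum_le {k : ℕ} {R α : Type*} [CommSemiring R] (N : ℕ)
    (f : α → MvPolynomial (Fin k) R) (hf : ∀ a, (f a).totalDegree ≤ N) (l : List α) :
    (l.map f).sum.totalDegree ≤ N := by
  induction l with
  | nil => simp
  | cons a l ih =>
    simp only [List.map_cons, List.sum_cons]
    exact (totalDegree_add _ _).trans (max_le (hf a) ih)

theorem LinCode.totalDegree_toPoly_le {k : ℕ} (a : LinCode k) : a.toPoly.totalDegree ≤ 1 := by
  refine (totalDegree_add _ _).trans (max_le ((totalDegree_C _).trans_le zero_le_one) ?_)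
  exact totalDegree_listSum_le 1 _ (fun i => (totalDegree_X (R := ZMod 2) i).le) _

theorem CliffCode.isClifford_toTerm {n m : ℕ} (c : CliffCode n m) : c.toTerm.IsClifford where
  scalar := ⟨c.p, rfl⟩
  phase := by
    refine ⟨c.cst, c.linPoly, c.quadPoly, ?_, ?_, ?_⟩
    · refine totalDegree_listSum_le 1 _ (fun a => ?_) _
      refine (totalDegree_mul _ _).trans ?_
      rw [totalDegree_C, totalDegree_X]
    · refine totalDegree_listSum_le 2 _ (fun a => ?_) _
      refine (totalDegree_mul _ _).trans ?_
      have := totalDegree_mul (X a.2.1 : MvPolynomial (Fin c.k) ℤ) (X a.2.2)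
      rw [totalDegree_X, totalDegree_X] at this
      rw [totalDegree_C]
      omega
    · exact (sub_self (cliffPhase c.cst c.linPoly c.quadPoly)).symm ▸ (phaseNull c.k).zero_mem
  ket := fun i => (c.ket i).totalDegree_toPoly_le
  disc := by
    intro d hd
    obtain ⟨a, -, rfl⟩ := List.mem_map.1 (List.mem_toFinset.1 hd)
    exact a.totalDegree_toPoly_le
  bra := fun i => (c.bra i).totalDegree_toPoly_le

/-- The morphism that is written. -/
noncomputable def CliffCode.toMor {n m : ℕ} (c : CliffCode n m) : CliffMor n m :=
  ⟨c.toTerm, c.isClifford_toTerm⟩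

/-! ### Every morphism of the Clifford fragment can be written -/

theorem finsupp_eq_single_add {k N : ℕ} (d : Fin k →₀ ℕ) (hd : d.degree ≤ N + 1) :
    d = 0 ∨ ∃ (i : Fin k) (e : Fin k →₀ ℕ), d = Finsupp.single i 1 + e ∧ e.degree ≤ N := by
  by_cases h : d = 0
  · exact Or.inl h
  · obtain ⟨i, hi⟩ := Finsupp.ne_iff.1 h
    have hle : Finsupp.single i 1 ≤ d := by
      rw [Finsupp.single_le_iff]
      exact Nat.one_le_iff_ne_zero.2 hi
    refine Or.inr ⟨i, d - Finsupp.single i 1, (add_tsub_cancel_of_le hle).symm, ?_⟩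
    have h2 := congrArg Finsupp.degree (add_tsub_cancel_of_le hle)
    rw [map_add, Finsupp.degree_single] at h2
    omega

theorem sum_monomials_mem {k N : ℕ} {R A : Type*} [CommSemiring R] [AddCommMonoid A]
    (S : AddSubmonoid A) (f : MvPolynomial (Fin k) R →+ A)
    (hf : ∀ d : Fin k →₀ ℕ, d.degree ≤ N → ∀ r : R, f (monomial d r) ∈ S)
    (p : MvPolynomial (Fin k) R) (hp : p.totalDegree ≤ N) : f p ∈ S := by
  rw [p.as_sum, map_sum]
  exact S.sum_mem fun d hd => hf d ((le_totalDegree hd).trans hp) _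

theorem LinCode.exists_toPoly {k : ℕ} (Q : BoolPoly k) (hQ : Q.totalDegree ≤ 1) :
    ∃ a : LinCode k, a.toPoly = Q := by
  let S : AddSubmonoid (BoolPoly k) :=
    { carrier := {p | ∃ a : LinCode k, a.toPoly = p}
      zero_mem' := ⟨⟨false, []⟩, by simp [LinCode.toPoly]⟩
      add_mem' := by
        rintro _ _ ⟨a, rfl⟩ ⟨b, rfl⟩
        refine ⟨⟨xor a.cst b.cst, a.vars ++ b.vars⟩, ?_⟩
        have h : (C (if xor a.cst b.cst then 1 else 0) : BoolPoly k) =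
            C (if a.cst then 1 else 0) + C (if b.cst then 1 else 0) := by
          rw [← C_add]
          congr 1
          cases a.cst <;> cases b.cst <;> decide
        simp only [LinCode.toPoly, h, List.map_append, List.sum_append]
        ring }
  have h01 : ∀ r : ZMod 2, r = 0 ∨ r = 1 := by decide
  refine sum_monomials_mem (N := 1) S (AddMonoidHom.id _) (fun d hd r => ?_) Q hQ
  rcases h01 r with rfl | rfl
  · simp
  rcases finsupp_eq_single_add (N := 0) d hd with rfl | ⟨i, e, rfl, he⟩
  · exact ⟨⟨true, []⟩, by simp [LinCode.toPoly]⟩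
  · obtain rfl : e = 0 := (Finsupp.degree_eq_zero_iff e).1 (Nat.le_zero.1 he)
    exact ⟨⟨false, [i]⟩, by simp [LinCode.toPoly, X]⟩

theorem cliffPhase_exists_lists {k : ℕ} (P₀ : ℤ) (P₁ P₂ : MvPolynomial (Fin k) ℤ)
    (h₁ : P₁.totalDegree ≤ 1) (h₂ : P₂.totalDegree ≤ 2) :
    ∃ (z : ℤ) (l : List (ℤ × Fin k)) (q : List (ℤ × Fin k × Fin k)),
      cliffPhase z (l.map fun a => C a.1 * X a.2).sum
        (q.map fun a => C a.1 * (X a.2.1 * X a.2.2)).sum = cliffPhase P₀ P₁ P₂ := by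
  let S : AddSubmonoid (PhasePoly k) :=
    { carrier := {p | ∃ (z : ℤ) (l : List (ℤ × Fin k)) (q : List (ℤ × Fin k × Fin k)),
        cliffPhase z (l.map fun a => C a.1 * X a.2).sum
          (q.map fun a => C a.1 * (X a.2.1 * X a.2.2)).sum = p}
      zero_mem' := ⟨0, [], [], by simp [cliffPhase]⟩
      add_mem' := by
        rintro _ _ ⟨z, l, q, rfl⟩ ⟨z', l', q', rfl⟩
        refine ⟨z + z', l ++ l', q ++ q', ?_⟩
        simp only [cliffPhase, List.map_append, List.sum_append, map_add, Int.cast_add]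
        ring }
  have hc : ∀ z : ℤ, (C (1 / 8) * C (z : ℝ) : PhasePoly k) ∈ S := fun z =>
    ⟨z, [], [], by simp [cliffPhase]⟩
  have hl : ∀ (z : ℤ) (i : Fin k), (C (1 / 4) * (C (z : ℝ) * X i) : PhasePoly k) ∈ S := fun z i =>
    ⟨0, [(z, i)], [], by simp [cliffPhase]⟩
  have hq : ∀ (z : ℤ) (i j : Fin k),
      (C (1 / 2) * (C (z : ℝ) * (X i * X j)) : PhasePoly k) ∈ S := fun z i j =>
    ⟨0, [], [(z, i, j)], by simp [cliffPhase]⟩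
  let f (r : ℝ) : MvPolynomial (Fin k) ℤ →+ PhasePoly k :=
    (AddMonoidHom.mulLeft (C r)).comp (MvPolynomial.map (Int.castRingHom ℝ)).toAddMonoidHom
  have hfm : ∀ (r : ℝ) (d : Fin k →₀ ℕ) (z : ℤ),
      f r (monomial d z) = C r * monomial d (z : ℝ) := fun r d z => by
    change C r * MvPolynomial.map (Int.castRingHom ℝ) (monomial d z) = _
    rw [map_monomial]
    rfl
  have e1 : f (1 / 4) P₁ ∈ S := by
    refine sum_monomials_mem (N := 1) S (f (1 / 4)) (fun d hd z => ?_) P₁ h₁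
    rw [hfm]
    rcases finsupp_eq_single_add (N := 0) d hd with rfl | ⟨i, e, rfl, he⟩
    · convert hc (2 * z) using 1
      rw [← C_apply, ← C_mul, ← C_mul]
      congr 1
      push_cast
      ring
    · obtain rfl : e = 0 := (Finsupp.degree_eq_zero_iff e).1 (Nat.le_zero.1 he)
      convert hl z i using 1
      rw [add_zero, C_mul_X_eq_monomial]
  have e2 : f (1 / 2) P₂ ∈ S := by
    refine sum_monomials_mem (N := 2) S (f (1 / 2)) (fun d hd z => ?_) P₂ h₂
    rw [hfm]
    rcases finsupp_eq_single_add (N := 1) d hd with rfl | ⟨i, e, rfl, he⟩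
    · convert hc (4 * z) using 1
      rw [← C_apply, ← C_mul, ← C_mul]
      congr 1
      push_cast
      ring
    · rcases finsupp_eq_single_add (N := 0) e he with rfl | ⟨j, e', rfl, he'⟩
      · convert hl (2 * z) i using 1
        rw [add_zero, ← C_mul_X_eq_monomial, ← mul_assoc, ← mul_assoc, ← C_mul, ← C_mul]
        congr 2
        push_cast
        ring
      · obtain rfl : e' = 0 := (Finsupp.degree_eq_zero_iff e').1 (Nat.le_zero.1 he')
        convert hq z i j using 1
        rw [add_zero]
        congr 1
        rw [← mul_assoc, C_mul_X_eq_monomial, X, monomial_mul, mul_one]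
  exact S.add_mem (S.add_mem (hc P₀) e1) e2

/-- Every morphism of the Clifford fragment is written by some code, up to the identification of
phase polynomials modulo `phaseNull`. -/
theorem CliffCode.exists_toMor {n m : ℕ} (t : CliffMor n m) :
    ∃ c : CliffCode n m, CliffStep t c.toMor := by
  obtain ⟨⟨k, s, P, O, D, I⟩, ⟨p, hp⟩, ⟨P₀, P₁, P₂, h₁, h₂, hP⟩, hO, hD, hI⟩ := t
  obtain ⟨z, l, q, hz⟩ := cliffPhase_exists_lists P₀ P₁ P₂ h₁ h₂
  choose o ho using fun i => LinCode.exists_toPoly (O i) (hO i)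
  choose b hb using fun i => LinCode.exists_toPoly (I i) (hI i)
  choose e he using fun d : {d // d ∈ D} => LinCode.exists_toPoly d.1 (hD d.1 d.2)
  refine ⟨⟨k, p, z, l, q, o, D.attach.toList.map e, b⟩, ?_⟩
  have hDe : ((D.attach.toList.map e).map LinCode.toPoly).toFinset = D := by
    ext d
    simp only [List.map_map, List.mem_toFinset, List.mem_map, Finset.mem_toList,
      Finset.mem_attach, true_and, Function.comp_apply, he, Subtype.exists, exists_prop,
      exists_eq_right]
  obtain rfl : (fun i => (o i).toPoly) = O := funext ho
  obtain rfl : (fun i => (b i).toPoly) = I := funext hb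
  obtain rfl : s = (1 / √2) ^ p := hp
  have key := SOPStep.phase (n := n) (m := m) ((1 / √2) ^ p) P (cliffPhase P₀ P₁ P₂)
    (fun i => (o i).toPoly) D (fun i => (b i).toPoly) hP
  rw [← hz] at key
  change SOPStep _ (SOPTerm.mk _ _ _ _ ((D.attach.toList.map e).map LinCode.toPoly).toFinset _)
  rw [hDe]
  exact key

/-! ### Sizes: number of symbols, numbers being counted with their binary digits -/

/-- Size of a natural number: its number of binary digits, plus one. -/
def natSize (a : ℕ) : ℕ := a.size + 1

/-- Size of an integer. -/
def intSize (a : ℤ) : ℕ := natSize a.natAbs + 1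

/-- Size of a written linear polynomial. -/
def LinCode.size {k : ℕ} (a : LinCode k) : ℕ := 1 + (a.vars.map fun i => natSize i).sum

namespace CliffCode

variable {n m : ℕ}

/-- Size of the phase polynomial. -/
def phaseSize (c : CliffCode n m) : ℕ :=
  intSize c.cst + (c.lin.map fun a => intSize a.1 + natSize a.2).sum +
    (c.quad.map fun a => intSize a.1 + natSize a.2.1 + natSize a.2.2).sum

/-- Combined size of the ket, bra and discarded polynomials. -/
def polySize (c : CliffCode n m) : ℕ :=
  ∑ i, (c.ket i).size + ∑ i, (c.bra i).size + (c.disc.map LinCode.size).sum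

/-- Number of binary digits of the number of summed variables and of the exponent in the scalar. -/
def headSize (c : CliffCode n m) : ℕ := natSize c.k + intSize c.p

end CliffCode

/-! ## Programs and their running time -/

/-- Data: binary trees. -/
inductive BinTree : Type
  | nil : BinTree
  | cons : BinTree → BinTree → BinTree

namespace BinTree

/-- Number of nodes. -/
def size : BinTree → ℕ
  | nil => 1
  | cons a b => a.size + b.size + 1

/-- First component. -/
def hd : BinTree → BinTree
  | nil => nil
  | cons a _ => a

/-- Second component. -/
def tl : BinTree → BinTree
  | nil => nil
  | cons _ b => b

/-- Booleans as trees. -/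
def ofBool : Bool → BinTree
  | false => nil
  | true => cons nil nil

/-- Lists as trees. -/
def ofList : List BinTree → BinTree
  | [] => nil
  | a :: l => cons a (ofList l)

/-- Natural numbers as lists of binary digits, least significant digit first. -/
def ofNat (a : ℕ) : BinTree := ofList (a.bits.map ofBool)

/-- Integers as sign and absolute value. -/
def ofInt (a : ℤ) : BinTree := cons (ofBool (decide (a < 0))) (ofNat a.natAbs)

end BinTree

/-- Contents of the variables of a program. -/
abbrev Store : Type := ℕ → BinTree

/-- Expressions of the programming language. -/
inductive Expr : Type
  | var : ℕ → Expr
  | nil : Expr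
  | cons : Expr → Expr → Expr
  | hd : Expr → Expr
  | tl : Expr → Expr

namespace Expr

/-- Value of an expression. -/
def eval (σ : Store) : Expr → BinTree
  | var i => σ i
  | nil => .nil
  | cons a b => .cons (a.eval σ) (b.eval σ)
  | hd a => (a.eval σ).hd
  | tl a => (a.eval σ).tl

/-- Number of steps for evaluating an expression: every subexpression costs the size of its value,
so that copying a tree is not free. -/
def cost (σ : Store) : Expr → ℕ
  | var i => (σ i).size
  | nil => 1
  | cons a b => a.cost σ + b.cost σ + (BinTree.cons (a.eval σ) (b.eval σ)).size
  | hd a => a.cost σ + (a.eval σ).hd.size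
  | tl a => a.cost σ + (a.eval σ).tl.size

end Expr

/-- Programs: assignments, composition, branching and loops.  A tree counts as true when it is not
`nil`. -/
inductive Prog : Type
  | skip : Prog
  | assign : ℕ → Expr → Prog
  | seq : Prog → Prog → Prog
  | cond : Expr → Prog → Prog → Prog
  | loop : Expr → Prog → Prog

/-- `Runs c σ T σ'`: started with the store `σ`, the program `c` halts after exactly `T` steps with
the store `σ'`. -/
inductive Prog.Runs : Prog → Store → ℕ → Store → Prop
  | skip (σ : Store) : Runs .skip σ 1 σ
  | assign (σ : Store) (i : ℕ) (e : Expr) :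
      Runs (.assign i e) σ (e.cost σ) (Function.update σ i (e.eval σ))
  | seq {c d : Prog} {σ σ' σ'' : Store} {T T' : ℕ} (hc : Runs c σ T σ') (hd : Runs d σ' T' σ'') :
      Runs (.seq c d) σ (T + T') σ''
  | condTrue {e : Expr} {c d : Prog} {σ σ' : Store} {T : ℕ} (he : e.eval σ ≠ .nil)
      (hc : Runs c σ T σ') : Runs (.cond e c d) σ (e.cost σ + T) σ'
  | condFalse {e : Expr} {c d : Prog} {σ σ' : Store} {T : ℕ} (he : e.eval σ = .nil)
      (hd : Runs d σ T σ') : Runs (.cond e c d) σ (e.cost σ + T) σ'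
  | loopDone {e : Expr} {c : Prog} {σ : Store} (he : e.eval σ = .nil) :
      Runs (.loop e c) σ (e.cost σ) σ
  | loopStep {e : Expr} {c : Prog} {σ σ' σ'' : Store} {T T' : ℕ} (he : e.eval σ ≠ .nil)
      (hc : Runs c σ T σ') (hl : Runs (.loop e c) σ' T' σ'') :
      Runs (.loop e c) σ (e.cost σ + T + T') σ''

/-- On the input `x` (variable `0`, all others being `nil`) the program halts after exactly `T`
steps with the output `y` (variable `0`). -/
def Prog.HaltsWith (c : Prog) (x y : BinTree) (T : ℕ) : Prop :=
  ∃ σ' : Store, c.Runs (Function.update (fun _ => BinTree.nil) 0 x) T σ' ∧ σ' 0 = y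

/-! ### Written terms as input of programs -/

/-- A written linear polynomial as a tree. -/
def LinCode.toTree {k : ℕ} (a : LinCode k) : BinTree :=
  .cons (.ofBool a.cst) (.ofList (a.vars.map fun i => .ofNat i))

/-- A written term as a tree. -/
def CliffCode.toTree {n m : ℕ} (c : CliffCode n m) : BinTree :=
  .ofList [.ofNat c.k, .ofInt c.p, .ofInt c.cst,
    .ofList (c.lin.map fun a => .cons (.ofInt a.1) (.ofNat a.2)),
    .ofList (c.quad.map fun a => .cons (.ofInt a.1) (.cons (.ofNat a.2.1) (.ofNat a.2.2))),
    .ofList (List.ofFn fun i => (c.ket i).toTree),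
    .ofList (c.disc.map LinCode.toTree),
    .ofList (List.ofFn fun i => (c.bra i).toTree)]

/-! ## Functions computed in polynomial time -/

/-! A term is interpreted as the matrix of a completely positive map (`SumData.sem`): the entry at
`(a, b)` sums `w y * conj (w y')` over the pairs of assignments whose ket and bra values are `a` and
`b` and which agree on all discarded polynomials. This matrix is a complete invariant of the
equivalence relation (`mk_eq_iff_sem`), and equality of two such matrices is tested with three Gauss
sums.

Soundness (`sound`): a rule reindexes the sum, sums out a variable, or changes a phase that cancels
against its conjugate because it is a function of discarded values.

Completeness (`SumData.rel_of_sem_eq`): the class of a term depends only on the functions that its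
polynomials define, an affine ket and bra, a quadratic phase and affine discards
(`SumData.HasClass.unique`). The rules generate all invertible affine changes of variables
(`SumData.rel_comap`), all changes of the discards that preserve the relation `SameDisc`
(`SumData.rel_disc_congr`) and the removal of phases that depend on discarded values only
(`SumData.rel_of_invariant`). If ket and bra do not separate assignments, some direction is
invisible to them; once it is a coordinate, the rules remove it or the sum is zero
(`SumData.exists_rel`). So every sum is zero or has a jointly injective ket and bra
(`SumData.exists_normalForm`), and in the injective case scalar, relation and phase differences can
be read off from the matrix (`SumData.rel_of_sem_eq_of_injective`).

Decision: `f = g` if and only if `⟨f, f⟩ = ⟨f, g⟩ = ⟨g, g⟩` (`eq_iff_matrixInner`). The inner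
product of two terms is a sum over four assignments subject to linear equations. Imposing each
equation `c = 0` by a new variable `u` with the sign `(-1) ^ (u c)` (`gaussSum_constraints`) yields
a sum of `i ^ Q(x)` for a symmetric matrix `Q` modulo 4. Symmetric elimination with pivots of size
one or two (`elimStep_spec`, `gaussEval_spec`) evaluates it to zero or to a power of `√2` times an
eighth root of unity (`matrixInner_eq`), and such values are compared through integers.

Running time: `PolyTime` is closed under composition, branching and bounded folds. Two facts keep
the bounds polynomial. An elimination step prepends at most four products of rows whose size depends
on the list of names and not on the current form (`PolyTime.tsize_elimStep_le`). And only names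
occurring in the written polynomials are eliminated: the number of summed variables, being written
in binary, may be exponentially larger, but it enters only through the exponent of `√2`. -/

theorem Polynomial.eval_le_eval_nat (q : Polynomial ℕ) {a b : ℕ} (h : a ≤ b) :
    q.eval a ≤ q.eval b := by
  rw [Polynomial.eval_eq_sum_range, Polynomial.eval_eq_sum_range]
  gcongr

namespace BinTree

theorem size_pos (a : BinTree) : 0 < a.size := by cases a <;> simp [size]

theorem size_hd_le (a : BinTree) : a.hd.size ≤ a.size := by
  cases a <;> simp only [hd, size] <;> omega

theorem size_tl_le (a : BinTree) : a.tl.size ≤ a.size := by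
  cases a <;> simp only [tl, size] <;> omega

theorem size_ofBool_le (b : Bool) : (ofBool b).size ≤ 3 := by cases b <;> simp [ofBool, size]

theorem ofBool_injective : Function.Injective ofBool := by
  intro a b; cases a <;> cases b <;> simp [ofBool]

theorem ofList_injective : Function.Injective ofList
  | [], [], _ => rfl
  | [], _ :: _, h => by simp [ofList] at h
  | _ :: _, [], h => by simp [ofList] at h
  | a :: l, b :: l', h => by
    simp only [ofList, cons.injEq] at h
    rw [h.1, ofList_injective h.2]

end BinTree

theorem Expr.size_eval_le_cost (σ : Store) (e : Expr) : (e.eval σ).size ≤ e.cost σ := by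
  cases e <;> simp only [Expr.eval, Expr.cost, BinTree.size] <;> omega

/-- Types whose elements are written as trees. -/
class Enc (α : Type) where
  enc : α → BinTree
  inj : Function.Injective enc

open Enc

instance : Enc BinTree := ⟨id, Function.injective_id⟩
instance : Enc Unit := ⟨fun _ => .nil, fun _ _ _ => rfl⟩
instance : Enc Bool := ⟨.ofBool, BinTree.ofBool_injective⟩
instance {α β : Type} [Enc α] [Enc β] : Enc (α × β) :=
  ⟨fun x => .cons (enc x.1) (enc x.2), fun _ _ h => by
    simp only [BinTree.cons.injEq] at h
    exact Prod.ext (inj h.1) (inj h.2)⟩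
instance {α : Type} [Enc α] : Enc (List α) :=
  ⟨fun l => .ofList (l.map enc), fun _ _ h =>
    List.map_injective_iff.2 inj (BinTree.ofList_injective h)⟩

theorem Nat.bits_injective : Function.Injective Nat.bits := by
  intro a b h
  have := congrArg (fun l => l.foldr (fun b n => Nat.bit b n) 0) h
  have key : ∀ n : ℕ, n.bits.foldr (fun b n => Nat.bit b n) 0 = n := by
    intro n
    induction n using Nat.binaryRec' with
    | zero => simp
    | bit b n hb ih => rw [Nat.bits_append_bit _ _ hb, List.foldr_cons, ih]
  simpa only [key] using this

instance : Enc ℕ := ⟨.ofNat, fun _ _ h => Nat.bits_injective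
  (List.map_injective_iff.2 BinTree.ofBool_injective (BinTree.ofList_injective h))⟩
instance : Enc ℤ := ⟨.ofInt, fun a b h => by
  simp only [BinTree.ofInt, BinTree.cons.injEq] at h
  have h1 : decide (a < 0) = decide (b < 0) := BinTree.ofBool_injective h.1
  have h2 : a.natAbs = b.natAbs := (inferInstance : Enc ℕ).inj h.2
  rw [decide_eq_decide] at h1
  omega⟩

instance {α : Type} [Enc α] {p : α → Prop} : Enc {a // p a} :=
  ⟨fun a => enc a.1, fun _ _ h => Subtype.ext (inj h)⟩

theorem enc_true_ne : enc true ≠ .nil := fun h => BinTree.noConfusion h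

/-- Size of the written form. -/
def tsize {α : Type} [Enc α] (a : α) : ℕ := (enc a).size

/-- The program `c` computes `f` in the register `r`, keeping the registers below, in time `q`. -/
def ComputesAt {α β : Type} [Enc α] [Enc β] (f : α → β) (q : Polynomial ℕ) (r : ℕ) (c : Prog) :
    Prop :=
  ∀ (σ : Store) (a : α), σ r = enc a → ∃ (T : ℕ) (σ' : Store), c.Runs σ T σ' ∧
    σ' r = enc (f a) ∧ (∀ i < r, σ' i = σ i) ∧ T ≤ q.eval (tsize a)

/-- Functions computed in polynomial time. -/
def PolyTime {α β : Type} [Enc α] [Enc β] (f : α → β) : Prop :=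
  ∃ q : Polynomial ℕ, (∀ a, tsize (f a) ≤ q.eval (tsize a)) ∧ ∀ r, ∃ c, ComputesAt f q r c

namespace PolyTime

section basic

variable {α β γ δ : Type} [Enc α] [Enc β] [Enc γ] [Enc δ]

theorem of_expr {f : α → β} (e : ℕ → Expr) (q : Polynomial ℕ)
    (h : ∀ r σ a, σ r = enc a → (e r).eval σ = enc (f a) ∧ (e r).cost σ ≤ q.eval (tsize a)) :
    PolyTime f := by
  refine ⟨q, fun a => ?_, fun r => ⟨.assign r (e r), fun σ a ha => ?_⟩⟩
  · obtain ⟨h1, h2⟩ := h 0 (fun _ => enc a) a rfl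
    exact ((congrArg BinTree.size h1).symm.le.trans (Expr.size_eval_le_cost _ _)).trans h2
  · obtain ⟨h1, h2⟩ := h r σ a ha
    refine ⟨_, _, .assign σ r (e r), ?_, fun i hi => ?_, h2⟩
    · rw [Function.update_self, h1]
    · rw [Function.update_of_ne hi.ne]

/-- A program sees only trees, so a function can be replaced by any other one that acts in the same
way on encodings. Changes of type (subtypes, lists seen as trees, integers seen as pairs) are
therefore free. -/
theorem of_enc_eq {f : α → β} {g : γ → δ} (hf : PolyTime f) (e : γ → α)
    (h1 : ∀ c, enc (e c) = enc c) (h2 : ∀ c, enc (f (e c)) = enc (g c)) : PolyTime g := by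
  obtain ⟨q, hq, hc⟩ := hf
  refine ⟨q, fun c => ?_, fun r => ?_⟩
  · have := hq (e c)
    unfold tsize at *
    rwa [h2, h1] at this
  · obtain ⟨p, hp⟩ := hc r
    refine ⟨p, fun σ a ha => ?_⟩
    obtain ⟨T, σ', h3, h4, h5, h6⟩ := hp σ (e a) (by rw [ha, h1])
    refine ⟨T, σ', h3, by rw [h4, h2], h5, ?_⟩
    unfold tsize at *
    rwa [h1] at h6

protected theorem id : PolyTime (fun a : α => a) :=
  of_expr .var .X fun r σ a h => by simp [Expr.eval, Expr.cost, h, tsize]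

theorem tree_hd : PolyTime BinTree.hd :=
  of_expr (fun r => .hd (.var r)) (.X + .X) fun r σ a h => by
    simp only [Expr.eval, Expr.cost, h, Polynomial.eval_add, Polynomial.eval_X]
    exact ⟨rfl, add_le_add_right (BinTree.size_hd_le _) _⟩

theorem tree_tl : PolyTime BinTree.tl :=
  of_expr (fun r => .tl (.var r)) (.X + .X) fun r σ a h => by
    simp only [Expr.eval, Expr.cost, h, Polynomial.eval_add, Polynomial.eval_X]
    exact ⟨rfl, add_le_add_right (BinTree.size_tl_le _) _⟩

protected theorem fst : PolyTime (Prod.fst : α × β → α) :=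
  of_expr (fun r => .hd (.var r)) (.X + .X) fun r σ a h => by
    simp only [Expr.eval, Expr.cost, h, Polynomial.eval_add, Polynomial.eval_X]
    exact ⟨rfl, add_le_add_right (BinTree.size_hd_le _) _⟩

protected theorem snd : PolyTime (Prod.snd : α × β → β) :=
  of_expr (fun r => .tl (.var r)) (.X + .X) fun r σ a h => by
    simp only [Expr.eval, Expr.cost, h, Polynomial.eval_add, Polynomial.eval_X]
    exact ⟨rfl, add_le_add_right (BinTree.size_tl_le _) _⟩

/-- The expression that evaluates to a given tree. -/
def constExpr : BinTree → Expr
  | .nil => .nil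
  | .cons a b => .cons (constExpr a) (constExpr b)

theorem eval_constExpr (σ : Store) : ∀ t, (constExpr t).eval σ = t
  | .nil => rfl
  | .cons a b => by simp [constExpr, Expr.eval, eval_constExpr σ a, eval_constExpr σ b]

theorem cost_constExpr (σ σ' : Store) : ∀ t, (constExpr t).cost σ = (constExpr t).cost σ'
  | .nil => rfl
  | .cons a b => by
    simp [constExpr, Expr.cost, cost_constExpr σ σ' a, cost_constExpr σ σ' b, eval_constExpr]

protected theorem const (b : β) : PolyTime (fun _ : α => b) :=
  of_expr (fun _ => constExpr (enc b)) (.C ((constExpr (enc b)).cost fun _ => .nil))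
    fun r σ a h => by
      simp only [eval_constExpr, Polynomial.eval_C, true_and]
      exact (cost_constExpr _ _ _).le

theorem comp {g : β → γ} {f : α → β} (hg : PolyTime g) (hf : PolyTime f) :
    PolyTime (fun a => g (f a)) := by
  obtain ⟨qf, hqf, hf⟩ := hf
  obtain ⟨qg, hqg, hg⟩ := hg
  refine ⟨qf + qg.comp qf, fun a => ?_, fun r => ?_⟩
  · rw [Polynomial.eval_add, Polynomial.eval_comp]
    exact ((hqg _).trans (qg.eval_le_eval_nat (hqf a))).trans (Nat.le_add_left _ _)
  · obtain ⟨cf, hcf⟩ := hf r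
    obtain ⟨cg, hcg⟩ := hg r
    refine ⟨.seq cf cg, fun σ a ha => ?_⟩
    obtain ⟨T, σ', h1, h2, h3, h4⟩ := hcf σ a ha
    obtain ⟨T', σ'', h1', h2', h3', h4'⟩ := hcg σ' (f a) h2
    refine ⟨_, _, .seq h1 h1', h2', fun i hi => (h3' i hi).trans (h3 i hi), ?_⟩
    rw [Polynomial.eval_add, Polynomial.eval_comp]
    exact add_le_add h4 (h4'.trans (qg.eval_le_eval_nat (hqf a)))

/-- The input is copied to the scratch registers `r + 1` and `r + 2`. A program working in register
`r + 2` leaves `r + 1` alone, so the first result survives the second computation. -/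
theorem pair {f : α → β} {g : α → γ} (hf : PolyTime f) (hg : PolyTime g) :
    PolyTime (fun a => (f a, g a)) := by
  obtain ⟨qf, hqf, hf⟩ := hf
  obtain ⟨qg, hqg, hg⟩ := hg
  refine ⟨.X + qf + (.X + qg) + (qf + qg + (qf + qg + 1)), fun a => ?_, fun r => ?_⟩
  · have h1 := hqf a
    have h2 := hqg a
    simp only [Polynomial.eval_add, Polynomial.eval_X, Polynomial.eval_one]
    change (enc (f a)).size + (enc (g a)).size + 1 ≤ _
    unfold tsize at *
    omega
  · obtain ⟨cf, hcf⟩ := hf (r + 1)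
    obtain ⟨cg, hcg⟩ := hg (r + 2)
    refine ⟨.seq (.seq (.seq (.assign (r + 1) (.var r)) cf) (.seq (.assign (r + 2) (.var r)) cg))
      (.assign r (.cons (.var (r + 1)) (.var (r + 2)))), fun σ a ha => ?_⟩
    obtain ⟨T, σ', h1, h2, h3, h4⟩ := hcf (Function.update σ (r + 1) ((Expr.var r).eval σ)) a
      (by simpa [Expr.eval] using ha)
    have hr : σ' r = enc a := by
      rw [h3 r (by omega), Function.update_of_ne (by omega), ha]
    obtain ⟨T', σ'', h1', h2', h3', h4'⟩ := hcg
      (Function.update σ' (r + 2) ((Expr.var r).eval σ')) a (by simpa [Expr.eval] using hr)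
    have hr' : σ'' (r + 1) = enc (f a) := by
      rw [h3' _ (by omega), Function.update_of_ne (by omega), h2]
    refine ⟨_, _, .seq (.seq (.seq (.assign _ _ _) h1) (.seq (.assign _ _ _) h1'))
      (.assign _ _ _), ?_, fun i hi => ?_, ?_⟩
    · simp [Expr.eval, hr', h2', enc]
    · rw [Function.update_of_ne hi.ne, h3' _ (by omega), Function.update_of_ne (by omega),
        h3 _ (by omega), Function.update_of_ne (by omega)]
    · have e1 := hqf a
      have e2 := hqg a
      simp only [Polynomial.eval_add, Polynomial.eval_X, Polynomial.eval_one, Expr.cost, Expr.eval,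
        ha, hr, hr', h2', BinTree.size]
      unfold tsize at *
      omega

/-- Each branch has to agree with `F` only where its test applies. Working on subtypes makes partial
operations, such as the head of a list, available under a guard. -/
theorem cond_on {b : α → Bool} {F : α → β} (hb : PolyTime b)
    (hf : PolyTime fun a : {a // b a = true} => F a)
    (hg : PolyTime fun a : {a // b a = false} => F a) : PolyTime F := by
  obtain ⟨qf, hqf, hf⟩ := hf
  obtain ⟨qg, hqg, hg⟩ := hg
  obtain ⟨qb, hqb, hb⟩ := hb
  refine ⟨.X + qb + (3 + (qf + qg)), fun a => ?_, fun r => ?_⟩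
  · simp only [Polynomial.eval_add, Polynomial.eval_X, Polynomial.eval_ofNat]
    cases hba : b a with
    | true =>
      have := hqf ⟨a, hba⟩
      change tsize (F a) ≤ qf.eval (tsize a) at this
      omega
    | false =>
      have := hqg ⟨a, hba⟩
      change tsize (F a) ≤ qg.eval (tsize a) at this
      omega
  · obtain ⟨cf, hcf⟩ := hf r
    obtain ⟨cg, hcg⟩ := hg r
    obtain ⟨cb, hcb⟩ := hb (r + 1)
    refine ⟨.seq (.seq (.assign (r + 1) (.var r)) cb) (.cond (.var (r + 1)) cf cg),
      fun σ a ha => ?_⟩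
    obtain ⟨T, σ', h1, h2, h3, h4⟩ := hcb (Function.update σ (r + 1) ((Expr.var r).eval σ)) a
      (by simpa [Expr.eval] using ha)
    have hr : σ' r = enc a := by
      rw [h3 r (by omega), Function.update_of_ne (by omega), ha]
    have hfr : ∀ i < r, σ' i = σ i := fun i hi => by
      rw [h3 i (by omega), Function.update_of_ne (by omega)]
    have hc : (Expr.var (r + 1)).cost σ' ≤ 3 := by
      simp only [Expr.cost, h2]
      exact BinTree.size_ofBool_le _
    have ha' : (Expr.var r).cost σ = tsize a := by simp only [Expr.cost, ha, tsize]
    cases hba : b a with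
    | true =>
      obtain ⟨T', σ'', h1', h2', h3', h4'⟩ := hcf σ' ⟨a, hba⟩ hr
      refine ⟨_, _, .seq (.seq (.assign _ _ _) h1) (.condTrue ?_ h1'), h2',
        fun i hi => (h3' i hi).trans (hfr i hi), ?_⟩
      · simp only [Expr.eval, h2, hba]
        exact enc_true_ne
      · change T' ≤ qf.eval (tsize a) at h4'
        simp only [Polynomial.eval_add, Polynomial.eval_X, Polynomial.eval_ofNat]
        omega
    | false =>
      obtain ⟨T', σ'', h1', h2', h3', h4'⟩ := hcg σ' ⟨a, hba⟩ hr
      refine ⟨_, _, .seq (.seq (.assign _ _ _) h1) (.condFalse ?_ h1'), h2',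
        fun i hi => (h3' i hi).trans (hfr i hi), ?_⟩
      · simp only [Expr.eval, h2, hba]
        rfl
      · change T' ≤ qg.eval (tsize a) at h4'
        simp only [Polynomial.eval_add, Polynomial.eval_X, Polynomial.eval_ofNat]
        omega

theorem subtype_val {p : α → Prop} : PolyTime (Subtype.val : {a // p a} → α) :=
  of_enc_eq .id Subtype.val (fun _ => rfl) fun _ => rfl

theorem subtype_mk {p : β → Prop} {f : α → β} (hf : PolyTime f) (h : ∀ a, p (f a)) :
    PolyTime fun a => (⟨f a, h a⟩ : {b // p b}) :=
  of_enc_eq hf id (fun _ => rfl) fun _ => rfl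

theorem cond {b : α → Bool} {f g : α → β} (hb : PolyTime b) (hf : PolyTime f) (hg : PolyTime g) :
    PolyTime (fun a => if b a then f a else g a) :=
  cond_on hb (of_enc_eq hf Subtype.val (fun _ => rfl) fun a => by simp [a.2])
    (of_enc_eq hg Subtype.val (fun _ => rfl) fun a => by simp [a.2])

/-- Since `M` bounds all intermediate values, every round has the same cost bound. The constant `3`
is the largest size of an encoded Boolean, which is what reading the test register costs. -/
theorem loop_runs {test : α → Bool} {body : α → α} {qb qt : Polynomial ℕ} {r : ℕ} {cb ct : Prog}
    (hb : ComputesAt body qb r cb) (ht : ComputesAt test qt (r + 1) ct) (M : ℕ) (n : ℕ) :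
    ∀ (a : α) (σ : Store), σ r = enc a → σ (r + 1) = enc (test a) →
      (∀ i < n, test (body^[i] a) = true) → test (body^[n] a) = false →
      (∀ i ≤ n, tsize (body^[i] a) ≤ M) →
      ∃ T σ', (Prog.loop (.var (r + 1)) (.seq cb (.seq (.assign (r + 1) (.var r)) ct))).Runs σ T σ' ∧
        σ' r = enc (body^[n] a) ∧ (∀ i < r, σ' i = σ i) ∧
        T ≤ 3 + n * (3 + (qb.eval M + (M + qt.eval M))) := by
  induction n with
  | zero =>
    intro a σ h1 h2 h3 h4 h5
    refine ⟨_, σ, .loopDone ?_, h1, fun _ _ => rfl, ?_⟩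
    · simp only [Expr.eval, h2]
      exact congrArg BinTree.ofBool h4
    · simp only [Expr.cost, h2, zero_mul, add_zero]
      exact BinTree.size_ofBool_le _
  | succ n ih =>
    intro a σ h1 h2 h3 h4 h5
    have hta : test a = true := h3 0 n.succ_pos
    obtain ⟨T, σ₁, a1, a2, a3, a4⟩ := hb σ a h1
    obtain ⟨T', σ₂, b1, b2, b3, b4⟩ := ht (Function.update σ₁ (r + 1) ((Expr.var r).eval σ₁))
      (body a) (by simpa [Expr.eval] using a2)
    have hr : σ₂ r = enc (body a) := by
      rw [b3 r (by omega), Function.update_of_ne (by omega), a2]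
    obtain ⟨T'', σ₃, c1, c2, c3, c4⟩ := ih (body a) σ₂ hr b2
      (fun i hi => h3 (i + 1) (by omega)) h4 (fun i hi => h5 (i + 1) (by omega))
    refine ⟨_, σ₃, .loopStep ?_ (.seq a1 (.seq (.assign _ _ _) b1)) c1, c2, fun i hi => ?_, ?_⟩
    · simp only [Expr.eval, h2, hta]
      exact enc_true_ne
    · rw [c3 i hi, b3 i (by omega), Function.update_of_ne (by omega), a3 i hi]
    · have e1 : (Expr.var (r + 1)).cost σ ≤ 3 := by
        simp only [Expr.cost, h2]
        exact BinTree.size_ofBool_le _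
      have e2 : (Expr.var r).cost σ₁ ≤ M := by
        simp only [Expr.cost, a2]
        exact h5 1 (by omega)
      have e3 := qb.eval_le_eval_nat (h5 0 (by omega))
      have e4 := qt.eval_le_eval_nat (h5 1 (by omega))
      simp only [Function.iterate_zero, Function.iterate_one, id] at e3 e4
      rw [Nat.succ_mul]
      omega

/-- Polynomially many rounds of a polynomial-time body need not be polynomial, because values could
grow from round to round. Hence the hypothesis bounds both the number of rounds and all intermediate
values by `B`. -/
theorem while_loop {test : α → Bool} {body F : α → α} (ht : PolyTime test) (hb : PolyTime body)
    (B : Polynomial ℕ)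
    (h : ∀ a, ∃ n, n ≤ B.eval (tsize a) ∧ (∀ i < n, test (body^[i] a) = true) ∧
      test (body^[n] a) = false ∧ (∀ i ≤ n, tsize (body^[i] a) ≤ B.eval (tsize a)) ∧
      F a = body^[n] a) : PolyTime F := by
  obtain ⟨qb, hqb, hb⟩ := hb
  obtain ⟨qt, hqt, ht⟩ := ht
  refine ⟨.X + qt + (3 + B * (3 + (qb.comp B + (B + qt.comp B)))) + B, fun a => ?_, fun r => ?_⟩
  · obtain ⟨n, h1, h2, h3, h4, h5⟩ := h a
    rw [h5, Polynomial.eval_add]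
    exact (h4 n le_rfl).trans (Nat.le_add_left _ _)
  · obtain ⟨cb, hcb⟩ := hb r
    obtain ⟨ct, hct⟩ := ht (r + 1)
    refine ⟨.seq (.seq (.assign (r + 1) (.var r)) ct) (.loop (.var (r + 1)) (.seq cb
      (.seq (.assign (r + 1) (.var r)) ct))), fun σ a ha => ?_⟩
    obtain ⟨n, h1, h2, h3, h4, h5⟩ := h a
    obtain ⟨T', σ₂, b1, b2, b3, b4⟩ := hct (Function.update σ (r + 1) ((Expr.var r).eval σ))
      a (by simpa [Expr.eval] using ha)
    have hr : σ₂ r = enc a := by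
      rw [b3 r (by omega), Function.update_of_ne (by omega), ha]
    obtain ⟨T'', σ₃, c1, c2, c3, c4⟩ := loop_runs hcb hct _ n a σ₂ hr b2 h2 h3 h4
    refine ⟨_, σ₃, .seq (.seq (.assign _ _ _) b1) c1, by rw [c2, h5], fun i hi => ?_, ?_⟩
    · rw [c3 i hi, b3 i (by omega), Function.update_of_ne (by omega)]
    · have e1 : (Expr.var r).cost σ = tsize a := by simp only [Expr.cost, ha, tsize]
      have e2 := Nat.mul_le_mul_right
        (3 + (qb.eval (B.eval (tsize a)) + (B.eval (tsize a) + qt.eval (B.eval (tsize a))))) h1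
      simp only [Polynomial.eval_add, Polynomial.eval_X, Polynomial.eval_mul, Polynomial.eval_comp,
        Polynomial.eval_ofNat]
      omega

end basic
end PolyTime


/-- Whether a tree is `nil`. -/
def BinTree.isNil : BinTree → Bool
  | .nil => true
  | .cons _ _ => false

/-! ### Sizes of encoded pairs and lists -/

section size

variable {α β : Type} [Enc α] [Enc β]

theorem tsize_pos (a : α) : 0 < tsize a := BinTree.size_pos _

theorem tsize_pair (a : α) (b : β) : tsize (a, b) = tsize a + tsize b + 1 := rfl

theorem tsize_fst_le (x : α × β) : tsize x.1 ≤ tsize x := by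
  have := tsize_pair x.1 x.2
  rw [Prod.mk.eta] at this
  omega

theorem tsize_snd_le (x : α × β) : tsize x.2 ≤ tsize x := by
  have := tsize_pair x.1 x.2
  rw [Prod.mk.eta] at this
  omega

theorem tsize_nil : tsize ([] : List α) = 1 := rfl

theorem tsize_cons (a : α) (l : List α) : tsize (a :: l) = tsize a + tsize l + 1 := rfl

theorem tsize_append (l l' : List α) : tsize (l ++ l') + 1 = tsize l + tsize l' := by
  induction l with
  | nil => rw [List.nil_append, tsize_nil, add_comm]
  | cons a l ih => rw [List.cons_append, tsize_cons, tsize_cons]; omega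

theorem tsize_le_of_mem {a : α} {l : List α} (h : a ∈ l) : tsize a ≤ tsize l := by
  induction l with
  | nil => simp at h
  | cons b l ih =>
    rw [tsize_cons]
    rcases List.mem_cons.1 h with rfl | h
    · omega
    · have := ih h
      omega

theorem length_le_tsize (l : List α) : l.length ≤ tsize l := by
  induction l with
  | nil => simp
  | cons b l ih => rw [tsize_cons, List.length_cons]; omega

theorem tsize_list_le {l : List α} {K : ℕ} (h : ∀ a ∈ l, tsize a ≤ K) :
    tsize l ≤ l.length * (K + 1) + 1 := by
  induction l with
  | nil => simp [tsize_nil]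
  | cons b l ih =>
    have h1 := h b (by simp)
    have h2 := ih fun a ha => h a (by simp [ha])
    rw [tsize_cons, List.length_cons, Nat.succ_mul]
    omega

theorem tsize_bool_le (b : Bool) : tsize b ≤ 3 := BinTree.size_ofBool_le b

end size

/-! ### Folds, maps and other operations on lists -/

namespace PolyTime

section fold

variable {Γ A β : Type} [Enc Γ] [Enc A] [Enc β]

theorem foldl_head {p : (Γ × β) × List A → Prop} (hp : ∀ x, p x → x.2 ≠ []) :
    PolyTime fun x : {x // p x} => x.1.2.head (hp _ x.2) :=
  of_expr (fun r => .hd (.tl (.var r))) (.X + (.X + .X)) fun r σ a h => by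
    simp only [Expr.eval, Expr.cost, h, Polynomial.eval_add, Polynomial.eval_X]
    have e1 := BinTree.size_tl_le (enc a)
    have e2 := BinTree.size_hd_le (enc a).tl
    refine ⟨?_, by unfold tsize; omega⟩
    obtain ⟨⟨⟨_, _⟩, l⟩, hl⟩ := a
    cases l with
    | nil => exact absurd rfl (hp _ hl)
    | cons a l => rfl

theorem list_tail : PolyTime (List.tail : List A → List A) :=
  of_expr (fun r => .tl (.var r)) (.X + .X) fun r σ a h => by
    simp only [Expr.eval, Expr.cost, h, Polynomial.eval_add, Polynomial.eval_X]
    refine ⟨?_, add_le_add_right (BinTree.size_tl_le _) _⟩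
    cases a <;> rfl

theorem cons {f : Γ → A} {g : Γ → List A} (hf : PolyTime f) (hg : PolyTime g) :
    PolyTime fun x => f x :: g x :=
  of_enc_eq (hf.pair hg) id (fun _ => rfl) fun _ => rfl

theorem not {b : Γ → Bool} (hb : PolyTime b) : PolyTime fun x => !b x :=
  of_enc_eq (cond hb (.const false) (.const true)) id (fun _ => rfl) fun c => by
    cases h : b c <;> simp [h]

theorem tree_isNil : PolyTime BinTree.isNil := by
  refine ⟨.X + 5, fun a => ?_, fun r => ⟨.cond (.var r) (.assign r .nil)
    (.assign r (.cons .nil .nil)), fun σ a ha => ?_⟩⟩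
  · simp only [Polynomial.eval_add, Polynomial.eval_X, Polynomial.eval_ofNat]
    exact (tsize_bool_le _).trans (Nat.le_add_left _ _)
  · cases a with
    | nil =>
      refine ⟨_, _, .condFalse ha (.assign _ _ _), ?_, fun i hi => ?_, ?_⟩
      · rw [Function.update_self]; rfl
      · rw [Function.update_of_ne hi.ne]
      · rw [Expr.cost, Expr.cost, ha]
        simp only [Polynomial.eval_add, Polynomial.eval_X, Polynomial.eval_ofNat]
        exact add_le_add_right (by simp [Expr.cost, Expr.eval, BinTree.size]) _
    | cons a b =>
      refine ⟨_, _, .condTrue (fun h => ?_) (.assign _ _ _), ?_, fun i hi => ?_, ?_⟩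
      · simp only [Expr.eval, ha] at h
        exact BinTree.noConfusion h
      · rw [Function.update_self]; rfl
      · rw [Function.update_of_ne hi.ne]
      · rw [Expr.cost, ha]
        simp only [Expr.cost, Polynomial.eval_add, Polynomial.eval_X, Polynomial.eval_ofNat]
        exact add_le_add_right (by norm_num) _

theorem list_isEmpty : PolyTime (List.isEmpty : List A → Bool) :=
  of_enc_eq (tree_isNil.comp (of_enc_eq .id enc (fun _ => rfl) (fun _ => rfl) :
    PolyTime fun l : List A => enc l)) id (fun _ => rfl) fun c => by cases c <;> rfl

theorem foldl {step : Γ → β → A → β} {init : Γ → β} {l : Γ → List A}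
    (hs : PolyTime fun x : (Γ × β) × A => step x.1.1 x.1.2 x.2) (hi : PolyTime init)
    (hl : PolyTime l) (B : Polynomial ℕ)
    (hB : ∀ γ l', l' <+: l γ → tsize (l'.foldl (step γ) (init γ)) ≤ B.eval (tsize γ)) :
    PolyTime fun γ => (l γ).foldl (step γ) (init γ) := by
  -- The states of the loop are restricted to those reached after a prefix of the list, so that `hB`
  -- bounds the accumulator in every round.
  let p : (Γ × β) × List A → Prop := fun x =>
    ∃ l', l' ++ x.2 = l x.1.1 ∧ x.1.2 = l'.foldl (step x.1.1) (init x.1.1)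
  let S : Type := {x // p x}
  let test : S → Bool := fun x => !x.1.2.isEmpty
  have hne : ∀ x : {x : S // test x = true}, x.1.1.2 ≠ [] := fun x h => by
    have := x.2
    simp [test, h] at this
  let body : S → S := fun x => if h : x.1.2 ≠ [] then
    ⟨((x.1.1.1, step x.1.1.1 x.1.1.2 (x.1.2.head h)), x.1.2.tail), by
      obtain ⟨l', h1, h2⟩ := x.2
      refine ⟨l' ++ [x.1.2.head h], ?_, ?_⟩
      · rw [List.append_assoc, List.singleton_append, List.cons_head_tail, h1]
      · rw [List.foldl_append, List.foldl_cons, List.foldl_nil, h2]⟩ else x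
  have htest : PolyTime test := (list_isEmpty.comp (PolyTime.snd.comp subtype_val)).not
  have hbody : PolyTime body := by
    refine cond_on htest ?_ ?_
    · have e : PolyTime fun x : {x : S // test x = true} => x.1.1 := subtype_val.comp subtype_val
      have eh : PolyTime fun x : {x : S // test x = true} => x.1.1.2.head (hne x) :=
        of_enc_eq (foldl_head (p := fun x : (Γ × β) × List A => x.2 ≠ []) fun _ h => h)
          (fun x : {x : S // test x = true} => ⟨x.1.1, hne x⟩) (fun _ => rfl) fun _ => rfl
      have e1 := PolyTime.fst.comp (PolyTime.fst.comp e)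
      have e2 := PolyTime.snd.comp (PolyTime.fst.comp e)
      refine of_enc_eq ((e1.pair (hs.comp ((e1.pair e2).pair eh))).pair
        (list_tail.comp (PolyTime.snd.comp e))) id (fun _ => rfl) fun x => ?_
      simp only [body, id, dif_pos (hne x)]
      rfl
    · refine of_enc_eq subtype_val id (fun _ => rfl) fun x => ?_
      have hx := x.2
      simp only [test, Bool.not_eq_eq_eq_not, Bool.not_false, List.isEmpty_iff] at hx
      simp only [body, hx, id, ne_eq, not_true_eq_false, dite_false]
  have key : ∀ (n : ℕ) (x : S), x.1.2.length = n →
      (∀ i < n, test (body^[i] x) = true) ∧ test (body^[n] x) = false ∧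
      (∀ i ≤ n, (body^[i] x).1.1.1 = x.1.1.1 ∧ tsize (body^[i] x).1.2 ≤ tsize x.1.2) ∧
      (body^[n] x).1 = ((x.1.1.1, (l x.1.1.1).foldl (step x.1.1.1) (init x.1.1.1)), []) := by
    intro n
    induction n with
    | zero =>
      intro x hx
      have hx' := List.length_eq_zero_iff.1 hx
      refine ⟨by simp, by simp [test, hx'], ?_, ?_⟩
      · intro i hi
        obtain rfl : i = 0 := by omega
        exact ⟨rfl, le_rfl⟩
      · obtain ⟨l', h1, h2⟩ := x.2
        rw [hx', List.append_nil] at h1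
        rw [← h1, ← h2, Function.iterate_zero, id, ← hx']
    | succ n ih =>
      intro x hx
      have hx0 : x.1.2 ≠ [] := fun h => by simp [h] at hx
      have hb : (body x).1 = ((x.1.1.1, step x.1.1.1 x.1.1.2 (x.1.2.head hx0)), x.1.2.tail) := by
        simp only [body, dif_pos hx0]
      obtain ⟨h1, h2, h3, h4⟩ := ih (body x) (by rw [hb, List.length_tail, hx]; rfl)
      rw [hb] at h3 h4
      refine ⟨fun i hi => ?_, h2, fun i hi => ?_, h4⟩
      · cases i with
        | zero => simp [test, hx0]
        | succ i => exact h1 i (by omega)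
      · cases i with
        | zero => exact ⟨rfl, le_rfl⟩
        | succ i =>
          refine ⟨(h3 i (by omega)).1, (h3 i (by omega)).2.trans ?_⟩
          conv_rhs => rw [← List.cons_head_tail hx0, tsize_cons]
          change tsize x.1.2.tail ≤ _
          omega
  have hw : PolyTime fun x : S => (⟨((x.1.1.1, (l x.1.1.1).foldl (step x.1.1.1) (init x.1.1.1)), []),
      l x.1.1.1, by simp, rfl⟩ : S) := by
    -- A state `((γ, b), rest)` consists of three components and two `cons` nodes, which account for
    -- the `2`.
    refine while_loop htest hbody (.X + B + 2) fun x => ⟨x.1.2.length, ?_, ?_⟩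
    · have e1 := length_le_tsize x.1.2
      have e2 := tsize_snd_le x.1
      simp only [Polynomial.eval_add, Polynomial.eval_X, Polynomial.eval_ofNat]
      change _ ≤ tsize x.1 + _ + _
      omega
    · obtain ⟨h1, h2, h3, h4⟩ := key _ x rfl
      refine ⟨h1, h2, fun i hi => ?_, Subtype.ext h4.symm⟩
      obtain ⟨e1, e2⟩ := h3 i hi
      obtain ⟨l', e3, e4⟩ := (body^[i] x).2
      have e5 := hB _ l' ⟨_, e3⟩
      rw [← e4, e1] at e5
      have e6 : tsize x.1.1.1 ≤ tsize x := (tsize_fst_le x.1.1).trans (tsize_fst_le x.1)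
      have e7 := B.eval_le_eval_nat e6
      have e8 : tsize x.1.1.1 + tsize x.1.2 ≤ tsize x := by
        change _ ≤ tsize x.1.1.1 + tsize x.1.1.2 + 1 + tsize x.1.2 + 1
        omega
      simp only [Polynomial.eval_add, Polynomial.eval_X, Polynomial.eval_ofNat]
      change tsize (body^[i] x).1.1.1 + tsize (body^[i] x).1.1.2 + 1 + tsize (body^[i] x).1.2 + 1 ≤ _
      rw [e1]
      omega
  have h0 : PolyTime fun γ => (⟨((γ, init γ), l γ), [], rfl, rfl⟩ : S) :=
    subtype_mk ((PolyTime.id.pair hi).pair hl) _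
  exact PolyTime.snd.comp (PolyTime.fst.comp (subtype_val.comp (hw.comp h0)))

/-- If the growth in one step does not depend on the accumulator, the total growth is at most the
number of steps times a polynomial, and the a priori bound required by `foldl` comes for free. -/
theorem foldl_add {step : Γ → β → A → β} {init : Γ → β} {l : Γ → List A}
    (hs : PolyTime fun x : (Γ × β) × A => step x.1.1 x.1.2 x.2) (hi : PolyTime init)
    (hl : PolyTime l) (p : Polynomial ℕ)
    (hp : ∀ γ b a, tsize (step γ b a) ≤ tsize b + p.eval (tsize γ + tsize a)) :
    PolyTime fun γ => (l γ).foldl (step γ) (init γ) := by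
  obtain ⟨qi, hqi, -⟩ := id hi
  obtain ⟨ql, hql, -⟩ := id hl
  refine foldl hs hi hl (qi + ql * p.comp (.X + ql)) fun γ l' h => ?_
  have key : ∀ (l' : List A) (b : β), (∀ a ∈ l', tsize a ≤ ql.eval (tsize γ)) →
      tsize (l'.foldl (step γ) b) ≤
        tsize b + l'.length * p.eval (tsize γ + ql.eval (tsize γ)) := by
    intro l'
    induction l' with
    | nil => intro b _; simp
    | cons a l' ih =>
      intro b hb
      have h1 := ih (step γ b a) fun a ha => hb a (by simp [ha])
      have h2 := hp γ b a
      have h3 := p.eval_le_eval_nat (add_le_add_right (hb a (by simp)) (tsize γ))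
      rw [List.foldl_cons, List.length_cons, Nat.succ_mul]
      omega
  have h1 := key l' (init γ) fun a ha => (tsize_le_of_mem (h.subset ha)).trans (hql γ)
  have h2 := hqi γ
  have h3 := Nat.mul_le_mul_right (p.eval (tsize γ + ql.eval (tsize γ)))
    ((h.length_le.trans (length_le_tsize _)).trans (hql γ))
  simp only [Polynomial.eval_add, Polynomial.eval_mul, Polynomial.eval_comp, Polynomial.eval_X]
  omega

theorem list_reverse : PolyTime (List.reverse : List A → List A) :=
  of_enc_eq (foldl_add (step := fun _ (b : List A) a => a :: b) (init := fun _ => []) (l := id)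
    (cons .snd (PolyTime.snd.comp .fst)) (.const _) .id (.X + 1) (fun γ b a => by
      simp only [tsize_cons, Polynomial.eval_add, Polynomial.eval_X, Polynomial.eval_one]
      omega)) id (fun _ => rfl) fun l => by
        simp only [id]
        congr 1
        exact List.foldl_flip_cons_eq_append' .. |>.trans (by simp)

theorem map {f : Γ → A → β} {l : Γ → List A} (hf : PolyTime fun x : Γ × A => f x.1 x.2)
    (hl : PolyTime l) : PolyTime fun γ => (l γ).map (f γ) := by
  obtain ⟨q, hq, -⟩ := id hf
  refine of_enc_eq (list_reverse.comp (foldl_add (step := fun γ (b : List β) a => f γ a :: b)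
    (init := fun _ => []) (cons (hf.comp ((PolyTime.fst.comp .fst).pair .snd))
      (PolyTime.snd.comp .fst)) (.const _) hl (q.comp (.X + 1) + 1) (fun γ b a => ?_)))
    id (fun _ => rfl) fun γ => ?_
  · have : tsize (f γ a) ≤ _ := hq (γ, a)
    rw [tsize_pair] at this
    simp only [tsize_cons, Polynomial.eval_add, Polynomial.eval_X, Polynomial.eval_one,
      Polynomial.eval_comp]
    omega
  · have key : ∀ (l : List A) (b : List β),
        l.foldl (fun b a => f γ a :: b) b = (l.map (f γ)).reverse ++ b := by
      intro l
      induction l with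
      | nil => simp
      | cons a l ih => intro b; simp [ih]
    simp only [id, key, List.append_nil, List.reverse_reverse]

theorem append {f g : Γ → List A} (hf : PolyTime f) (hg : PolyTime g) :
    PolyTime fun γ => f γ ++ g γ := by
  refine of_enc_eq (foldl_add (step := fun _ (b : List A) a => a :: b) (init := g)
    (cons .snd (PolyTime.snd.comp .fst)) hg (list_reverse.comp hf) (.X + 1) (fun γ b a => by
      simp only [tsize_cons, Polynomial.eval_add, Polynomial.eval_X, Polynomial.eval_one]
      omega)) id (fun _ => rfl) fun γ => ?_
  simp

theorem flatMap {f : Γ → A → List β} {l : Γ → List A} (hf : PolyTime fun x : Γ × A => f x.1 x.2)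
    (hl : PolyTime l) : PolyTime fun γ => (l γ).flatMap (f γ) := by
  obtain ⟨q, hq, -⟩ := id hf
  refine of_enc_eq (foldl_add (step := fun γ (b : List β) a => b ++ f γ a)
    (init := fun _ => []) (append (PolyTime.snd.comp .fst)
      (hf.comp ((PolyTime.fst.comp .fst).pair .snd))) (.const _) hl
      (q.comp (.X + 1)) (fun γ b a => ?_)) id (fun _ => rfl) fun γ => ?_
  · have : tsize (f γ a) ≤ _ := hq (γ, a)
    have h2 := tsize_append b (f γ a)
    rw [tsize_pair] at this
    simp only [Polynomial.eval_add, Polynomial.eval_X, Polynomial.eval_one,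
      Polynomial.eval_comp]
    omega
  · have key : ∀ (l : List A) (b : List β),
        l.foldl (fun b a => b ++ f γ a) b = b ++ l.flatMap (f γ) := by
      intro l
      induction l with
      | nil => simp
      | cons a l ih => intro b; simp [ih]
    simp only [id, key, List.nil_append]

end fold
end PolyTime


/-! ### Functions on finite types -/

namespace PolyTime

/-- Finite types on which programs can branch. -/
class FinCases (α : Type) [Enc α] : Prop where
  cases : ∀ {Γ β : Type} [Enc Γ] [Enc β] (f : α → Γ → β), (∀ a, PolyTime (f a)) →
    PolyTime fun x : α × Γ => f x.1 x.2

instance : FinCases Bool := ⟨fun f h => of_enc_eq (cond .fst ((h true).comp .snd)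
  ((h false).comp .snd)) id (fun _ => rfl) fun ⟨b, _⟩ => by cases b <;> rfl⟩

instance {α β : Type} [Enc α] [Enc β] [FinCases α] [FinCases β] : FinCases (α × β) :=
  ⟨fun f h => (FinCases.cases (fun a (x : β × _) => f (a, x.1) x.2) fun a =>
    FinCases.cases (fun b x => f (a, b) x) fun b => h (a, b)).comp
      ((PolyTime.fst.comp .fst).pair ((PolyTime.snd.comp .fst).pair .snd))⟩

/-- A finite case distinction with constant branches; all arithmetic with residues modulo 4 and 8 is
done in this way. -/
theorem fin_fun {α β : Type} [Enc α] [Enc β] [FinCases α] (f : α → β) : PolyTime f :=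
  (FinCases.cases (fun a (_ : Unit) => f a) fun _ => .const _).comp (PolyTime.id.pair (.const ()))

/-- The binary digits of a residue modulo 4. -/
def bits4 (v : ZMod 4) : Bool × Bool := (decide (v = 1 ∨ v = 3), decide (v = 2 ∨ v = 3))

/-- The residue modulo 4 with given binary digits. -/
def ofBits4 (b : Bool × Bool) : ZMod 4 := (if b.1 then 1 else 0) + if b.2 then 2 else 0

theorem ofBits4_bits4 : ∀ v, ofBits4 (bits4 v) = v := by decide

instance : Enc (ZMod 4) := ⟨fun v => enc (bits4 v), fun a b h => by
  rw [← ofBits4_bits4 a, ← ofBits4_bits4 b, inj h]⟩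

instance : FinCases (ZMod 4) := ⟨fun f h => of_enc_eq
  (FinCases.cases (fun b x => f (ofBits4 b) x) fun b => h (ofBits4 b))
  (fun x => (bits4 x.1, x.2)) (fun _ => rfl) fun x => by simp only [ofBits4_bits4]⟩

/-- The binary digits of a residue modulo 8. -/
def bits8 (v : ZMod 8) : Bool × Bool × Bool :=
  (decide (v ∈ [1, 3, 5, 7]), decide (v ∈ [2, 3, 6, 7]), decide (v ∈ [4, 5, 6, 7]))

/-- The residue modulo 8 with given binary digits. -/
def ofBits8 (b : Bool × Bool × Bool) : ZMod 8 :=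
  (if b.1 then 1 else 0) + (if b.2.1 then 2 else 0) + if b.2.2 then 4 else 0

theorem ofBits8_bits8 : ∀ v, ofBits8 (bits8 v) = v := by decide

instance : Enc (ZMod 8) := ⟨fun v => enc (bits8 v), fun a b h => by
  rw [← ofBits8_bits8 a, ← ofBits8_bits8 b, inj h]⟩

instance : FinCases (ZMod 8) := ⟨fun f h => of_enc_eq
  (FinCases.cases (fun b x => f (ofBits8 b) x) fun b => h (ofBits8 b))
  (fun x => (bits8 x.1, x.2)) (fun _ => rfl) fun x => by simp only [ofBits8_bits8]⟩

theorem tsize_zmod4_le (a : ZMod 4) : tsize a ≤ 7 := by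
  have h1 := tsize_bool_le (bits4 a).1
  have h2 := tsize_bool_le (bits4 a).2
  change tsize (bits4 a).1 + tsize (bits4 a).2 + 1 ≤ 7
  omega

theorem tsize_zmod8_le (a : ZMod 8) : tsize a ≤ 11 := by
  have h1 := tsize_bool_le (bits8 a).1
  have h2 := tsize_bool_le (bits8 a).2.1
  have h3 := tsize_bool_le (bits8 a).2.2
  change tsize (bits8 a).1 + (tsize (bits8 a).2.1 + tsize (bits8 a).2.2 + 1) + 1 ≤ 11
  omega

/-! ### Comparison of trees -/

section equality

noncomputable instance : DecidableEq BinTree := Classical.decEq _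

/-- State of the comparison of trees: pairs still to be compared, and whether all is well. -/
abbrev CmpState : Type := List (BinTree × BinTree) × Bool

/-- One step of the comparison of trees. -/
def cmpStep (x : CmpState) : CmpState :=
  match x with
  | ([], f) => ([], f)
  | ((.nil, .nil) :: w, f) => (w, f)
  | ((.cons a b, .cons c d) :: w, f) => ((a, c) :: (b, d) :: w, f)
  | (_ :: _, _) => ([], false)

theorem polyTime_cmpStep : PolyTime cmpStep := by
  have e0 : PolyTime fun x : CmpState => enc x.1 :=
    of_enc_eq PolyTime.fst id (fun _ => rfl) fun _ => rfl
  have ea : PolyTime fun x : CmpState => (enc x.1).hd.hd := tree_hd.comp (tree_hd.comp e0)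
  have eb : PolyTime fun x : CmpState => (enc x.1).hd.tl := tree_tl.comp (tree_hd.comp e0)
  have et : PolyTime fun x : CmpState => x.1.tail := list_tail.comp .fst
  have ef : PolyTime fun x : CmpState => x.2 := .snd
  refine of_enc_eq (cond (list_isEmpty.comp PolyTime.fst : PolyTime fun x : CmpState => x.1.isEmpty)
    .id (cond (tree_isNil.comp ea) (cond (tree_isNil.comp eb) (et.pair ef)
      (.const (([], false) : CmpState))) (cond (tree_isNil.comp eb) (.const (([], false) : CmpState))
        ((cons ((tree_hd.comp ea).pair (tree_hd.comp eb))
          (cons ((tree_tl.comp ea).pair (tree_tl.comp eb)) et)).pair ef))))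
    id (fun _ => rfl) fun x => ?_
  rcases x with ⟨_ | ⟨⟨a, b⟩, w⟩, f⟩
  · rfl
  · cases a <;> cases b <;> rfl

/-- The total size of the left components in the work list decreases in every step, because a pair
of inner nodes is replaced by the pairs of their children; the encoded work list does not grow. This
bounds both the number of rounds and the size of the states. -/
theorem cmp_iterate (M : ℕ) : ∀ (w : List (BinTree × BinTree)) (f : Bool),
    (w.map fun p => p.1.size).sum ≤ M → ∃ n, n ≤ M ∧
      (∀ i < n, (cmpStep^[i] (w, f)).1 ≠ []) ∧ (cmpStep^[n] (w, f)).1 = [] ∧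
      (∀ i ≤ n, tsize (cmpStep^[i] (w, f)).1 ≤ tsize w) ∧
      (cmpStep^[n] (w, f)).2 = (f && w.all fun p => decide (p.1 = p.2)) := by
  induction M with
  | zero =>
    intro w f h
    have hw : w = [] := by
      rcases w with _ | ⟨p, w⟩
      · rfl
      · rw [List.map_cons, List.sum_cons] at h
        have := p.1.size_pos
        omega
    subst hw
    exact ⟨0, le_rfl, by simp, rfl, fun i hi => by
      obtain rfl : i = 0 := by omega
      rfl, by simp⟩
  | succ M ih =>
    intro w f hw
    by_cases hw0 : w = []
    · subst hw0
      exact ⟨0, by simp, by simp, rfl, fun i hi => by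
        obtain rfl : i = 0 := by omega
        rfl, by simp⟩
    have main : ∀ w' f', cmpStep (w, f) = (w', f') → tsize w' ≤ tsize w →
        (w'.map fun p => p.1.size).sum < (w.map fun p => p.1.size).sum →
        ((f' && w'.all fun p => decide (p.1 = p.2)) = (f && w.all fun p => decide (p.1 = p.2))) →
        ∃ n, n ≤ M + 1 ∧
          (∀ i < n, (cmpStep^[i] (w, f)).1 ≠ []) ∧ (cmpStep^[n] (w, f)).1 = [] ∧
          (∀ i ≤ n, tsize (cmpStep^[i] (w, f)).1 ≤ tsize w) ∧
          (cmpStep^[n] (w, f)).2 = (f && w.all fun p => decide (p.1 = p.2)) := by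
      intro w' f' h1 h2 h2' h3
      obtain ⟨n, e1, e2, e3, e4, e5⟩ := ih w' f' (by omega)
      refine ⟨n + 1, by omega, fun i hi => ?_, ?_, fun i hi => ?_, ?_⟩
      · cases i with
        | zero => exact hw0
        | succ i => rw [Function.iterate_succ_apply, h1]; exact e2 i (by omega)
      · rw [Function.iterate_succ_apply, h1]; exact e3
      · cases i with
        | zero => exact le_rfl
        | succ i =>
          rw [Function.iterate_succ_apply, h1]
          exact (e4 i (by omega)).trans h2
      · rw [Function.iterate_succ_apply, h1, e5, h3]
    rcases w with _ | ⟨⟨a, b⟩, w⟩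
    · exact absurd rfl hw0
    have ha := a.size_pos
    have ht := tsize_pos w
    rcases a with _ | ⟨a1, a2⟩ <;> rcases b with _ | ⟨b1, b2⟩
    · exact main w f rfl (by rw [tsize_cons]; omega)
        (by simp only [List.map_cons, List.sum_cons]; omega) (by simp)
    · exact main [] false rfl (by rw [tsize_cons, tsize_nil]; omega)
        (by simp only [List.map_cons, List.sum_cons, List.map_nil, List.sum_nil]; omega) (by simp)
    · exact main [] false rfl (by rw [tsize_cons, tsize_nil]; omega)
        (by simp only [List.map_cons, List.sum_cons, List.map_nil, List.sum_nil]; omega) (by simp)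
    · refine main ((a1, b1) :: (a2, b2) :: w) f rfl ?_ ?_ ?_
      · simp only [tsize_cons, tsize_pair]
        change a1.size + b1.size + 1 + (a2.size + b2.size + 1 + tsize w + 1) + 1 ≤
          a1.size + a2.size + 1 + (b1.size + b2.size + 1) + 1 + tsize w + 1
        omega
      · simp only [List.map_cons, List.sum_cons, BinTree.size]
        omega
      · simp only [List.all_cons, BinTree.cons.injEq, Bool.decide_and, Bool.and_assoc]

theorem sum_size_le_tsize (w : List (BinTree × BinTree)) :
    (w.map fun p => p.1.size).sum ≤ tsize w := by
  induction w with
  | nil => simp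
  | cons p w ih =>
    have : p.1.size ≤ tsize p := tsize_fst_le p
    rw [List.map_cons, List.sum_cons, tsize_cons]
    omega

theorem tree_eq : PolyTime fun x : BinTree × BinTree => decide (x.1 = x.2) := by
  have hw : PolyTime fun x : CmpState => (([], x.2 && x.1.all fun p => decide (p.1 = p.2)) :
      CmpState) := by
    refine while_loop (test := fun x : CmpState => !x.1.isEmpty)
      (list_isEmpty.comp PolyTime.fst).not polyTime_cmpStep (.X + 5) fun x => ?_
    obtain ⟨w, f⟩ := x
    obtain ⟨n, e1, e2, e3, e4, e5⟩ := cmp_iterate _ w f (sum_size_le_tsize w)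
    have e6 : tsize w ≤ tsize (w, f) := tsize_fst_le (w, f)
    refine ⟨n, ?_, fun i hi => ?_, ?_, fun i hi => ?_, Prod.ext e3.symm e5.symm⟩
    · simp only [Polynomial.eval_add, Polynomial.eval_X, Polynomial.eval_ofNat]
      omega
    · simpa using e2 i hi
    · simpa using e3
    · have h1 := e4 i hi
      have h2 := tsize_bool_le (cmpStep^[i] (w, f)).2
      simp only [Polynomial.eval_add, Polynomial.eval_X, Polynomial.eval_ofNat]
      change tsize (cmpStep^[i] (w, f)).1 + tsize (cmpStep^[i] (w, f)).2 + 1 ≤ _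
      omega
  refine of_enc_eq (PolyTime.snd.comp (hw.comp ((cons .id (.const [])).pair (.const true))))
    id (fun _ => rfl) fun x => ?_
  simp

/-- Encodings are injective, so elements are compared as trees. -/
theorem decide_eq {Γ α : Type} [Enc Γ] [Enc α] [DecidableEq α] {f g : Γ → α} (hf : PolyTime f)
    (hg : PolyTime g) : PolyTime fun x => decide (f x = g x) :=
  of_enc_eq (tree_eq.comp (of_enc_eq (hf.pair hg) id (fun _ => rfl) (fun _ => rfl) :
    PolyTime fun x => (enc (f x), enc (g x)))) id (fun _ => rfl) fun x => by
    exact congrArg enc (decide_eq_decide.2 inj.eq_iff)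

theorem and {Γ : Type} [Enc Γ] {f g : Γ → Bool} (hf : PolyTime f) (hg : PolyTime g) :
    PolyTime fun x => f x && g x :=
  (fin_fun fun b : Bool × Bool => b.1 && b.2).comp (hf.pair hg)

theorem or {Γ : Type} [Enc Γ] {f g : Γ → Bool} (hf : PolyTime f) (hg : PolyTime g) :
    PolyTime fun x => f x || g x :=
  (fin_fun fun b : Bool × Bool => b.1 || b.2).comp (hf.pair hg)

end equality

/-! ### Arithmetic with binary digits -/

section arithmetic

theorem nat_bits : PolyTime Nat.bits := of_enc_eq .id Nat.bits (fun _ => rfl) fun _ => rfl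

theorem headD_false : PolyTime fun l : List Bool => l.headD false :=
  of_enc_eq tree_hd enc (fun _ => rfl) fun l => by cases l <;> rfl

theorem enc_bit (b : Bool) (n : ℕ) (h : n = 0 → b = true) :
    enc (Nat.bit b n) = .cons (enc b) (enc n) := by
  change BinTree.ofList _ = _
  rw [Nat.bits_append_bit _ _ h]
  rfl

/-- Digits are stored without leading zeros, so appending a zero digit to `0` must return the empty
list; this is the separate case. -/
theorem nat_bit {Γ : Type} [Enc Γ] {b : Γ → Bool} {n : Γ → ℕ} (hb : PolyTime b) (hn : PolyTime n) :
    PolyTime fun x => Nat.bit (b x) (n x) := by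
  refine cond_on (b := fun x => decide (n x = 0) && !b x) ((decide_eq hn (.const 0)).and hb.not)
    ?_ ?_
  · refine of_enc_eq (PolyTime.const (0 : ℕ)) id (fun _ => rfl) fun x => ?_
    have hx := x.2
    simp only [Bool.and_eq_true, decide_eq_true_eq, Bool.not_eq_eq_eq_not, Bool.not_true] at hx
    simp [hx.1, hx.2, Nat.bit]
  · refine of_enc_eq ((hb.pair hn).comp subtype_val) id (fun _ => rfl) fun x => ?_
    have hx := x.2
    rw [enc_bit]
    · rfl
    · intro h
      simpa [h] using hx

theorem tsize_bit (b : Bool) (n : ℕ) (h : n = 0 → b = true) :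
    tsize (Nat.bit b n) = tsize b + tsize n + 1 := by
  unfold tsize
  rw [enc_bit b n h]
  rfl

theorem tsize_bit_le (b : Bool) (n : ℕ) : tsize (Nat.bit b n) ≤ tsize n + 4 := by
  by_cases h : n = 0 → b = true
  · have h2 := tsize_bit b n h
    have := tsize_bool_le b
    omega
  · push Not at h
    obtain ⟨rfl, h⟩ := h
    cases b
    · simp [Nat.bit]
    · simp at h

/-- State of an addition: carry, digits still to be added, digits of the result. -/
abbrev SumState : Type := Bool × (List Bool × List Bool) × List Bool

/-- One step of an addition. -/
def sumStep (s : SumState) : SumState :=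
  ((s.1 && s.2.1.1.headD false) || (s.1 && s.2.1.2.headD false) ||
    (s.2.1.1.headD false && s.2.1.2.headD false), (s.2.1.1.tail, s.2.1.2.tail),
    (s.1 ^^ (s.2.1.1.headD false ^^ s.2.1.2.headD false)) :: s.2.2)

/-- The number with given digits, least significant digit first. -/
def ofDigits (l : List Bool) : ℕ := l.foldr Nat.bit 0

theorem ofDigits_bits (n : ℕ) : ofDigits n.bits = n := by
  unfold ofDigits
  induction n using Nat.binaryRec' with
  | zero => simp
  | bit b n hb ih => rw [Nat.bits_append_bit _ _ hb, List.foldr_cons, ih]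

/-- What is still to be added. -/
def restSum (s : SumState) : ℕ := ofDigits s.2.1.1 + ofDigits s.2.1.2 + s.1.toNat

/-- A full adder: the parity of the carry and the two current digits is emitted and their majority
is carried on. -/
theorem restSum_eq (s : SumState) :
    restSum s = Nat.bit (s.1 ^^ (s.2.1.1.headD false ^^ s.2.1.2.headD false)) (restSum (sumStep s)) := by
  obtain ⟨c, ⟨a, b⟩, o⟩ := s
  have key : ∀ l, ofDigits l = 2 * ofDigits l.tail + (l.headD false).toNat := by
    intro l
    cases l with
    | nil => rfl
    | cons b l => exact Nat.bit_val b _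
  simp only [restSum, sumStep]
  rw [key a, key b, Nat.bit_val]
  cases c <;> cases a.headD false <;> cases b.headD false <;>
    simp only [Bool.toNat_true, Bool.toNat_false, Bool.and_true, Bool.and_false, Bool.or_true,
      Bool.or_false, Bool.xor_true, Bool.xor_false, Bool.not_true, Bool.not_false] <;> omega

/-- Each step divides `restSum` by two and emits the remainder, so nothing is left once the clock
`l` is long enough. Digits are pushed on the front of the output, hence the final fold meets the
most significant one first. -/
theorem sum_correct (l : List Unit) : ∀ s : SumState, restSum s < 2 ^ l.length →
    (l.foldl (fun s _ => sumStep s) s).2.2.foldl (fun n b => Nat.bit b n) 0 =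
      s.2.2.foldl (fun n b => Nat.bit b n) (restSum s) := by
  induction l with
  | nil =>
    intro s h
    rw [List.length_nil, pow_zero, Nat.lt_one_iff] at h
    rw [h, List.foldl_nil]
  | cons a l ih =>
    intro s h
    have h1 := restSum_eq s
    rw [List.foldl_cons, ih, h1]
    · rfl
    · rw [Nat.bit_val] at h1
      rw [List.length_cons, pow_succ] at h
      omega

theorem nat_add : PolyTime fun x : ℕ × ℕ => x.1 + x.2 := by
  have h1 : PolyTime fun x : ℕ × ℕ => x.1.bits := nat_bits.comp .fst
  have h2 : PolyTime fun x : ℕ × ℕ => x.2.bits := nat_bits.comp .snd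
  -- The concatenated digits, with one more entry for the last carry, serve only as a clock for the
  -- addition.
  have hl : PolyTime fun x : ℕ × ℕ => (() :: (x.1.bits ++ x.2.bits).map fun _ => () : List Unit) :=
    cons (.const ()) (map (f := fun _ _ => ()) (.const ()) (h1.append h2))
  have hs : PolyTime sumStep := by
    have ec : PolyTime fun s : SumState => s.1 := .fst
    have ea : PolyTime fun s : SumState => s.2.1.1 := PolyTime.fst.comp (PolyTime.fst.comp .snd)
    have eb : PolyTime fun s : SumState => s.2.1.2 := PolyTime.snd.comp (PolyTime.fst.comp .snd)
    have ha := headD_false.comp ea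
    have hb := headD_false.comp eb
    exact (((ec.and ha).or (ec.and hb)).or (ha.and hb)).pair
      (((list_tail.comp ea).pair (list_tail.comp eb)).pair
        (cons ((fin_fun fun b : Bool × Bool × Bool => (b.1 ^^ (b.2.1 ^^ b.2.2))).comp
          (ec.pair (ha.pair hb))) (PolyTime.snd.comp .snd)))
  have hf := foldl_add (Γ := ℕ × ℕ) (A := Unit) (step := fun _ s _ => sumStep s)
    (init := fun x => (false, (x.1.bits, x.2.bits), [])) (hs.comp (PolyTime.snd.comp .fst))
    ((PolyTime.const false).pair ((h1.pair h2).pair (.const []))) hl 10 (fun γ s a => by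
      obtain ⟨c, ⟨a, b⟩, o⟩ := s
      have key : ∀ l : List Bool, tsize l.tail ≤ tsize l := fun l => by
        cases l with
        | nil => exact le_rfl
        | cons b l => rw [tsize_cons, List.tail_cons]; omega
      have e1 := key a
      have e2 := key b
      have e3 := tsize_bool_le ((c && a.headD false) || (c && b.headD false) ||
        (a.headD false && b.headD false))
      have e4 := tsize_bool_le (c ^^ (a.headD false ^^ b.headD false))
      simp only [sumStep, tsize_pair, tsize_cons, Polynomial.eval_ofNat]
      omega)
  have hr := foldl_add (Γ := List Bool) (A := Bool) (step := fun _ n b => Nat.bit b n)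
    (init := fun _ => 0) (l := id) (nat_bit .snd (PolyTime.snd.comp .fst)) (.const 0) .id 4
    (fun γ n b => by simpa using tsize_bit_le b n)
  refine of_enc_eq (hr.comp (PolyTime.snd.comp (PolyTime.snd.comp hf))) id (fun _ => rfl)
    fun x => ?_
  simp only [id]
  rw [sum_correct]
  · simp only [List.foldl_nil, restSum, ofDigits_bits]
    rfl
  · simp only [restSum, ofDigits_bits, List.length_cons, List.length_map, List.length_append,
      Nat.size_eq_bits_len, Bool.toNat_false, add_zero]
    have e1 := Nat.lt_size_self x.1
    have e2 := Nat.lt_size_self x.2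
    have e3 := Nat.pow_le_pow_right two_pos (Nat.le_add_right x.1.size x.2.size)
    have e4 := Nat.pow_le_pow_right two_pos (Nat.le_add_left x.2.size x.1.size)
    rw [pow_succ]
    omega

theorem add {Γ : Type} [Enc Γ] {f g : Γ → ℕ} (hf : PolyTime f) (hg : PolyTime g) :
    PolyTime fun x => f x + g x := nat_add.comp (hf.pair hg)

theorem tsize_nat_le (a : ℕ) : tsize a ≤ 4 * a.size + 1 := by
  have h : ∀ l : List Bool, (BinTree.ofList (l.map BinTree.ofBool)).size ≤ 4 * l.length + 1 := by
    intro l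
    induction l with
    | nil => exact le_rfl
    | cons b l ih =>
      have := BinTree.size_ofBool_le b
      simp only [List.map_cons, BinTree.ofList, BinTree.size, List.length_cons]
      omega
  exact (h a.bits).trans (by rw [Nat.size_eq_bits_len])

/-- An increment creates at most one new digit; this controls the exponent counter during the
elimination. -/
theorem tsize_succ_le (a : ℕ) : tsize (a + 1) ≤ tsize a + 4 := by
  have e0 : tsize false = 1 := rfl
  have e1 : tsize true = 3 := rfl
  have e2 : tsize (0 : ℕ) = 1 := rfl
  induction a using Nat.binaryRec' with
  | zero =>
    have h := tsize_bit true 0 (by simp)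
    change tsize 1 = _ at h
    rw [zero_add]
    omega
  | bit b n hb ih =>
    rw [tsize_bit b n hb]
    cases b with
    | true =>
      have : Nat.bit true n + 1 = Nat.bit false (n + 1) := by
        simp only [Nat.bit_val, Bool.toNat_true, Bool.toNat_false]; omega
      rw [this, tsize_bit _ _ (by omega)]
      omega
    | false =>
      have : Nat.bit false n + 1 = Nat.bit true n := by
        simp only [Nat.bit_val, Bool.toNat_true, Bool.toNat_false]
      rw [this, tsize_bit _ _ (by simp)]
      omega

theorem int_neg : PolyTime fun z : ℤ => decide (z < 0) :=
  of_enc_eq (PolyTime.fst : PolyTime (Prod.fst : Bool × ℕ → Bool))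
    (fun z : ℤ => (decide (z < 0), z.natAbs)) (fun _ => rfl) fun _ => rfl

theorem int_natAbs : PolyTime Int.natAbs :=
  of_enc_eq (PolyTime.snd : PolyTime (Prod.snd : Bool × ℕ → ℕ))
    (fun z : ℤ => (decide (z < 0), z.natAbs)) (fun _ => rfl) fun _ => rfl

/-- The sign and the two lowest digits suffice, however long the coefficient is. -/
theorem int_mod_four : PolyTime fun z : ℤ => (z : ZMod 4) := by
  have h1 : PolyTime fun z : ℤ => z.natAbs.bits := nat_bits.comp int_natAbs
  refine of_enc_eq ((fin_fun fun b : Bool × Bool × Bool =>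
    if b.1 then -ofBits4 b.2 else ofBits4 b.2).comp (int_neg.pair
      ((headD_false.comp h1).pair (headD_false.comp (list_tail.comp h1))))) id (fun _ => rfl)
      fun z => ?_
  have key : ∀ n : ℕ, (n : ZMod 4) = ofBits4 (n.bits.headD false, n.bits.tail.headD false) := by
    intro n
    have e : ∀ l : List Bool, ((ofDigits l : ℕ) : ZMod 4) = ofBits4 (l.headD false, l.tail.headD false) := by
      intro l
      have h4 : ((4 : ℕ) : ZMod 4) = 0 := rfl
      rcases l with _ | ⟨a, _ | ⟨b, l⟩⟩
      · rfl
      · cases a <;> rfl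
      · change ((Nat.bit a (Nat.bit b (ofDigits l)) : ℕ) : ZMod 4) = ofBits4 (a, b)
        rw [Nat.bit_val, Nat.bit_val, mul_add, ← mul_assoc, Nat.cast_add, Nat.cast_add,
          Nat.cast_mul _ (ofDigits l)]
        rw [show (((2 * 2 : ℕ)) : ZMod 4) = 0 from rfl, zero_mul, zero_add]
        cases a <;> cases b <;> rfl
    rw [← e, ofDigits_bits]
  congr 1
  by_cases hz : z < 0
  · simp only [id, hz, decide_true, if_true, ← key]
    have : z = -(z.natAbs : ℤ) := by omega
    conv_rhs => rw [this]
    simp only [Int.cast_neg, Int.cast_natCast]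
  · simp only [id, hz, decide_false, ← key]
    have : z = (z.natAbs : ℤ) := by omega
    conv_rhs => rw [this]
    simp only [Int.cast_natCast, Bool.false_eq_true, if_false]

end arithmetic
end PolyTime


/-! ## The decision procedure -/

/-- Names of Boolean variables: a kind and an index. -/
abbrev VarName : Type := ℕ × ℕ

/-- A linear form, given by its coefficients. -/
abbrev Row : Type := List (VarName × ZMod 4)

/-- A multiple of a product of two linear forms. -/
abbrev RankOne : Type := ZMod 4 × Row × Row

/-- A written linear Boolean polynomial. -/
abbrev WrittenForm : Type := Bool × List ℕ

/-- A written term. -/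
abbrev WrittenTerm : Type := ℕ × ℤ × ℤ × List (ℤ × ℕ) × List (ℤ × ℕ × ℕ) ×
  List WrittenForm × List WrittenForm × List WrittenForm × Unit

/-- The coefficient of a variable in a linear form. -/
def look (r : Row) (j : VarName) : ZMod 4 := r.foldl (fun b e => if e.1 = j then e.2 else b) 0

/-- An entry of the matrix of a sum of products of two linear forms. -/
def entry (S : List RankOne) (i j : VarName) : ZMod 4 :=
  S.foldl (fun b u => b + u.1 * (look u.2.1 i * look u.2.2 j)) 0

/-- A row of the matrix of a sum of products of two linear forms. -/
def rowOf (V : List VarName) (S : List RankOne) (p : VarName) : Row := V.map fun j => (j, entry S p j)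

/-- Odd residues modulo 4. -/
def oddRes (v : ZMod 4) : Bool := decide (v = 1 ∨ v = 3)

/-- A variable that has an odd coefficient in the row of `p`, if there is any. -/
def partner (V : List VarName) (S : List RankOne) (p : VarName) : VarName :=
  V.foldl (fun b j => if oddRes (entry S p j) then j else b) p

/-- State of the evaluation of a Gauss sum: the quadratic form, the exponent of `1 / √2`, the
argument in eighths of a turn, and whether the sum is known to vanish. -/
abbrev ElimState : Type := List RankOne × ℕ × ZMod 8 × Bool

/-- The products of linear forms that eliminate a pair of variables with the matrix `a s; s b`. -/
def blockForms (a b s : ZMod 4) (r r' : Row) : List RankOne :=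
  [(-((a * b - 1) * b), r, r), ((a * b - 1) * s, r, r'), ((a * b - 1) * s, r', r),
    (-((a * b - 1) * a), r', r')]

/-- The argument of the Gauss sum of the matrix `a s; s b` with `s` odd and `a` even. -/
def blockArg (a b : ZMod 4) : ZMod 8 := if a = 2 then ((2 * b.val : ℕ) : ZMod 8) else 0

/-- Elimination of the variable `p`. -/
def elimStep (V : List VarName) (st : ElimState) (p : VarName) : ElimState :=
  if oddRes (entry st.1 p p) then
    ((-entry st.1 p p, rowOf V st.1 p, rowOf V st.1 p) :: st.1, st.2.1 + 1,
      st.2.2.1 + (if entry st.1 p p = 1 then 1 else -1), st.2.2.2)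
  else if oddRes (entry st.1 p (partner V st.1 p)) then
    (blockForms (entry st.1 p p) (entry st.1 (partner V st.1 p) (partner V st.1 p))
      (entry st.1 p (partner V st.1 p)) (rowOf V st.1 p) (rowOf V st.1 (partner V st.1 p)) ++ st.1,
      st.2.1 + 1 + 1, st.2.2.1 + blockArg (entry st.1 p p)
        (entry st.1 (partner V st.1 p) (partner V st.1 p)), st.2.2.2)
  else (st.1, st.2.1, st.2.2.1, st.2.2.2 || decide (entry st.1 p p = 2))

/-- The variables of a quadratic form. -/
def varNames (S : List RankOne) : List VarName := S.flatMap fun u => u.2.1.map Prod.fst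

/-- Evaluation of a Gauss sum. -/
def gaussEval (S : List RankOne) : ElimState :=
  (varNames S).foldl (elimStep (varNames S)) (S, 0, 0, false)

/-- The product of a number and two variables. -/
def monoForm (v : ZMod 4) (x y : VarName) : RankOne := (v, [(x, 1)], [(y, 1)])

/-- Twice the product of a variable and a linear form. -/
def constraint (u : VarName) (t : ℕ) (f : WrittenForm) : List RankOne :=
  monoForm (if f.1 then 2 else 0) u u ::
    f.2.flatMap fun i => [monoForm 1 u (t, i), monoForm 1 (t, i) u]

/-- Twice the sum of the products of new variables and given linear forms. -/
def constraints (τ t : ℕ) (l : List WrittenForm) : List RankOne :=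
  l.zipIdx.flatMap fun x => constraint (τ, x.2) t x.1

/-- The quadratic form given by a copy of a term. -/
def copyForm (sg : ZMod 4) (t tk td tb : ℕ) (c : WrittenTerm) : List RankOne :=
  (c.2.2.2.1.flatMap fun a => [monoForm (sg * (a.1 : ZMod 4)) (t, a.2) (t, a.2)]) ++
  ((c.2.2.2.2.1.flatMap fun a => [monoForm (sg * (a.1 : ZMod 4)) (t, a.2.1) (t, a.2.2),
    monoForm (sg * (a.1 : ZMod 4)) (t, a.2.2) (t, a.2.1)]) ++
  (constraints tk t c.2.2.2.2.2.1 ++ (constraints td t c.2.2.2.2.2.2.1 ++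
    constraints tb t c.2.2.2.2.2.2.2.1)))

/-- The quadratic form whose Gauss sum gives the inner product of two terms. -/
def gramForm (c d : WrittenTerm) : List RankOne :=
  copyForm 1 0 4 8 6 c ++ (copyForm (-1) 1 5 8 7 c ++ (copyForm (-1) 2 4 9 6 d ++
    copyForm 1 3 5 9 7 d))

/-- The positive part of an integer. -/
def posInt (z : ℤ) : ℕ := if decide (z < 0) then 0 else z.natAbs

/-- The negative part of an integer. -/
def negInt (z : ℤ) : ℕ := if decide (z < 0) then z.natAbs else 0

/-- The larger part of the comparison of exponents. -/
def expo (c d : WrittenTerm) : ℕ :=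
  (c.1 + c.1) + (c.1 + c.1) + (negInt c.2.1 + negInt c.2.1) + (posInt d.2.1 + posInt d.2.1)

/-- Comparison of inner products. -/
def sameValues (x : WrittenTerm × WrittenTerm) (e₁ e₁₂ e₂ : ElimState) : Bool :=
  (e₁.2.2.2 && e₂.2.2.2) ||
  (((!e₁.2.2.2 && !e₁₂.2.2.2) && !e₂.2.2.2) &&
    ((decide (e₁.2.2.1 = e₁₂.2.2.1) && decide (e₁₂.2.2.1 = e₂.2.2.1)) &&
      (decide (expo x.1 x.2 + e₁₂.2.1 = expo x.2 x.1 + e₁.2.1) &&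
        decide (expo x.1 x.2 + e₂.2.1 = expo x.2 x.1 + e₁₂.2.1))))

/-- The decision procedure. -/
def sameMorphism (x : WrittenTerm × WrittenTerm) : Bool :=
  sameValues x (gaussEval (gramForm x.1 x.1)) (gaussEval (gramForm x.1 x.2))
    (gaussEval (gramForm x.2 x.2))

namespace PolyTime

/-! ### Running time of the elimination -/

section elimination

variable {Γ : Type} [Enc Γ]

theorem zmod4_fun₂ (f : ZMod 4 → ZMod 4 → ZMod 4) {a b : Γ → ZMod 4} (ha : PolyTime a)
    (hb : PolyTime b) : PolyTime fun x => f (a x) (b x) :=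
  (fin_fun fun x : ZMod 4 × ZMod 4 => f x.1 x.2).comp (ha.pair hb)

theorem look' : PolyTime fun x : Row × VarName => look x.1 x.2 := by
  refine of_enc_eq (foldl (Γ := Row × VarName) (A := VarName × ZMod 4)
    (step := fun x b e => if decide (e.1 = x.2) then e.2 else b) (init := fun _ => 0)
    (l := Prod.fst) (cond (decide_eq (PolyTime.fst.comp .snd)
      (PolyTime.snd.comp (PolyTime.fst.comp .fst))) (PolyTime.snd.comp .snd)
      (PolyTime.snd.comp .fst)) (.const _) .fst 7 fun _ _ _ => by simpa using tsize_zmod4_le _)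
    id (fun _ => rfl) fun x => ?_
  simp [look]

theorem entry' : PolyTime fun x : List RankOne × VarName × VarName => entry x.1 x.2.1 x.2.2 := by
  refine foldl (Γ := List RankOne × VarName × VarName) (A := RankOne)
    (step := fun x b u => b + u.1 * (look u.2.1 x.2.1 * look u.2.2 x.2.2)) (init := fun _ => 0)
    (l := Prod.fst) ?_ (.const _) .fst 7 fun _ _ _ => by simpa using tsize_zmod4_le _
  have e : PolyTime fun x : ((List RankOne × VarName × VarName) × ZMod 4) × RankOne => x.1.1.2 :=
    PolyTime.snd.comp (PolyTime.fst.comp .fst)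
  exact zmod4_fun₂ (· + ·) (PolyTime.snd.comp .fst) (zmod4_fun₂ (· * ·) (PolyTime.fst.comp .snd)
    (zmod4_fun₂ (· * ·)
      (look'.comp ((PolyTime.fst.comp (PolyTime.snd.comp .snd)).pair (PolyTime.fst.comp e)))
      (look'.comp ((PolyTime.snd.comp (PolyTime.snd.comp .snd)).pair (PolyTime.snd.comp e)))))

theorem entry {S : Γ → List RankOne} {i j : Γ → VarName} (hS : PolyTime S) (hi : PolyTime i)
    (hj : PolyTime j) : PolyTime fun x => entry (S x) (i x) (j x) :=
  comp (f := fun x => (S x, i x, j x)) entry' (hS.pair (hi.pair hj))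

theorem rowOf {V : Γ → List VarName} {S : Γ → List RankOne} {p : Γ → VarName} (hV : PolyTime V)
    (hS : PolyTime S) (hp : PolyTime p) : PolyTime fun x => rowOf (V x) (S x) (p x) :=
  map (f := fun x j => (j, _root_.entry (S x) (p x) j))
    (PolyTime.snd.pair (entry (hS.comp .fst) (hp.comp .fst) .snd)) hV

theorem partner {V : Γ → List VarName} {S : Γ → List RankOne} {p : Γ → VarName} (hV : PolyTime V)
    (hS : PolyTime S) (hp : PolyTime p) : PolyTime fun x => partner (V x) (S x) (p x) := by
  refine foldl_add (step := fun x b j => if oddRes (_root_.entry (S x) (p x) j) then j else b)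
    (cond ((fin_fun oddRes).comp (entry (hS.comp (PolyTime.fst.comp .fst))
      (hp.comp (PolyTime.fst.comp .fst)) .snd)) .snd (PolyTime.snd.comp .fst)) hp hV .X
    fun γ b a => ?_
  rw [Polynomial.eval_X]
  split <;> omega

theorem blockForms {a b s : Γ → ZMod 4} {r r' : Γ → Row} (ha : PolyTime a) (hb : PolyTime b)
    (hs : PolyTime s) (hr : PolyTime r) (hr' : PolyTime r') :
    PolyTime fun x => blockForms (a x) (b x) (s x) (r x) (r' x) := by
  have hd : PolyTime fun x => a x * b x - 1 := zmod4_fun₂ (fun a b => a * b - 1) ha hb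
  exact cons ((zmod4_fun₂ (fun d b => -(d * b)) hd hb).pair (hr.pair hr))
    (cons ((zmod4_fun₂ (· * ·) hd hs).pair (hr.pair hr'))
      (cons ((zmod4_fun₂ (· * ·) hd hs).pair (hr'.pair hr))
        (cons ((zmod4_fun₂ (fun d b => -(d * b)) hd ha).pair (hr'.pair hr')) (.const []))))

theorem elimStep {V : Γ → List VarName} {st : Γ → ElimState} {p : Γ → VarName} (hV : PolyTime V)
    (hst : PolyTime st) (hp : PolyTime p) : PolyTime fun x => elimStep (V x) (st x) (p x) := by
  have hS : PolyTime fun x => (st x).1 := PolyTime.fst.comp hst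
  have hg : PolyTime fun x => (st x).2.1 := PolyTime.fst.comp (PolyTime.snd.comp hst)
  have hc : PolyTime fun x => (st x).2.2.1 :=
    PolyTime.fst.comp (PolyTime.snd.comp (PolyTime.snd.comp hst))
  have hz : PolyTime fun x => (st x).2.2.2 :=
    PolyTime.snd.comp (PolyTime.snd.comp (PolyTime.snd.comp hst))
  have ha := entry hS hp hp
  have hj := partner hV hS hp
  have hb := entry hS hj hj
  have hs := entry hS hp hj
  have hr := rowOf hV hS hp
  have hr' := rowOf hV hS hj
  refine cond ((fin_fun oddRes).comp ha)
    ((cons (((fin_fun fun a : ZMod 4 => -a).comp ha).pair (hr.pair hr)) hS).pair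
      ((hg.add (.const 1)).pair (((fin_fun fun x : ZMod 8 × ZMod 4 =>
        x.1 + if x.2 = 1 then 1 else -1).comp (hc.pair ha)).pair hz)))
    (cond ((fin_fun oddRes).comp hs)
      (((blockForms ha hb hs hr hr').append hS).pair (((hg.add (.const 1)).add (.const 1)).pair
        (((fin_fun fun x : ZMod 8 × ZMod 4 × ZMod 4 => x.1 + blockArg x.2.1 x.2.2).comp
          (hc.pair (ha.pair hb))).pair hz)))
      (hS.pair (hg.pair (hc.pair (hz.or ((fin_fun fun a : ZMod 4 => decide (a = 2)).comp ha))))))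

/-- A row stores one residue for each entry of `V`, no matter how long the list of products `S` has
become. -/
theorem tsize_rowOf_le (V : List VarName) (S : List RankOne) (p : VarName) :
    tsize (_root_.rowOf V S p) ≤ tsize V * (tsize V + 9) + 1 := by
  refine (tsize_list_le (K := tsize V + 8) fun a ha => ?_).trans ?_
  · obtain ⟨j, hj, rfl⟩ := List.mem_map.1 ha
    have h1 := tsize_le_of_mem hj
    have h2 := tsize_zmod4_le (_root_.entry S p j)
    rw [tsize_pair]
    omega
  · rw [_root_.rowOf, List.length_map]
    exact add_le_add_left (Nat.mul_le_mul_right (tsize V + 9) (length_le_tsize V)) 1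

/-- A step prepends at most four products, that is eight rows, and increments the counter at most
twice. The growth is thus independent of the current form, as `foldl_add` requires. -/
theorem tsize_elimStep_le (V : List VarName) (st : ElimState) (p : VarName) :
    tsize (_root_.elimStep V st p) ≤ tsize st + (8 * (tsize V * (tsize V + 9) + 1) + 100) := by
  obtain ⟨S, g, c, z⟩ := st
  have h1 := tsize_rowOf_le V S p
  have h2 := tsize_rowOf_le V S (_root_.partner V S p)
  have h3 := tsize_succ_le g
  have h4 := tsize_succ_le (g + 1)
  have h5 := tsize_pos c
  have h6 := tsize_pos z
  have k4 : ∀ v : ZMod 4, tsize v ≤ 7 := tsize_zmod4_le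
  have k8 : ∀ v : ZMod 8, tsize v ≤ 11 := tsize_zmod8_le
  unfold _root_.elimStep
  dsimp only
  split
  · have e1 := k4 (-_root_.entry S p p)
    have e2 := k8 (c + if _root_.entry S p p = 1 then 1 else -1)
    simp only [tsize_pair, tsize_cons]
    omega
  split
  · set a := _root_.entry S p p
    set q := _root_.partner V S p
    set b := _root_.entry S q q
    set s := _root_.entry S p q
    have e1 := k4 (-((a * b - 1) * b))
    have e2 := k4 ((a * b - 1) * s)
    have e3 := k4 (-((a * b - 1) * a))
    have e4 := k8 (c + blockArg a b)
    simp only [_root_.blockForms, List.cons_append, List.nil_append, tsize_pair, tsize_cons]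
    omega
  · have e1 := tsize_bool_le (z || decide (_root_.entry S p p = 2))
    simp only [tsize_pair]
    omega

theorem varNames : PolyTime varNames :=
  flatMap (Γ := List RankOne) (f := fun _ (u : RankOne) => u.2.1.map Prod.fst)
    (map (f := fun _ (x : VarName × ZMod 4) => x.1) (PolyTime.fst.comp .snd)
      (PolyTime.fst.comp (PolyTime.snd.comp .snd))) .id

theorem gaussEval : PolyTime gaussEval := by
  obtain ⟨q, hq, -⟩ := id varNames
  exact foldl_add (step := fun S st p => _root_.elimStep (_root_.varNames S) st p)
    (elimStep (varNames.comp (PolyTime.fst.comp .fst)) (PolyTime.snd.comp .fst) .snd)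
    (PolyTime.id.pair (.const ((0, 0, false) : ℕ × ZMod 8 × Bool))) varNames
    (8 * (q * (q + 9) + 1) + 100) fun S st p => by
      refine (tsize_elimStep_le _ _ _).trans (add_le_add_right ?_ _)
      have h := (hq S).trans (q.eval_le_eval_nat (Nat.le_add_right (tsize S) (tsize p)))
      simp only [Polynomial.eval_add, Polynomial.eval_mul, Polynomial.eval_ofNat,
        Polynomial.eval_one]
      gcongr

end elimination

/-! ### Running time of the construction and comparison of inner products -/

section gram

variable {Γ : Type} [Enc Γ]

/-- Each step copies the counter into the list, so the growth depends on the accumulator and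
`foldl_add` does not apply; the closed form `key` of the partial folds provides the bound instead.
-/
theorem zipIdx {A : Type} [Enc A] : PolyTime fun l : List A => l.zipIdx := by
  have key : ∀ (l : List A) (n : ℕ) (acc : List (A × ℕ)),
      l.foldl (fun (s : ℕ × List (A × ℕ)) a => (s.1 + 1, (a, s.1) :: s.2)) (n, acc) =
        (n + l.length, (l.zipIdx n).reverse ++ acc) := by
    intro l
    induction l with
    | nil => intro n acc; simp
    | cons a l ih =>
      intro n acc
      rw [List.foldl_cons, ih, List.zipIdx_cons, List.reverse_cons, List.append_assoc]
      simp [add_assoc, add_comm 1]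
  refine of_enc_eq (list_reverse.comp (PolyTime.snd.comp (foldl (Γ := List A) (A := A)
    (step := fun _ (s : ℕ × List (A × ℕ)) a => (s.1 + 1, (a, s.1) :: s.2))
    (init := fun _ => (0, [])) (l := id) ?_ (.const _) .id
    ((4 * .X + 1) + (.X * (.X + (4 * .X + 1) + 2) + 1) + 1) fun l l' h => ?_)))
    id (fun _ => rfl) fun l => by simp [key]
  · have e : PolyTime fun x : (List A × (ℕ × List (A × ℕ))) × A => x.1.2 := PolyTime.snd.comp .fst
    exact ((PolyTime.fst.comp e).add (.const 1)).pair
      (cons (PolyTime.snd.pair (PolyTime.fst.comp e)) (PolyTime.snd.comp e))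
  · have hn : ∀ n ≤ tsize l, tsize n ≤ 4 * tsize l + 1 := fun n hn => by
      have := tsize_nat_le n
      have h2 : n.size ≤ n := Nat.size_le.2 n.lt_two_pow_self
      omega
    have hlen : l'.length ≤ tsize l := h.length_le.trans (length_le_tsize l)
    rw [key, tsize_pair]
    simp only [zero_add, List.append_nil, Polynomial.eval_add, Polynomial.eval_mul,
      Polynomial.eval_X, Polynomial.eval_ofNat, Polynomial.eval_one]
    refine add_le_add_left (add_le_add (hn _ hlen) ?_) _
    refine (tsize_list_le (K := tsize l + (4 * tsize l + 1) + 1) fun a ha => ?_).trans ?_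
    · rw [List.mem_reverse] at ha
      obtain ⟨a, i⟩ := a
      have h1 := tsize_le_of_mem (h.subset (List.fst_mem_of_mem_zipIdx ha))
      have h2 := List.snd_lt_of_mem_zipIdx ha
      have h3 := hn i (by simp at h2; omega)
      rw [tsize_pair]
      change tsize a ≤ tsize l at h1
      omega
    · rw [List.length_reverse, List.length_zipIdx]
      exact add_le_add_left (Nat.mul_le_mul_right _ hlen) _

theorem monoForm {v : Γ → ZMod 4} {x y : Γ → VarName} (hv : PolyTime v) (hx : PolyTime x)
    (hy : PolyTime y) : PolyTime fun a => monoForm (v a) (x a) (y a) :=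
  hv.pair ((cons (hx.pair (.const 1)) (.const [])).pair (cons (hy.pair (.const 1)) (.const [])))

theorem constraints (τ t : ℕ) : PolyTime (constraints τ t) := by
  refine flatMap (Γ := List WrittenForm) (f := fun _ (x : WrittenForm × ℕ) =>
    constraint (τ, x.2) t x.1) ?_ zipIdx
  have hu : PolyTime fun x : List WrittenForm × WrittenForm × ℕ => (τ, x.2.2) :=
    (PolyTime.const τ).pair (PolyTime.snd.comp .snd)
  refine cons (monoForm ((fin_fun fun b : Bool => if b then (2 : ZMod 4) else 0).comp
    (PolyTime.fst.comp (PolyTime.fst.comp .snd))) hu hu) (flatMap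
      (f := fun (x : List WrittenForm × WrittenForm × ℕ) (i : ℕ) =>
        [_root_.monoForm 1 (τ, x.2.2) (t, i), _root_.monoForm 1 (t, i) (τ, x.2.2)]) ?_
      (PolyTime.snd.comp (PolyTime.fst.comp .snd)))
  have hi : PolyTime fun x : (List WrittenForm × WrittenForm × ℕ) × ℕ => (t, x.2) :=
    (PolyTime.const t).pair .snd
  exact cons (monoForm (.const 1) (hu.comp .fst) hi)
    (cons (monoForm (.const 1) hi (hu.comp .fst)) (.const []))

theorem copyForm (sg : ZMod 4) (t tk td tb : ℕ) : PolyTime (copyForm sg t tk td tb) := by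
  have h3 : PolyTime fun c : WrittenTerm => c.2.2.2 := PolyTime.snd.comp (PolyTime.snd.comp .snd)
  have h5 : PolyTime fun c : WrittenTerm => c.2.2.2.2.2 := PolyTime.snd.comp (PolyTime.snd.comp h3)
  have hc : PolyTime fun z : ℤ => sg * (z : ZMod 4) :=
    (fin_fun fun v : ZMod 4 => sg * v).comp int_mod_four
  refine append (flatMap (f := fun _ (a : ℤ × ℕ) =>
      [_root_.monoForm (sg * (a.1 : ZMod 4)) (t, a.2) (t, a.2)]) ?_ (PolyTime.fst.comp h3))
    (append (flatMap (f := fun _ (a : ℤ × ℕ × ℕ) =>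
      [_root_.monoForm (sg * (a.1 : ZMod 4)) (t, a.2.1) (t, a.2.2),
        _root_.monoForm (sg * (a.1 : ZMod 4)) (t, a.2.2) (t, a.2.1)]) ?_
      (PolyTime.fst.comp (PolyTime.snd.comp h3)))
    (append ((constraints tk t).comp (PolyTime.fst.comp h5))
    (append ((constraints td t).comp (PolyTime.fst.comp (PolyTime.snd.comp h5)))
      ((constraints tb t).comp (PolyTime.fst.comp (PolyTime.snd.comp (PolyTime.snd.comp h5)))))))
  · have hi : PolyTime fun x : WrittenTerm × ℤ × ℕ => (t, x.2.2) :=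
      (PolyTime.const t).pair (PolyTime.snd.comp .snd)
    exact cons (monoForm (hc.comp (PolyTime.fst.comp .snd)) hi hi) (.const [])
  · have hi : PolyTime fun x : WrittenTerm × ℤ × ℕ × ℕ => (t, x.2.2.1) :=
      (PolyTime.const t).pair (PolyTime.fst.comp (PolyTime.snd.comp .snd))
    have hj : PolyTime fun x : WrittenTerm × ℤ × ℕ × ℕ => (t, x.2.2.2) :=
      (PolyTime.const t).pair (PolyTime.snd.comp (PolyTime.snd.comp .snd))
    have hv := hc.comp (PolyTime.fst.comp .snd : PolyTime fun x : WrittenTerm × ℤ × ℕ × ℕ => x.2.1)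
    exact cons (monoForm hv hi hj) (cons (monoForm hv hj hi) (.const []))

theorem gramForm {c d : Γ → WrittenTerm} (hc : PolyTime c) (hd : PolyTime d) :
    PolyTime fun x => gramForm (c x) (d x) :=
  append ((copyForm 1 0 4 8 6).comp hc) (append ((copyForm (-1) 1 5 8 7).comp hc)
    (append ((copyForm (-1) 2 4 9 6).comp hd) ((copyForm 1 3 5 9 7).comp hd)))

theorem posInt : PolyTime posInt := cond int_neg (.const 0) int_natAbs

theorem negInt : PolyTime negInt := cond int_neg int_natAbs (.const 0)

theorem expo {c d : Γ → WrittenTerm} (hc : PolyTime c) (hd : PolyTime d) :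
    PolyTime fun x => expo (c x) (d x) := by
  have h1 : PolyTime fun x => (c x).1 := PolyTime.fst.comp hc
  have h2 : PolyTime fun x => _root_.negInt (c x).2.1 :=
    negInt.comp (PolyTime.fst.comp (PolyTime.snd.comp hc))
  have h3 : PolyTime fun x => _root_.posInt (d x).2.1 :=
    posInt.comp (PolyTime.fst.comp (PolyTime.snd.comp hd))
  exact (((h1.add h1).add (h1.add h1)).add (h2.add h2)).add (h3.add h3)

theorem sameValues {x : Γ → WrittenTerm × WrittenTerm} {e₁ e₁₂ e₂ : Γ → ElimState}
    (hx : PolyTime x) (h₁ : PolyTime e₁) (h₁₂ : PolyTime e₁₂) (h₂ : PolyTime e₂) :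
    PolyTime fun a => sameValues (x a) (e₁ a) (e₁₂ a) (e₂ a) := by
  have hz : ∀ {e : Γ → ElimState}, PolyTime e → PolyTime fun a => (e a).2.2.2 := fun h =>
    PolyTime.snd.comp (PolyTime.snd.comp (PolyTime.snd.comp h))
  have hc : ∀ {e : Γ → ElimState}, PolyTime e → PolyTime fun a => (e a).2.2.1 := fun h =>
    PolyTime.fst.comp (PolyTime.snd.comp (PolyTime.snd.comp h))
  have hg : ∀ {e : Γ → ElimState}, PolyTime e → PolyTime fun a => (e a).2.1 := fun h =>
    PolyTime.fst.comp (PolyTime.snd.comp h)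
  have hE := expo (PolyTime.fst.comp hx) (PolyTime.snd.comp hx)
  have hE' := expo (PolyTime.snd.comp hx) (PolyTime.fst.comp hx)
  exact ((hz h₁).and (hz h₂)).or ((((hz h₁).not.and (hz h₁₂).not).and (hz h₂).not).and
    (((decide_eq (hc h₁) (hc h₁₂)).and (decide_eq (hc h₁₂) (hc h₂))).and
      ((decide_eq (hE.add (hg h₁₂)) (hE'.add (hg h₁))).and
        (decide_eq (hE.add (hg h₂)) (hE'.add (hg h₁₂))))))

theorem sameMorphism : PolyTime sameMorphism :=
  sameValues .id (gaussEval.comp (gramForm .fst .fst)) (gaussEval.comp (gramForm .fst .snd))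
    (gaussEval.comp (gramForm .snd .snd))

end gram

end PolyTime

/-! ### Terms as input -/

namespace CliffCode

variable {n m : ℕ}

/-- A written linear polynomial. -/
def _root_.LinCode.written {k : ℕ} (a : LinCode k) : WrittenForm := (a.cst, a.vars.map fun i : Fin k => (i : ℕ))

/-- A written term. -/
def written (c : CliffCode n m) : WrittenTerm :=
  (c.k, c.p, c.cst, c.lin.map (fun a => (a.1, (a.2 : ℕ))),
    c.quad.map (fun a => (a.1, (a.2.1 : ℕ), (a.2.2 : ℕ))),
    List.ofFn (fun i => (c.ket i).written), c.disc.map LinCode.written,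
    List.ofFn (fun i => (c.bra i).written), ())

theorem _root_.LinCode.enc_written {k : ℕ} (a : LinCode k) : enc a.written = a.toTree := by
  change BinTree.cons _ (BinTree.ofList _) = _
  -- In `LinCode.toTree` the list of indices is coerced to a list of natural numbers through the
  -- list monad.
  have e : (a.vars >>= fun i => pure (i : ℕ)) = a.vars.map fun i : Fin k => (i : ℕ) :=
    bind_pure_comp _ _
  rw [LinCode.toTree, LinCode.written, e, List.map_map, List.map_map]
  rfl

/-- The passage to `written` forgets `n`, `m` and the bounds on the indices but keeps the tree. This
is why one program serves all types of terms. -/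
theorem enc_written (c : CliffCode n m) : enc c.written = c.toTree := by
  have h : ∀ {k : ℕ}, (enc ∘ LinCode.written : LinCode k → BinTree) = LinCode.toTree :=
    funext LinCode.enc_written
  have h' : ∀ {k N : ℕ} (f : Fin N → LinCode k),
      enc (List.ofFn fun i => (f i).written) = .ofList (List.ofFn fun i => (f i).toTree) :=
    fun f => congrArg BinTree.ofList (by
      rw [List.map_ofFn]
      exact congrArg List.ofFn (funext fun i => LinCode.enc_written _))
  have e1 : enc (c.lin.map fun a => (a.1, (a.2 : ℕ))) =
      .ofList (c.lin.map fun a => .cons (.ofInt a.1) (.ofNat a.2)) :=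
    congrArg BinTree.ofList (by rw [List.map_map]; rfl)
  have e2 : enc (c.quad.map fun a => (a.1, (a.2.1 : ℕ), (a.2.2 : ℕ))) =
      .ofList (c.quad.map fun a => .cons (.ofInt a.1) (.cons (.ofNat a.2.1) (.ofNat a.2.2))) :=
    congrArg BinTree.ofList (by rw [List.map_map]; rfl)
  have e3 : enc (c.disc.map LinCode.written) = .ofList (c.disc.map LinCode.toTree) :=
    congrArg BinTree.ofList (by rw [List.map_map, h])
  rw [toTree, ← e1, ← e2, ← e3, ← h', ← h']
  rfl

end CliffCode

/-! ## Gauss sums -/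

/-- Powers of the imaginary unit. -/
noncomputable def quarter : AddChar (ZMod 4) ℂ := AddChar.zmodChar 4 Complex.I_pow_four

/-- The primitive eighth root of unity. -/
noncomputable def omega8 : ℂ := (1 + Complex.I) / √2

theorem sqrt_two_sq : ((√2 : ℝ) : ℂ) ^ 2 = 2 := by
  rw [← Complex.ofReal_pow, Real.sq_sqrt (by norm_num)]
  norm_num

theorem sqrt_two_ne : ((√2 : ℝ) : ℂ) ≠ 0 := fun h => by
  have := sqrt_two_sq
  rw [h] at this
  norm_num at this

theorem omega8_sq : omega8 ^ 2 = Complex.I := by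
  rw [omega8, div_pow, sqrt_two_sq, add_sq, Complex.I_sq]
  ring

theorem omega8_pow_eight : omega8 ^ 8 = 1 := by
  rw [show (8 : ℕ) = 2 * 4 from rfl, pow_mul, omega8_sq, Complex.I_pow_four]

/-- Powers of the primitive eighth root of unity. -/
noncomputable def eighth : AddChar (ZMod 8) ℂ := AddChar.zmodChar 8 omega8_pow_eight

/-- Powers of the imaginary unit, as pairs of integers. -/
def quarterPair (v : ZMod 4) : ℤ × ℤ :=
  if v = 0 then (1, 0) else if v = 1 then (0, 1) else if v = 2 then (-1, 0) else (0, -1)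

/-- Pairs of integers as complex numbers. -/
noncomputable def pairHom : ℤ × ℤ →+ ℂ where
  toFun z := z.1 + z.2 * Complex.I
  map_zero' := by simp
  map_add' z w := by
    simp only [Prod.fst_add, Prod.snd_add]
    push_cast
    ring

/-- Sums of powers of `i` become sums of pairs of integers, so identities between them with finitely
many parameters can be decided by enumeration. -/
theorem quarter_eq (v : ZMod 4) : quarter v = pairHom (quarterPair v) := by
  have h : v = 0 ∨ v = 1 ∨ v = 2 ∨ v = 3 := by revert v; decide
  rw [quarter, AddChar.zmodChar_apply]
  rcases h with rfl | rfl | rfl | rfl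
  · exact (pow_zero _).trans (by simp [pairHom, quarterPair])
  · exact (pow_one _).trans (by
      rw [quarterPair, if_neg (by decide), if_pos rfl]; simp [pairHom])
  · exact Complex.I_sq.trans (by
      rw [quarterPair, if_neg (by decide), if_neg (by decide), if_pos rfl]; simp [pairHom])
  · exact Complex.I_pow_three.trans (by
      rw [quarterPair, if_neg (by decide), if_neg (by decide), if_neg (by decide)]; simp [pairHom])

theorem one_eq_pairHom : (1 : ℂ) = pairHom (1, 0) := by simp [pairHom]

theorem eighth_one : eighth 1 = omega8 := by
  rw [eighth, AddChar.zmodChar_apply]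
  exact pow_one _

/-- The numbers `1 + i` and `1 - i` are `√2` times primitive eighth roots of unity; the modulus and
argument contributed by an odd pivot come from here. -/
theorem one_add_quarter (a : ZMod 4) (ha : oddRes a = true) :
    1 + quarter a = √2 * eighth (if a = 1 then 1 else -1) := by
  have h1 : (√2 : ℂ) * omega8 = 1 + Complex.I := by
    rw [omega8, mul_div_cancel₀ _ sqrt_two_ne]
  have h2 : quarter 1 = Complex.I := by
    rw [quarter, AddChar.zmodChar_apply]
    exact pow_one _
  have h3 : quarter 3 = -Complex.I := by
    rw [quarter, AddChar.zmodChar_apply]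
    exact Complex.I_pow_three
  have h4 : eighth (-1) = -Complex.I * omega8 := by
    rw [eighth, AddChar.zmodChar_apply]
    change omega8 ^ 7 = _
    rw [show (7 : ℕ) = 2 * 3 + 1 from rfl, pow_succ, pow_mul, omega8_sq, Complex.I_pow_three]
  have h5 : a = 1 ∨ a = 3 := of_decide_eq_true ha
  rcases h5 with rfl | rfl
  · rw [if_pos rfl, eighth_one, h1, h2]
  · rw [if_neg (by decide), h4, h3, mul_left_comm, h1, mul_add, neg_mul, neg_mul, Complex.I_mul_I]
    ring

/-- For even `r` both sides are `1 + i ^ a`. For odd `r` both are `1 - i ^ a`, because `i ^ (-a) =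
-i ^ a` when `a` is odd. The dependence on the row value `r` is thus a correction of the quadratic
form. -/
theorem quarter_pair (a r : ZMod 4) (ha : oddRes a = true) :
    1 + quarter (r + r + a) = (1 + quarter a) * quarter (-a * (r * r)) := by
  have key : ∀ a r : ZMod 4, oddRes a = true →
      (1, 0) + quarterPair (r + r + a) =
        quarterPair (-a * (r * r)) + quarterPair (a + -a * (r * r)) := by
    decide +kernel
  rw [one_add_mul, ← AddChar.map_add_eq_mul, one_eq_pairHom]
  simp only [quarter_eq]
  rw [← map_add, key a r ha, map_add]

/-- The analogue of `quarter_pair` for a pivot block with diagonal `a`, `b` and off-diagonal entry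
`s`. Its determinant `a b - s ^ 2 = a b - 1` is odd, hence its own inverse modulo 4, and the
correction is minus the form of the inverse block in `(r, r')`, as in a Schur complement. -/
theorem quarter_block (a b s r r' : ZMod 4) (ha : oddRes a = false) (hs : oddRes s = true) :
    1 + quarter (r + r + a) + quarter (r' + r' + b) + quarter (r + r + a + (r' + r' + s + s + b)) =
      2 * eighth (blockArg a b) * quarter (-((a * b - 1) * b) * (r * r) +
        (a * b - 1) * s * (r * r') + (a * b - 1) * s * (r' * r) + -((a * b - 1) * a) * (r' * r')) := by
  have key : ∀ a b s r r' : ZMod 4, oddRes a = false → oddRes s = true →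
      (1, 0) + quarterPair (r + r + a) + quarterPair (r' + r' + b) +
        quarterPair (r + r + a + (r' + r' + s + s + b)) =
      quarterPair ((if a = 2 then b else 0) + (-((a * b - 1) * b) * (r * r) +
        (a * b - 1) * s * (r * r') + (a * b - 1) * s * (r' * r) + -((a * b - 1) * a) * (r' * r'))) +
      quarterPair ((if a = 2 then b else 0) + (-((a * b - 1) * b) * (r * r) +
        (a * b - 1) * s * (r * r') + (a * b - 1) * s * (r' * r) + -((a * b - 1) * a) * (r' * r'))) := by
    decide +kernel
  have h8 : eighth (blockArg a b) = quarter (if a = 2 then b else 0) := by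
    rw [blockArg]
    split
    · rw [eighth, quarter, AddChar.zmodChar_apply, AddChar.zmodChar_apply, ← omega8_sq, ← pow_mul]
      have hb := b.val_lt
      rw [ZMod.val_natCast, Nat.mod_eq_of_lt (by omega)]
    · simp
  rw [h8, mul_assoc, ← AddChar.map_add_eq_mul, two_mul]
  rw [one_eq_pairHom]
  simp only [quarter_eq, ← map_add]
  rw [key a b s r r' ha hs]

/-! ### Gauss sums of quadratic forms modulo 4 -/

section gauss

variable {J : Type} [Fintype J] [DecidableEq J]

/-- Residues modulo 2 as residues modulo 4. -/
def lift4 (b : ZMod 2) : ZMod 4 := b.val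

/-- The value of a linear form. -/
def linVal (r : J → ZMod 4) (x : J → ZMod 2) : ZMod 4 := ∑ j, r j * lift4 (x j)

/-- The value of a quadratic form. -/
def quadVal (M : J → J → ZMod 4) (x : J → ZMod 2) : ZMod 4 :=
  ∑ i, lift4 (x i) * linVal (M i) x

/-- The Gauss sum of a quadratic form. -/
noncomputable def gaussSum4 (M : J → J → ZMod 4) : ℂ := ∑ x : J → ZMod 2, quarter (quadVal M x)

/-- Change of one coordinate. -/
def flipAt (x : J → ZMod 2) (p : J) : J → ZMod 2 := x + Pi.single p 1

theorem lift4_flip (x : J → ZMod 2) (p j : J) :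
    lift4 (flipAt x p j) = lift4 (x j) + if j = p then 1 - 2 * lift4 (x p) else 0 := by
  have h : ∀ b : ZMod 2, lift4 (b + 1) = lift4 b + (1 - 2 * lift4 b) := by decide
  rw [flipAt, Pi.add_apply]
  by_cases hj : j = p
  · subst hj
    rw [Pi.single_eq_same, if_pos rfl, h]
  · rw [Pi.single_eq_of_ne hj, if_neg hj, add_zero, add_zero]

theorem linVal_flip (r : J → ZMod 4) (x : J → ZMod 2) (p : J) :
    linVal r (flipAt x p) = linVal r x + r p * (1 - 2 * lift4 (x p)) := by
  simp only [linVal, lift4_flip, mul_add, Finset.sum_add_distrib, mul_ite, mul_zero,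
    Finset.sum_ite_eq', Finset.mem_univ, if_true]

/-- The flip changes `lift4 (x p)` by `1 - 2 lift4 (x p)`, which is a sign: its square is `1` and
its double is `2`. By symmetry the mixed terms occur twice, so the sign disappears from the result.
-/
theorem quadVal_flip (M : J → J → ZMod 4) (hM : ∀ i j, M i j = M j i) (x : J → ZMod 2) (p : J) :
    quadVal M (flipAt x p) = quadVal M x + (linVal (M p) x + linVal (M p) x + M p p) := by
  have h1 : ∑ i, lift4 (x i) * M i p = linVal (M p) x :=
    Finset.sum_congr rfl fun i _ => by rw [hM i p, mul_comm]
  have h2 : ∀ b : ZMod 2, (1 - 2 * lift4 b) ^ 2 = 1 ∧ 2 * (1 - 2 * lift4 b) = 2 := by decide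
  obtain ⟨h3, h4⟩ := h2 (x p)
  simp only [quadVal, lift4_flip, linVal_flip, add_mul, mul_add, Finset.sum_add_distrib, ite_mul,
    zero_mul, Finset.sum_ite_eq', Finset.mem_univ, if_true, ← mul_assoc, ← Finset.sum_mul, h1]
  linear_combination linVal (M p) x * h4 + M p p * h3

theorem sum_flip (f : (J → ZMod 2) → ℂ) (p : J) : ∑ x, f (flipAt x p) = ∑ x, f x :=
  Fintype.sum_equiv (Equiv.addRight (Pi.single p 1 : J → ZMod 2)) _ _ fun _ => rfl

/-- Adding the sum to its reindexing by the flip of `p` brings in `quarter_pair`. The variable `p`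
remains a summation variable, so that all forms in the elimination live on the same index type. -/
theorem gaussSum4_odd (M M' : J → J → ZMod 4) (hM : ∀ i j, M i j = M j i) (p : J)
    (hp : oddRes (M p p) = true)
    (hM' : ∀ x, quadVal M' x = quadVal M x + -M p p * (linVal (M p) x * linVal (M p) x)) :
    gaussSum4 M = (√2 : ℂ)⁻¹ * eighth (if M p p = 1 then 1 else -1) * gaussSum4 M' := by
  have h1 : gaussSum4 M + gaussSum4 M = (1 + quarter (M p p)) * gaussSum4 M' := by
    nth_rewrite 2 [gaussSum4]
    rw [← sum_flip _ p, gaussSum4, gaussSum4, ← Finset.sum_add_distrib, Finset.mul_sum]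
    refine Finset.sum_congr rfl fun x _ => ?_
    have hx := AddChar.map_add_eq_mul quarter (quadVal M x)
    rw [quadVal_flip M hM, hM', hx, hx, ← mul_one_add, quarter_pair _ _ hp]
    ring
  rw [one_add_quarter _ hp] at h1
  have h2 : (√2 : ℂ)⁻¹ = √2 / 2 := by
    rw [eq_div_iff two_ne_zero, ← sqrt_two_sq, sq,
      inv_mul_cancel_left₀ sqrt_two_ne]
  rw [h2]
  linear_combination h1 / 2

/-- The same averaging over the four combinations of flips of `p` and `q`, evaluated by
`quarter_block`. -/
theorem gaussSum4_block (M M' : J → J → ZMod 4) (hM : ∀ i j, M i j = M j i) (p q : J)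
    (hp : oddRes (M p p) = false) (hq : oddRes (M p q) = true)
    (hM' : ∀ x, quadVal M' x = quadVal M x +
      (-((M p p * M q q - 1) * M q q) * (linVal (M p) x * linVal (M p) x) +
        (M p p * M q q - 1) * M p q * (linVal (M p) x * linVal (M q) x) +
        (M p p * M q q - 1) * M p q * (linVal (M q) x * linVal (M p) x) +
        -((M p p * M q q - 1) * M p p) * (linVal (M q) x * linVal (M q) x))) :
    gaussSum4 M = 2⁻¹ * eighth (blockArg (M p p) (M q q)) * gaussSum4 M' := by
  have h2 : ∀ b : ZMod 2, 2 * (1 - 2 * lift4 b) = 2 := by decide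
  have h1 : gaussSum4 M + gaussSum4 M + gaussSum4 M + gaussSum4 M =
      2 * eighth (blockArg (M p p) (M q q)) * gaussSum4 M' := by
    have e1 : gaussSum4 M = ∑ x : J → ZMod 2, quarter (quadVal M (flipAt x p)) :=
      (sum_flip _ p).symm
    have e2 : gaussSum4 M = ∑ x : J → ZMod 2, quarter (quadVal M (flipAt x q)) :=
      (sum_flip _ q).symm
    have e3 : gaussSum4 M = ∑ x : J → ZMod 2,
        quarter (quadVal M (flipAt (flipAt x p) q)) := by
      rw [e2, ← sum_flip _ p]
    calc gaussSum4 M + gaussSum4 M + gaussSum4 M + gaussSum4 M = gaussSum4 M +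
        ∑ x : J → ZMod 2, quarter (quadVal M (flipAt x p)) +
        ∑ x : J → ZMod 2, quarter (quadVal M (flipAt x q)) +
        ∑ x : J → ZMod 2, quarter (quadVal M (flipAt (flipAt x p) q)) := by
          rw [← e1, ← e2, ← e3]
      _ = _ := ?_
    rw [gaussSum4, gaussSum4, ← Finset.sum_add_distrib, ← Finset.sum_add_distrib,
      ← Finset.sum_add_distrib, Finset.mul_sum]
    refine Finset.sum_congr rfl fun x _ => ?_
    have e4 : quadVal M (flipAt (flipAt x p) q) = quadVal M x +
        (linVal (M p) x + linVal (M p) x + M p p +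
          (linVal (M q) x + linVal (M q) x + M p q + M p q + M q q)) := by
      rw [quadVal_flip M hM, quadVal_flip M hM, linVal_flip, hM q p]
      linear_combination M p q * h2 (x p)
    have hx := AddChar.map_add_eq_mul quarter (quadVal M x)
    rw [e4, quadVal_flip M hM, quadVal_flip M hM, hM', hx, hx, hx, hx]
    have := quarter_block (M p p) (M q q) (M p q) (linVal (M p) x) (linVal (M q) x) hp hq
    linear_combination quarter (quadVal M x) * this
  linear_combination h1 / 4

/-- A flip of `p` multiplies every summand by `i ^ 2 = -1`, so the sum equals its own negative. -/
theorem gaussSum4_isolated (M : J → J → ZMod 4) (hM : ∀ i j, M i j = M j i) (p : J)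
    (hp : M p p = 2) (h : ∀ j, 2 * M p j = 0) : gaussSum4 M = 0 := by
  have h2 : quarter 2 = -1 := by
    rw [quarter, AddChar.zmodChar_apply]
    exact Complex.I_sq
  have h1 : gaussSum4 M = -gaussSum4 M := by
    nth_rewrite 1 [gaussSum4]
    rw [← sum_flip _ p, gaussSum4, ← Finset.sum_neg_distrib]
    refine Finset.sum_congr rfl fun x _ => ?_
    have : linVal (M p) x + linVal (M p) x = 0 := by
      rw [← two_mul, linVal, Finset.mul_sum]
      exact Finset.sum_eq_zero fun j _ => by rw [← mul_assoc, h, zero_mul]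
    rw [quadVal_flip M hM, this, hp, zero_add, AddChar.map_add_eq_mul, h2, mul_neg_one]
  linear_combination h1 / 2

/-- The entries at `(i, j)` and `(j, i)` together contribute a multiple of `2 M i j = 0` and the
diagonal is zero, so every summand is `1`. -/
theorem gaussSum4_null (M : J → J → ZMod 4) (hM : ∀ i j, M i j = M j i) (h0 : ∀ i, M i i = 0)
    (h : ∀ i j, 2 * M i j = 0) : gaussSum4 M = 2 ^ Fintype.card J := by
  have hq : ∀ x, quadVal M x = 0 := by
    intro x
    simp only [quadVal, linVal, Finset.mul_sum]
    rw [← Finset.sum_product']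
    refine Finset.sum_involution (fun a _ => a.swap) (fun a _ => ?_) (fun a _ ha hs => ha ?_)
      (fun a _ => Finset.mem_univ _) fun a _ => Prod.swap_swap a
    · simp only [Prod.fst_swap, Prod.snd_swap, hM a.2 a.1]
      linear_combination (lift4 (x a.1) * lift4 (x a.2)) * h a.1 a.2
    · have : a.2 = a.1 := congrArg Prod.fst hs
      rw [this, h0, zero_mul, mul_zero]
  simp [gaussSum4, hq, ZMod.card]

end gauss

/-! ### Correctness of the evaluation -/

section correctness

theorem foldl_add_eq {α : Type} (f : α → ZMod 4) (l : List α) (b : ZMod 4) :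
    l.foldl (fun b u => b + f u) b = b + (l.map f).sum := by
  induction l generalizing b with
  | nil => simp
  | cons a l ih => rw [List.foldl_cons, ih, List.map_cons, List.sum_cons, add_assoc]

theorem entry_eq (S : List RankOne) (i j : VarName) :
    entry S i j = (S.map fun u => u.1 * (look u.2.1 i * look u.2.2 j)).sum := by
  rw [entry, foldl_add_eq, zero_add]

theorem entry_cons (u : RankOne) (S : List RankOne) (i j : VarName) :
    entry (u :: S) i j = u.1 * (look u.2.1 i * look u.2.2 j) + entry S i j := by
  rw [entry_eq, entry_eq, List.map_cons, List.sum_cons]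

/-- Names may be repeated in `V`, but all pairs with the same name carry the same value. -/
theorem look_map (f : VarName → ZMod 4) (V : List VarName) (j : VarName) (b : ZMod 4) :
    (V.map fun j => (j, f j)).foldl (fun b e => if e.1 = j then e.2 else b) b =
      if j ∈ V then f j else b := by
  induction V generalizing b with
  | nil => simp
  | cons a V ih =>
    rw [List.map_cons, List.foldl_cons, ih]
    by_cases hj : a = j
    · subst hj; simp
    · have : j ≠ a := fun h => hj h.symm
      simp [hj, this]

theorem look_eq_zero (r : Row) (j : VarName) (h : j ∉ r.map Prod.fst) : look r j = 0 := by
  have : ∀ (r : Row) (b : ZMod 4), j ∉ r.map Prod.fst →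
      r.foldl (fun b e => if e.1 = j then e.2 else b) b = b := by
    intro r
    induction r with
    | nil => simp
    | cons e r ih =>
      intro b h
      rw [List.map_cons, List.mem_cons, not_or] at h
      rw [List.foldl_cons, ih _ h.2, if_neg (Ne.symm h.1)]
  exact this r 0 h

/-- The matrix is symmetric and vanishes outside the given variables. -/
structure GoodForm (V : List VarName) (S : List RankOne) : Prop where
  symm : ∀ i j, entry S i j = entry S j i
  supp : ∀ i j, i ∉ V → entry S i j = 0

/-- Columns outside `V` are not stored; their entries vanish by symmetry and `supp`. -/
theorem GoodForm.look_rowOf {V : List VarName} {S : List RankOne} (h : GoodForm V S)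
    (p j : VarName) : look (rowOf V S p) j = entry S p j := by
  rw [look, rowOf, look_map (entry S p)]
  split
  · rfl
  · rw [h.symm, h.supp _ _ ‹_›]

/-- Collecting the names of the left factors alone is enough, since for a symmetric matrix the
vanishing of rows gives that of columns. -/
theorem entry_eq_zero (S : List RankOne) (i j : VarName) (h : i ∉ varNames S) : entry S i j = 0 := by
  rw [entry_eq]
  refine List.sum_eq_zero fun x hx => ?_
  obtain ⟨u, hu, rfl⟩ := List.mem_map.1 hx
  rw [look_eq_zero, zero_mul, mul_zero]
  exact fun h' => h (List.mem_flatMap.2 ⟨u, hu, h'⟩)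

/-- When no entry is odd, the fold returns its default `p`. The diagonal entry at `p` has already
been found even by `elimStep`, so the test on the partner then fails as it should. -/
theorem partner_spec (V : List VarName) (S : List RankOne) (p : VarName) :
    (oddRes (entry S p (partner V S p)) = true ∧ partner V S p ∈ p :: V) ∨
      (partner V S p = p ∧ ∀ j ∈ V, oddRes (entry S p j) = false) := by
  have key : ∀ (l : List VarName) (b : VarName),
      (oddRes (entry S p (l.foldl (fun b j => if oddRes (entry S p j) then j else b) b)) = true ∧
        l.foldl (fun b j => if oddRes (entry S p j) then j else b) b ∈ b :: l) ∨
        (l.foldl (fun b j => if oddRes (entry S p j) then j else b) b = b ∧ ∀ j ∈ l, oddRes (entry S p j) = false) := by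
    intro l
    induction l with
    | nil => simp
    | cons a l ih =>
      intro b
      simp only [List.foldl_cons]
      by_cases h : oddRes (entry S p a) = true
      · rw [if_pos h]
        rcases ih a with ⟨h1, h2⟩ | ⟨h1, h2⟩
        · exact Or.inl ⟨h1, List.mem_cons_of_mem _ h2⟩
        · refine Or.inl ⟨by rw [h1]; exact h, by rw [h1]; simp⟩
      · rw [if_neg h]
        rcases ih b with ⟨h1, h2⟩ | ⟨h1, h2⟩
        · refine Or.inl ⟨h1, ?_⟩
          rcases List.mem_cons.1 h2 with h3 | h3
          · rw [h3]; simp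
          · exact List.mem_cons_of_mem _ (List.mem_cons_of_mem _ h3)
        · refine Or.inr ⟨h1, fun j hj => ?_⟩
          rcases List.mem_cons.1 hj with rfl | hj
          · simpa using h
          · exact h2 j hj
  exact key V p

/-- The row of a variable that has no influence. -/
def NullRow (S : List RankOne) (p : VarName) : Prop :=
  entry S p p = 0 ∧ ∀ j, 2 * entry S p j = 0

theorem not_odd {v : ZMod 4} (h : oddRes v = false) : 2 * v = 0 := by
  revert v; decide

theorem odd_mul_self {v : ZMod 4} (h : oddRes v = true) : v * v = 1 := by
  revert v; decide

theorem even_mul_even {v w : ZMod 4} (h : 2 * v = 0) (h' : 2 * w = 0) : v * w = 0 := by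
  revert v w; decide

/-- The effect of the elimination of a variable on the quadratic form. -/
structure ElimSpec {J : Type} [Fintype J] [DecidableEq J] (nm : J → VarName) (V : List VarName)
    (st st' : ElimState) (p : VarName) : Prop where
  good : GoodForm V st'.1
  null : NullRow st'.1 p ∨ st'.2.2.2 = true
  keep : ∀ i, NullRow st.1 i → NullRow st'.1 i
  flag : st.2.2.2 = true → st'.2.2.2 = true
  value : (if st'.2.2.2 then 0 else (√2 : ℂ)⁻¹ ^ st'.2.1 * eighth st'.2.2.1 *
      gaussSum4 fun i j => entry st'.1 (nm i) (nm j)) =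
    if st.2.2.2 then 0 else (√2 : ℂ)⁻¹ ^ st.2.1 * eighth st.2.2.1 *
      gaussSum4 fun i j => entry st.1 (nm i) (nm j)

variable {J : Type} [Fintype J] [DecidableEq J]

theorem quadVal_add_rankOne (M M' : J → J → ZMod 4) (v : ZMod 4) (r r' : J → ZMod 4)
    (h : ∀ i j, M' i j = v * (r i * r' j) + M i j) (x : J → ZMod 2) :
    quadVal M' x = v * (linVal r x * linVal r' x) + quadVal M x := by
  simp only [quadVal, linVal, h, add_mul, Finset.sum_add_distrib, mul_add, Finset.mul_sum,
    Finset.sum_mul]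
  congr 1
  rw [Finset.sum_comm]
  exact Finset.sum_congr rfl fun i _ => Finset.sum_congr rfl fun j _ => by ring

/-- Subtracting the Schur complement correction clears the row of `p`. A row that was already null
stays so: its entries in the pivot columns are even, and products of even residues vanish modulo 4.
Without an odd entry the row of `p` is even, and its diagonal entry decides between a null row and a
vanishing sum. -/
theorem elimStep_spec (nm : J → VarName) (V : List VarName) (hV : ∀ p ∈ V, ∃ j, nm j = p)
    (st : ElimState) (h : GoodForm V st.1) (p : VarName) (hp : p ∈ V) :
    ElimSpec nm V st (elimStep V st p) p := by
  obtain ⟨S, g, c, z⟩ := st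
  obtain ⟨p, rfl⟩ := hV p hp
  dsimp only at h
  unfold elimStep
  dsimp only
  split
  · rename_i ha
    have he : ∀ i j, entry ((-entry S (nm p) (nm p), rowOf V S (nm p), rowOf V S (nm p)) :: S) i j =
        -entry S (nm p) (nm p) * (entry S (nm p) i * entry S (nm p) j) + entry S i j := by
      intro i j
      rw [entry_cons, h.look_rowOf, h.look_rowOf]
    refine ⟨⟨fun i j => ?_, fun i j hi => ?_⟩, Or.inl ?_, fun i hi => ⟨?_, fun j => ?_⟩, fun h => h, ?_⟩
    · rw [he, he, h.symm i j, mul_comm (entry S (nm p) i)]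
    · rw [he, h.supp i j hi, h.symm (nm p) i, h.supp i _ hi]
      ring
    · have : ∀ j, entry ((-entry S (nm p) (nm p), rowOf V S (nm p), rowOf V S (nm p)) :: S)
          (nm p) j = 0 := fun j => by
        rw [he]
        linear_combination -entry S (nm p) j * odd_mul_self ha
      exact ⟨this _, fun j => by rw [this, mul_zero]⟩
    · have h1 := hi.2 (nm p)
      dsimp only at *
      rw [he, hi.1, h.symm (nm p) i, even_mul_even h1 h1, mul_zero, zero_add]
    · dsimp only at *
      rw [he, h.symm _ i]
      linear_combination hi.2 j - entry S (nm p) (nm p) * entry S (nm p) j * hi.2 (nm p)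
    · dsimp only
      cases z
      · simp only [Bool.false_eq_true, if_false]
        rw [gaussSum4_odd (fun i j => entry S (nm i) (nm j)) _ (fun i j => h.symm _ _) p ha
          fun x => (quadVal_add_rankOne _ _ _ _ _ (fun i j => he (nm i) (nm j)) x).trans
            (add_comm _ _)]
        rw [AddChar.map_add_eq_mul, pow_succ]
        ring
      · rw [if_pos rfl, if_pos rfl]
  rename_i ha
  rw [Bool.not_eq_true] at ha
  have hspec := partner_spec V S (nm p)
  split
  · rename_i hs
    set q := partner V S (nm p) with hq
    have hqV : q ∈ V := by
      rcases hspec with ⟨-, h2⟩ | ⟨h2, -⟩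
      · rcases List.mem_cons.1 h2 with h3 | h3
        · rw [h3]; exact hp
        · exact h3
      · rw [h2]; exact hp
    clear_value q
    obtain ⟨q, rfl⟩ := hV q hqV
    set a := entry S (nm p) (nm p)
    set b := entry S (nm q) (nm q)
    set s := entry S (nm p) (nm q) with hsdef
    have he : ∀ i j, entry (blockForms a b s (rowOf V S (nm p)) (rowOf V S (nm q)) ++ S) i j =
        -((a * b - 1) * b) * (entry S (nm p) i * entry S (nm p) j) +
        ((a * b - 1) * s * (entry S (nm p) i * entry S (nm q) j) +
        ((a * b - 1) * s * (entry S (nm q) i * entry S (nm p) j) +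
        (-((a * b - 1) * a) * (entry S (nm q) i * entry S (nm q) j) + entry S i j))) := by
      intro i j
      simp only [blockForms, List.cons_append, List.nil_append, entry_cons, h.look_rowOf]
    have hsq : entry S (nm q) (nm p) = s := h.symm _ _
    refine ⟨⟨fun i j => ?_, fun i j hi => ?_⟩, Or.inl ?_, fun i hi => ⟨?_, fun j => ?_⟩, fun h => h, ?_⟩
    · rw [he, he, h.symm i j]
      ring
    · rw [he, h.supp i j hi, h.symm (nm p) i, h.symm (nm q) i, h.supp i _ hi, h.supp i _ hi]
      ring
    · have hab : ∀ a b s : ZMod 4, oddRes a = false → oddRes s = true →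
          -((a * b - 1) * b) * a + (a * b - 1) * s * s + 1 = 0 := by decide
      have : ∀ j, entry (blockForms a b s (rowOf V S (nm p)) (rowOf V S (nm q)) ++ S)
          (nm p) j = 0 := fun j => by
        rw [he, hsq]
        linear_combination entry S (nm p) j * hab a b s ha hs
      exact ⟨this _, fun j => by rw [this, mul_zero]⟩
    · have h1 := hi.2 (nm p)
      have h2 := hi.2 (nm q)
      dsimp only at *
      rw [he, hi.1, h.symm (nm p), h.symm (nm q), even_mul_even h1 h1, even_mul_even h1 h2,
        even_mul_even h2 h1, even_mul_even h2 h2]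
      ring
    · have h1 := hi.2 (nm p)
      have h2 := hi.2 (nm q)
      dsimp only at *
      rw [he, h.symm (nm p) i, h.symm (nm q) i]
      linear_combination hi.2 j + (-((a * b - 1) * b) * entry S (nm p) j +
        (a * b - 1) * s * entry S (nm q) j) * h1 + ((a * b - 1) * s * entry S (nm p) j -
        (a * b - 1) * a * entry S (nm q) j) * h2
    · dsimp only
      cases z
      · simp only [Bool.false_eq_true, if_false]
        rw [gaussSum4_block (fun i j => entry S (nm i) (nm j))
          (fun i j => entry (blockForms a b s (rowOf V S (nm p)) (rowOf V S (nm q)) ++ S) (nm i) (nm j))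
          (fun i j => h.symm _ _) p q ha hs fun x => ?_]
        · rw [AddChar.map_add_eq_mul, pow_succ, pow_succ]
          have : (√2 : ℂ)⁻¹ * (√2 : ℂ)⁻¹ = 2⁻¹ := by
            rw [← mul_inv, ← sq, sqrt_two_sq]
          linear_combination (√2 : ℂ)⁻¹ ^ g * eighth c * eighth (blockArg a b) *
            (gaussSum4 fun i j => entry (blockForms a b s (rowOf V S (nm p)) (rowOf V S (nm q)) ++ S)
              (nm i) (nm j)) * this
        · have e1 := quadVal_add_rankOne _ _ _ _ _ (fun i j => he (nm i) (nm j)) x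
          rw [e1, quadVal_add_rankOne _ _ _ _ _ (fun i j => rfl) x,
            quadVal_add_rankOne _ _ _ _ _ (fun i j => rfl) x,
            quadVal_add_rankOne _ _ _ _ _ (fun i j => rfl) x]
          ring
      · rw [if_pos rfl, if_pos rfl]
  · rename_i hs
    have heven : ∀ j, 2 * entry S (nm p) j = 0 := by
      rcases hspec with ⟨h1, -⟩ | ⟨-, h1⟩
      · exact absurd h1 hs
      · intro j
        by_cases hj : j ∈ V
        · exact not_odd (h1 j hj)
        · rw [h.symm, h.supp _ _ hj, mul_zero]
    have h02 : entry S (nm p) (nm p) = 0 ∨ entry S (nm p) (nm p) = 2 := by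
      revert ha
      generalize entry S (nm p) (nm p) = v
      revert v
      decide
    refine ⟨h, ?_, fun i hi => hi, fun h => by simp at h; simp [h], ?_⟩
    · rcases h02 with h0 | h0
      · exact Or.inl ⟨h0, heven⟩
      · exact Or.inr (by simp [h0])
    · dsimp only
      rcases h02 with h0 | h0
      · rw [h0]
        have : decide ((0 : ZMod 4) = 2) = false := by decide
        rw [this, Bool.or_false]
      · rw [gaussSum4_isolated (fun i j => entry S (nm i) (nm j)) (fun i j => h.symm _ _) p h0
          fun j => heven _]
        simp

/-- Induction over the names still to be treated; the invariant is that all other names have null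
rows unless the flag is set. In the end `gaussSum4_null` gives `2 ^ card J`, which includes the
factors of the variables that never occur in `S` and are never visited. -/
theorem gaussEval_spec (nm : J → VarName) (S : List RankOne)
    (hs : ∀ i j, entry S i j = entry S j i) (hV : ∀ p ∈ varNames S, ∃ j, nm j = p) :
    (gaussSum4 fun i j => entry S (nm i) (nm j)) =
      if (gaussEval S).2.2.2 then 0 else
        (√2 : ℂ)⁻¹ ^ (gaussEval S).2.1 * eighth (gaussEval S).2.2.1 * 2 ^ Fintype.card J := by
  set V := varNames S with hVdef
  have key : ∀ (l : List VarName) (st : ElimState), (∀ p ∈ l, p ∈ V) → GoodForm V st.1 →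
      (∀ i ∈ V, i ∉ l → NullRow st.1 i ∨ st.2.2.2 = true) →
      (if st.2.2.2 then 0 else (√2 : ℂ)⁻¹ ^ st.2.1 * eighth st.2.2.1 *
        gaussSum4 fun i j => entry st.1 (nm i) (nm j)) =
      if (l.foldl (elimStep V) st).2.2.2 then 0 else
        (√2 : ℂ)⁻¹ ^ (l.foldl (elimStep V) st).2.1 * eighth (l.foldl (elimStep V) st).2.2.1 *
          2 ^ Fintype.card J := by
    intro l
    induction l with
    | nil =>
      intro st _ hg hn
      rw [List.foldl_nil]
      split
      · rfl
      · rename_i hz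
        have hn' : ∀ i, NullRow st.1 i := by
          intro i
          by_cases hi : i ∈ V
          · exact (hn i hi (by simp)).resolve_right hz
          · exact ⟨hg.supp _ _ hi, fun j => by rw [hg.supp _ _ hi, mul_zero]⟩
        rw [gaussSum4_null _ (fun i j => hg.symm _ _) (fun i => (hn' _).1) fun i j => (hn' _).2 _]
    | cons p l ih =>
      intro st hl hg hn
      have hsp := elimStep_spec nm V hV st hg p (hl p (by simp))
      rw [List.foldl_cons, ← ih _ (fun q hq => hl q (by simp [hq])) hsp.good ?_, hsp.value]
      intro i hi hil
      by_cases hip : i = p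
      · rw [hip]; exact hsp.null
      · rcases hn i hi (by simp [hip, hil]) with h | h
        · exact Or.inl (hsp.keep i h)
        · exact Or.inr (hsp.flag h)
  have := key V (S, 0, 0, false) (fun _ h => h) ⟨hs, fun i j => entry_eq_zero S i j⟩
    (fun i hi hil => absurd hi hil)
  rw [gaussEval, ← this]
  simp

end correctness

/-! ## Values of polynomials -/

/-- Boolean vectors. -/
abbrev BVec (k : ℕ) : Type := Fin k → ZMod 2

section values

variable {k : ℕ}

/-- The real number `0` or `1`. -/
def bit01 (b : ZMod 2) : ℝ := (b.val : ℝ)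

/-- Value of a phase polynomial. -/
noncomputable def evalP (P : PhasePoly k) (x : BVec k) : ℝ := eval (fun i => bit01 (x i)) P

/-- Value of a Boolean polynomial. -/
noncomputable def evalB (Q : BoolPoly k) (x : BVec k) : ZMod 2 := eval x Q

theorem bit01_zero : bit01 0 = 0 := by simp [bit01]

theorem bit01_one : bit01 1 = 1 := by
  have : (1 : ZMod 2).val = 1 := rfl
  rw [bit01, this, Nat.cast_one]

theorem zmod2_cases (b : ZMod 2) : b = 0 ∨ b = 1 := by revert b; decide

theorem bit01_mul (a b : ZMod 2) : bit01 (a * b) = bit01 a * bit01 b := by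
  rcases zmod2_cases a with rfl | rfl <;> simp [bit01_zero, bit01_one]

theorem bit01_sq (a : ZMod 2) : bit01 a ^ 2 = bit01 a := by
  rcases zmod2_cases a with rfl | rfl <;> simp [bit01_zero, bit01_one]

theorem bit01_add (a b : ZMod 2) : bit01 (a + b) = bit01 a + bit01 b - 2 * bit01 a * bit01 b := by
  have h : (1 + 1 : ZMod 2) = 0 := rfl
  rcases zmod2_cases a with rfl | rfl <;> rcases zmod2_cases b with rfl | rfl <;>
    simp [bit01_zero, bit01_one, h]
  norm_num

theorem evalP_add (P P' : PhasePoly k) (x : BVec k) :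
    evalP (P + P') x = evalP P x + evalP P' x := map_add _ _ _

theorem evalP_sub (P P' : PhasePoly k) (x : BVec k) :
    evalP (P - P') x = evalP P x - evalP P' x := map_sub _ _ _

theorem evalP_mul (P P' : PhasePoly k) (x : BVec k) :
    evalP (P * P') x = evalP P x * evalP P' x := map_mul _ _ _

theorem evalP_C (r : ℝ) (x : BVec k) : evalP (C r) x = r := eval_C _

theorem evalP_X (i : Fin k) (x : BVec k) : evalP (X i) x = bit01 (x i) := eval_X _

theorem evalB_add (P P' : BoolPoly k) (x : BVec k) :
    evalB (P + P') x = evalB P x + evalB P' x := map_add _ _ _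

theorem evalB_C (r : ZMod 2) (x : BVec k) : evalB (C r) x = r := eval_C _

theorem evalB_X (i : Fin k) (x : BVec k) : evalB (X i) x = x i := eval_X _

theorem evalP_hat (Q : BoolPoly k) (x : BVec k) : evalP (hat Q) x = bit01 (evalB Q x) := by
  have key : ∀ S : Finset (Fin k →₀ ℕ), evalP (S.fold phaseXor 0 fun d => monomial d 1) x =
      bit01 (∑ d ∈ S, ∏ i ∈ d.support, x i ^ d i) := by
    intro S
    induction S using Finset.induction_on with
    | empty => simp [evalP, bit01_zero]
    | insert d S hd ih =>
      have hm : evalP (monomial d 1) x = bit01 (∏ i ∈ d.support, x i ^ d i) := by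
        rw [evalP, eval_monomial, one_mul, Finsupp.prod]
        have hpow : ∀ (b : ZMod 2) (n : ℕ), bit01 (b ^ n) = bit01 b ^ n := by
          intro b n
          induction n with
          | zero => simp [bit01_one]
          | succ n ih => rw [pow_succ, pow_succ, bit01_mul, ih]
        have : ∀ T : Finset (Fin k), ∏ i ∈ T, bit01 (x i) ^ d i = bit01 (∏ i ∈ T, x i ^ d i) := by
          intro T
          induction T using Finset.induction_on with
          | empty => simp [bit01_one]
          | insert i T hi ih => rw [Finset.prod_insert hi, Finset.prod_insert hi, bit01_mul, ih, hpow]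
        exact this _
      rw [Finset.fold_insert hd, Finset.sum_insert hd, bit01_add, ← ih, ← hm]
      simp only [phaseXor, evalP, map_sub, map_add, map_mul, map_ofNat]
  rw [hat, key, evalB, eval_eq]
  congr 1
  refine Finset.sum_congr rfl fun d hd => ?_
  rw [(zmod2_cases _).resolve_left (mem_support_iff.1 hd), one_mul]

theorem evalP_rename {l : ℕ} (f : Fin k → Fin l) (P : PhasePoly k) (x : BVec l) :
    evalP (rename f P) x = evalP P (x ∘ f) := by
  rw [evalP, eval_rename]
  rfl

theorem evalB_rename {l : ℕ} (f : Fin k → Fin l) (P : BoolPoly k) (x : BVec l) :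
    evalB (rename f P) x = evalB P (x ∘ f) := by
  rw [evalB, eval_rename]
  rfl

theorem evalP_upP (P : PhasePoly k) (x : BVec (k + 1)) : evalP (upP P) x = evalP P (Fin.tail x) :=
  evalP_rename _ _ _

theorem evalB_upB (P : BoolPoly k) (x : BVec (k + 1)) : evalB (upB P) x = evalB P (Fin.tail x) :=
  evalB_rename _ _ _

theorem eval_bind {R : Type*} [CommRing R] {k l : ℕ} (f : Fin k → MvPolynomial (Fin l) R)
    (P : MvPolynomial (Fin k) R) (x : Fin l → R) :
    eval x (bind₁ f P) = eval (fun i => eval x (f i)) P := by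
  rw [eval, eval₂Hom_bind₁]
  rfl

theorem evalP_removeP (Q : BoolPoly k) (P : PhasePoly (k + 1)) (x : BVec k) :
    evalP (removeP Q P) x = evalP P (Fin.cons (evalB Q x) x) := by
  rw [evalP, removeP, eval_bind, evalP]
  congr 2
  funext i
  refine Fin.cases ?_ (fun i => ?_) i
  · exact evalP_hat Q x
  · exact eval_X _

theorem evalB_removeB (Q : BoolPoly k) (P : BoolPoly (k + 1)) (x : BVec k) :
    evalB (removeB Q P) x = evalB P (Fin.cons (evalB Q x) x) := by
  rw [evalB, removeB, eval_bind, evalB]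
  congr 2
  funext i
  refine Fin.cases ?_ (fun i => ?_) i
  · rfl
  · exact eval_X _

theorem evalP_substP (y : Fin k) (Q : BoolPoly k) (P : PhasePoly k) (x : BVec k) :
    evalP (substP y Q P) x = evalP P (Function.update x y (evalB Q x)) := by
  rw [evalP, substP, eval_bind, evalP]
  congr 2
  funext i
  by_cases h : i = y
  · subst h
    rw [Function.update_self, Function.update_self]
    exact evalP_hat Q x
  · rw [Function.update_of_ne h, Function.update_of_ne h]
    exact eval_X _

theorem evalB_substB (y : Fin k) (Q : BoolPoly k) (P : BoolPoly k) (x : BVec k) :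
    evalB (substB y Q P) x = evalB P (Function.update x y (evalB Q x)) := by
  rw [evalB, substB, eval_bind, evalB]
  congr 2
  funext i
  by_cases h : i = y
  · subst h
    rw [Function.update_self, Function.update_self]
    rfl
  · rw [Function.update_of_ne h, Function.update_of_ne h]
    exact eval_X _

theorem evalB_update_of_notMem {y : Fin k} {P : BoolPoly k} (h : y ∉ P.vars) (x : BVec k)
    (b : ZMod 2) : evalB P (Function.update x y b) = evalB P x := by
  refine eval₂Hom_congr' rfl (fun i hi _ => ?_) rfl
  rw [Function.update_of_ne]
  rintro rfl
  exact h hi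

/-! ### Phase polynomials modulo `phaseNull` -/

/-- The polynomial that is `1` at one Boolean vector and `0` at the others. -/
noncomputable def deltaPoly (R : Type*) [CommRing R] (x : BVec k) : MvPolynomial (Fin k) R :=
  ∏ i, if x i = 0 then 1 - X i else X i

/-- Interpolation: modulo the ideal, a polynomial is the sum of its values times the indicator
polynomials of the Boolean vectors, and these have integer coefficients. With the converse
`int_of_mem_phaseNull`, phase polynomials can be treated as functions with values in the circle. -/
theorem mem_phaseNull_of_int (P : PhasePoly k) (h : ∀ x, ∃ z : ℤ, evalP P x = z) :
    P ∈ phaseNull k := by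
  choose z hz using h
  set I := Ideal.span (Set.range fun i : Fin k => (X i ^ 2 - X i : PhasePoly k)) with hI
  let π := Ideal.Quotient.mk I
  have hX : ∀ i : Fin k, π (X i) * π (X i) = π (X i) := by
    intro i
    rw [← map_mul, Ideal.Quotient.eq, ← sq]
    exact Ideal.subset_span ⟨i, rfl⟩
  -- In the quotient a variable acts on the indicator of `x` as the number `x i`.
  have hδ : ∀ (x : BVec k) (i : Fin k), π (X i) * π (deltaPoly ℝ x) =
      π (C (bit01 (x i))) * π (deltaPoly ℝ x) := by
    intro x i
    rw [deltaPoly, ← Finset.mul_prod_erase _ _ (Finset.mem_univ i), map_mul, ← mul_assoc,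
      ← mul_assoc]
    congr 1
    rcases zmod2_cases (x i) with h0 | h0
    · rw [if_pos h0, h0, bit01_zero, map_sub, map_one, map_zero, map_zero, zero_mul, mul_sub,
        mul_one, hX, sub_self]
    · rw [if_neg (by rw [h0]; decide), h0, bit01_one, map_one, map_one, one_mul, hX]
  -- Expansion of the product of the factors `(1 - X i) + X i = 1`.
  have hsum : ∑ x : BVec k, deltaPoly ℝ x = 1 := by
    have h := Finset.prod_univ_sum (fun _ : Fin k => (Finset.univ : Finset (ZMod 2)))
      (fun i b => if b = 0 then 1 - X i else (X i : PhasePoly k))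
    rw [Fintype.piFinset_univ] at h
    simp only [deltaPoly]
    rw [← h]
    refine Finset.prod_eq_one fun i _ => ?_
    have : (Finset.univ : Finset (ZMod 2)) = {0, 1} := rfl
    rw [this, Finset.sum_pair (by decide), if_pos rfl, if_neg (by decide)]
    ring
  have hP : ∀ (P : PhasePoly k) (x : BVec k), π P * π (deltaPoly ℝ x) =
      π (C (evalP P x)) * π (deltaPoly ℝ x) := by
    intro P x
    induction P using MvPolynomial.induction_on with
    | C a => rw [evalP_C]
    | add p q hp hq => rw [map_add, add_mul, hp, hq, evalP_add, C_add, map_add, add_mul]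
    | mul_X p i hp =>
      rw [map_mul, mul_assoc, hδ, mul_left_comm, hp, evalP_mul, evalP_X, C_mul, map_mul, ← mul_assoc,
        mul_comm (π _) (π (C (evalP p x)))]
  have hmem : P - ∑ x, C (evalP P x) * deltaPoly ℝ x ∈ I := by
    rw [← Ideal.Quotient.eq, map_sum]
    simp only [map_mul]
    rw [← Finset.sum_congr rfl fun x _ => hP P x, ← Finset.mul_sum, ← map_sum, hsum, map_one,
      mul_one]
  have hint : ∑ x, C (evalP P x) * deltaPoly ℝ x =
      MvPolynomial.map (Int.castRingHom ℝ) (∑ x, C (z x) * deltaPoly ℤ x) := by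
    rw [map_sum]
    refine Finset.sum_congr rfl fun x _ => ?_
    rw [map_mul, map_C, hz, deltaPoly, deltaPoly, map_prod]
    congr 1
    refine Finset.prod_congr rfl fun i _ => ?_
    split <;> simp
  rw [phaseNull]
  refine AddSubgroup.mem_sup.2 ⟨_, ⟨∑ x, C (z x) * deltaPoly ℤ x, rfl⟩,
    P - ∑ x, C (evalP P x) * deltaPoly ℝ x, hmem, ?_⟩
  change MvPolynomial.map (Int.castRingHom ℝ) _ + _ = _
  rw [← hint, add_sub_cancel]

theorem int_of_mem_phaseNull {P : PhasePoly k} (h : P ∈ phaseNull k) (x : BVec k) :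
    ∃ z : ℤ, evalP P x = z := by
  obtain ⟨_, ⟨A, rfl⟩, B, hB, rfl⟩ := AddSubgroup.mem_sup.1 h
  have h1 : evalP B x = 0 := by
    have : Ideal.span (Set.range fun i : Fin k => (X i ^ 2 - X i : PhasePoly k)) ≤
        RingHom.ker (eval fun i => bit01 (x i)) := by
      rw [Ideal.span_le]
      rintro _ ⟨i, rfl⟩
      simp [RingHom.mem_ker, bit01_sq]
    exact this hB
  refine ⟨eval (fun i => ((x i).val : ℤ)) A, ?_⟩
  rw [evalP_add, h1, add_zero]
  change eval _ (MvPolynomial.map (Int.castRingHom ℝ) A) = (Int.castRingHom ℝ) _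
  rw [eval_map]
  change _ = (Int.castRingHom ℝ) (eval₂ (RingHom.id ℤ) _ A)
  rw [eval₂_comp_left, RingHom.comp_id]
  congr 1

end values

/-! ## Interpretation of terms -/

/-- A sum over Boolean vectors: scalar, phases, values of the ket and bra polynomials, values of the
discarded polynomials. -/
@[ext]
structure SumData (n m k : ℕ) where
  s : ℝ
  φ : BVec k → UnitAddCircle
  L : Fin m ⊕ Fin n → BVec k → ZMod 2
  D : Set (BVec k → ZMod 2)

/-- The functions that a term consists of. -/
noncomputable def SOPTerm.den {n m : ℕ} (t : SOPTerm n m) : SumData n m t.k where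
  s := t.s
  φ := fun x => (evalP t.P x : UnitAddCircle)
  L := Sum.elim (fun i => evalB (t.O i)) (fun i => evalB (t.I i))
  D := evalB '' (t.D : Set (BoolPoly t.k))

/-- The phase of a point of the circle. -/
noncomputable def phase (t : UnitAddCircle) : ℂ := (AddCircle.toCircle t : ℂ)

theorem phase_add (a b : UnitAddCircle) : phase (a + b) = phase a * phase b := by
  rw [phase, AddCircle.toCircle_add, Circle.coe_mul]
  rfl

theorem phase_zero : phase 0 = 1 := by rw [phase, AddCircle.toCircle_zero, Circle.coe_one]

theorem phase_coe (r : ℝ) : phase (r : UnitAddCircle) = Complex.exp (2 * Real.pi * r * Complex.I) := by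
  rw [phase, AddCircle.toCircle_apply_mk, Circle.coe_exp]
  push_cast
  rw [div_one]

theorem phase_mul_conj (a : UnitAddCircle) : phase a * (starRingEnd ℂ) (phase a) = 1 := by
  rw [Complex.mul_conj, phase, Circle.normSq_coe, Complex.ofReal_one]

theorem phase_half : phase ((1 / 2 : ℝ) : UnitAddCircle) = -1 := by
  rw [phase_coe, show (2 * Real.pi * ((1 / 2 : ℝ) : ℂ) * Complex.I) = Real.pi * Complex.I by
    push_cast; ring, Complex.exp_pi_mul_I]

theorem phase_quarter : phase ((1 / 4 : ℝ) : UnitAddCircle) = Complex.I := by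
  rw [phase_coe, show (2 * Real.pi * ((1 / 4 : ℝ) : ℂ) * Complex.I) = Real.pi / 2 * Complex.I by
    push_cast; ring, Complex.exp_pi_div_two_mul_I]

theorem phase_eighth : phase ((1 / 8 : ℝ) : UnitAddCircle) = omega8 := by
  rw [phase_coe, show (2 * Real.pi * ((1 / 8 : ℝ) : ℂ) * Complex.I) = ((Real.pi / 4 : ℝ) : ℂ) * Complex.I by
    push_cast; ring, Complex.exp_mul_I, ← Complex.ofReal_cos, ← Complex.ofReal_sin,
    Real.cos_pi_div_four, Real.sin_pi_div_four, omega8, eq_div_iff sqrt_two_ne]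
  have := sqrt_two_sq
  push_cast
  linear_combination (1 + Complex.I) / 2 * this

theorem phase_mul_bit01 (r : ℝ) (b : ZMod 2) :
    phase ((r * bit01 b : ℝ) : UnitAddCircle) = if b = 0 then 1 else phase (r : UnitAddCircle) := by
  rcases zmod2_cases b with rfl | rfl
  · rw [bit01_zero, mul_zero, if_pos rfl, ← phase_zero, AddCircle.coe_zero]
  · rw [bit01_one, mul_one, if_neg (by decide)]

/-! ### Matrices given by double sums over assignments -/

section amplitude

open Classical in
/-- The entries of a completely positive map given by a sum. -/
noncomputable def cpEntry {Y Z : Type} [Fintype Y] (w : Y → ℂ) (L : Y → Z) (R : Y → Y → Prop)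
    (a b : Z) : ℂ :=
  ∑ y, ∑ y', if L y = a ∧ L y' = b ∧ R y y' then w y * (starRingEnd ℂ) (w y') else 0

variable {Y Y' Z : Type} [Fintype Y] [Fintype Y']

open Classical in
-- Label and relation are constant on the fibres of `π`, so the weights can be summed over the
-- fibres, independently in the two arguments of the double sum.
theorem cpEntry_push (π : Y → Y') {w : Y → ℂ} {w' : Y' → ℂ} {L : Y → Z} {L' : Y' → Z}
    {R : Y → Y → Prop} {R' : Y' → Y' → Prop} (hL : ∀ y, L y = L' (π y))
    (hR : ∀ y y', R y y' ↔ R' (π y) (π y')) (hw : ∀ y', w' y' = ∑ y with π y = y', w y) :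
    cpEntry w L R = cpEntry w' L' R' := by
  funext a b
  unfold cpEntry
  rw [← Finset.sum_fiberwise (s := Finset.univ) (g := π)]
  refine Finset.sum_congr rfl fun z _ => ?_
  have h1 : ∀ y ∈ Finset.univ.filter (π · = z),
      (∑ y', if L y = a ∧ L y' = b ∧ R y y' then w y * (starRingEnd ℂ) (w y') else 0) =
        ∑ z', ∑ y' with π y' = z', if L' z = a ∧ L' z' = b ∧ R' z z' then
          w y * (starRingEnd ℂ) (w y') else 0 := by
    intro y hy
    rw [← Finset.sum_fiberwise (s := Finset.univ) (g := π)]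
    refine Finset.sum_congr rfl fun z' _ => Finset.sum_congr rfl fun y' hy' => ?_
    rw [hL, hL, hR, (Finset.mem_filter.1 hy).2, (Finset.mem_filter.1 hy').2]
  rw [Finset.sum_congr rfl h1, Finset.sum_comm]
  refine Finset.sum_congr rfl fun z' _ => ?_
  by_cases h : L' z = a ∧ L' z' = b ∧ R' z z'
  · simp only [h, and_self, if_true]
    rw [hw, hw, map_sum, Finset.sum_mul_sum]
  · simp only [h, if_false, Finset.sum_const_zero]

theorem cpEntry_equiv (e : Y ≃ Y') {w : Y → ℂ} {w' : Y' → ℂ} {L : Y → Z} {L' : Y' → Z}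
    {R : Y → Y → Prop} {R' : Y' → Y' → Prop} (hL : ∀ y, L y = L' (e y))
    (hR : ∀ y y', R y y' ↔ R' (e y) (e y')) (hw : ∀ y, w y = w' (e y)) :
    cpEntry w L R = cpEntry w' L' R' := by
  classical
  refine cpEntry_push e hL hR fun y' => ?_
  rw [Finset.sum_eq_single (e.symm y')]
  · rw [hw, e.apply_symm_apply]
  · intro y hy hne
    rw [Finset.mem_filter] at hy
    exact absurd (e.eq_symm_apply.2 hy.2) hne
  · intro h
    simp at h

/-- Assignments of weight zero do not contribute; this is the substitution step in the soundness of
(HH). -/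
theorem cpEntry_incl (ι : Y' → Y) (hι : Function.Injective ι) {w : Y → ℂ} {w' : Y' → ℂ}
    {L : Y → Z} {L' : Y' → Z} {R : Y → Y → Prop} {R' : Y' → Y' → Prop}
    (hL : ∀ y, L (ι y) = L' y) (hR : ∀ y y', R (ι y) (ι y') ↔ R' y y')
    (hw : ∀ y, w (ι y) = w' y) (h0 : ∀ y, (∀ y', ι y' ≠ y) → w y = 0) :
    cpEntry w L R = cpEntry w' L' R' := by
  classical
  funext a b
  unfold cpEntry
  symm
  refine Finset.sum_of_injOn ι hι.injOn (fun _ _ => Finset.mem_coe.2 (Finset.mem_univ _))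
    (fun y _ hy => ?_) fun z _ => ?_
  · simp [h0 y fun y' h => hy ⟨y', by simp, h⟩]
  · refine Finset.sum_of_injOn ι hι.injOn (fun _ _ => Finset.mem_coe.2 (Finset.mem_univ _))
      (fun y _ hy => ?_) fun z' _ => ?_
    · simp [h0 y fun y' h => hy ⟨y', by simp, h⟩]
    · simp only [hL, hR, hw]

/-- A phase that takes equal values on related assignments cancels against its conjugate. Phases
that depend only on discarded values are of this kind. -/
theorem cpEntry_phase {w w' : Y → ℂ} (L : Y → Z) {R : Y → Y → Prop} (u : Y → UnitAddCircle)
    (hw : ∀ y, w' y = w y * phase (u y)) (hu : ∀ y y', R y y' → u y = u y') :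
    cpEntry w' L R = cpEntry w L R := by
  classical
  funext a b
  refine Finset.sum_congr rfl fun y _ => Finset.sum_congr rfl fun y' _ => ?_
  split
  · rename_i h
    rw [hw, hw, hu y y' h.2.2, map_mul]
    linear_combination w y * (starRingEnd ℂ) (w y') * phase_mul_conj (u y')
  · rfl

theorem cpEntry_congr {w w' : Y → ℂ} {L L' : Y → Z} {R R' : Y → Y → Prop} (hw : ∀ y, w y = w' y)
    (hL : ∀ y, L y = L' y) (hR : ∀ y y', R y y' ↔ R' y y') : cpEntry w L R = cpEntry w' L' R' :=
  cpEntry_equiv (.refl Y) hL hR hw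

theorem cpEntry_zero (L : Y → Z) (R : Y → Y → Prop) : cpEntry (fun _ => 0) L R = 0 := by
  classical
  funext a b
  simp [cpEntry]

theorem sum_cons {M : Type*} [AddCommMonoid M] {k : ℕ} (f : BVec (k + 1) → M) :
    ∑ x, f x = ∑ b : ZMod 2, ∑ x : BVec k, f (Fin.cons b x) := by
  rw [← Fintype.sum_prod_type']
  exact (Fintype.sum_equiv (Fin.consEquiv fun _ => ZMod 2) _ _ fun _ => rfl).symm

theorem sum_zmod2 {M : Type*} [AddCommMonoid M] (f : ZMod 2 → M) : ∑ b, f b = f 0 + f 1 :=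
  Fin.sum_univ_two f

theorem cpEntry_tail {k : ℕ} {w : BVec (k + 1) → ℂ} {w' : BVec k → ℂ} {L : BVec (k + 1) → Z}
    {L' : BVec k → Z} {R : BVec (k + 1) → BVec (k + 1) → Prop} {R' : BVec k → BVec k → Prop}
    (hL : ∀ y, L y = L' (Fin.tail y)) (hR : ∀ y y', R y y' ↔ R' (Fin.tail y) (Fin.tail y'))
    (hw : ∀ x, w' x = w (Fin.cons 0 x) + w (Fin.cons 1 x)) : cpEntry w L R = cpEntry w' L' R' := by
  classical
  refine cpEntry_push Fin.tail hL hR fun x => ?_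
  rw [Finset.sum_filter, sum_cons, sum_zmod2]
  simp only [Fin.tail_cons, Finset.sum_ite_eq', Finset.mem_univ, if_true]
  exact hw x

/-- Discarding the variable `0` forces its two copies to be equal. Summing over the common value
gives the factor `1 + (-1) ^ (q y + q y')`, which is `2` if `q` agrees and `0` otherwise; the `2` is
shared as `√2` between the two weights. -/
theorem cpEntry_discard {k : ℕ} {w : BVec (k + 1) → ℂ} {w' : BVec k → ℂ} {L : BVec (k + 1) → Z}
    {L' : BVec k → Z} {R : BVec (k + 1) → BVec (k + 1) → Prop} {R' R₀ : BVec k → BVec k → Prop}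
    (q : BVec k → ZMod 2)
    (hL : ∀ y, L y = L' (Fin.tail y))
    (hR : ∀ y y', R y y' ↔ y 0 = y' 0 ∧ R₀ (Fin.tail y) (Fin.tail y'))
    (hR' : ∀ y y', R' y y' ↔ q y = q y' ∧ R₀ y y')
    (hw0 : ∀ x, w' x = √2 * w (Fin.cons 0 x))
    (hw1 : ∀ x, w (Fin.cons 1 x) = if q x = 0 then w (Fin.cons 0 x) else - w (Fin.cons 0 x)) :
    cpEntry w L R = cpEntry w' L' R' := by
  classical
  funext a b
  unfold cpEntry
  rw [sum_cons, Finset.sum_comm]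
  refine Finset.sum_congr rfl fun y _ => ?_
  simp only [sum_cons (k := k) (M := ℂ), sum_zmod2]
  rw [← Finset.sum_add_distrib, ← Finset.sum_add_distrib, ← Finset.sum_add_distrib]
  refine Finset.sum_congr rfl fun y' _ => ?_
  have h01 : (0 : ZMod 2) ≠ 1 := by decide
  simp only [hL, hR, hR', Fin.tail_cons, Fin.cons_zero, h01, h01.symm, true_and, false_and,
    and_false, if_false, add_zero, zero_add, hw0, hw1, map_mul, Complex.conj_ofReal]
  by_cases h : L' y = a ∧ L' y' = b ∧ R₀ y y'
  · have h2 := sqrt_two_sq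
    rcases zmod2_cases (q y) with e | e <;> rcases zmod2_cases (q y') with e' | e' <;>
      simp [h.1, h.2.1, h.2.2, e, e', h01, h01.symm]
    all_goals linear_combination -(w (Fin.cons 0 y) * (starRingEnd ℂ) (w (Fin.cons 0 y'))) * h2
  · have h' : ¬ (L' y = a ∧ L' y' = b ∧ q y = q y' ∧ R₀ y y') := fun h' => h ⟨h'.1, h'.2.1, h'.2.2.2⟩
    rw [if_neg h, if_neg h, if_neg h', add_zero]

end amplitude

namespace SumData

variable {n m k : ℕ}

/-- The weights of the sum. -/
noncomputable def weight (f : SumData n m k) (x : BVec k) : ℂ := f.s * phase (f.φ x)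

/-- Equality of the discarded values. -/
def SameDisc (f : SumData n m k) (x x' : BVec k) : Prop := ∀ d ∈ f.D, d x = d x'

/-- The completely positive map denoted by a sum. -/
noncomputable def sem (f : SumData n m k) (a b : Fin m ⊕ Fin n → ZMod 2) : ℂ :=
  cpEntry f.weight (fun x i => f.L i x) f.SameDisc a b

end SumData

theorem exists_affine {k : ℕ} (Q : BoolPoly k) (hQ : Q.totalDegree ≤ 1) :
    ∃ (c : ZMod 2) (a : BVec k), ∀ x, evalB Q x = c + ∑ i, a i * x i := by
  obtain ⟨⟨c, l⟩, rfl⟩ := LinCode.exists_toPoly Q hQ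
  refine ⟨if c then 1 else 0, fun i => (l.map fun j => if j = i then 1 else 0).sum, fun x => ?_⟩
  rw [LinCode.toPoly, evalB_add, evalB_C]
  congr 1
  dsimp only
  clear hQ
  induction l with
  | nil => simp [evalB]
  | cons j l ih =>
    simp only [List.map_cons, List.sum_cons, evalB_add, evalB_X, ih, add_mul, Finset.sum_add_distrib]
    simp

theorem substVec_involutive {k : ℕ} (y : Fin k) (A : BVec k → ZMod 2)
    (hA : ∀ x b, A (Function.update x y b) = A x) :
    Function.Involutive fun x : BVec k => Function.update x y (x y + A x) := by
  intro x
  have h2 : ∀ a b : ZMod 2, a + b + b = a := by decide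
  simp only [hA, Function.update_self, Function.update_idem, h2, Function.update_eq_self]

theorem den_sem {k : ℕ} (s : ℝ) (P : PhasePoly k) (O : Fin m → BoolPoly k)
    (D : Finset (BoolPoly k)) (I : Fin n → BoolPoly k) :
    (SOPTerm.mk k s P O D I).den.sem =
      cpEntry (fun x : BVec k => (s : ℂ) * phase (evalP P x : ℝ))
        (fun x => Sum.elim (fun i => evalB (O i) x) fun i => evalB (I i) x)
        (fun x x' => ∀ d ∈ D, evalB d x = evalB d x') := by
  have h : (SOPTerm.mk k s P O D I).den.sem = cpEntry (fun x : BVec k => (s : ℂ) * phase (evalP P x : ℝ))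
        (fun x i => Sum.elim (fun i => evalB (O i)) (fun i => evalB (I i)) i x)
        (fun x x' => ∀ d ∈ evalB '' (D : Set (BoolPoly k)), d x = d x') := rfl
  rw [h]
  refine cpEntry_congr (fun _ => rfl) (fun x => _root_.funext fun i => ?_)
    fun x x' => Set.forall_mem_image
  rcases i with i | i <;> rfl

/-- Under the substitution an affine discard changes by a constant multiple of `A`, and if `A` is
discarded or constant this change is the same for related assignments. Soundness uses the degree
bound on the discards only here. -/
theorem sameDisc_substVec {k : ℕ} (D : Finset (BoolPoly k)) (hlin : ∀ d ∈ D, d.totalDegree ≤ 1)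
    {y : Fin k} {A : BoolPoly k} (hyA : y ∉ A.vars)
    (hD : (∀ d ∈ D, y ∉ d.vars) ∨ {X y, A} ⊆ insert 1 D) (x x' : BVec k) :
    (∀ d ∈ D, evalB d x = evalB d x') ↔
      ∀ d ∈ D, evalB d (Function.update x y (x y + evalB A x)) =
        evalB d (Function.update x' y (x' y + evalB A x')) := by
  rcases hD with hD | hD
  · refine forall₂_congr fun d hd => ?_
    rw [evalB_update_of_notMem (hD d hd), evalB_update_of_notMem (hD d hd)]
  · have key : ∀ d ∈ D, ∃ c : ZMod 2, ∀ x, evalB d (Function.update x y (x y + evalB A x)) =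
        evalB d x + c * evalB A x := by
      intro d hd
      obtain ⟨c, a, h⟩ := exists_affine d (hlin d hd)
      refine ⟨a y, fun x => ?_⟩
      rw [h, h, add_assoc]
      congr 1
      rw [← Finset.add_sum_erase _ _ (Finset.mem_univ y), ← Finset.add_sum_erase _ _ (Finset.mem_univ y),
        Function.update_self]
      have : ∑ i ∈ Finset.univ.erase y, a i * Function.update x y (x y + evalB A x) i =
          ∑ i ∈ Finset.univ.erase y, a i * x i :=
        Finset.sum_congr rfl fun i hi => by rw [Function.update_of_ne (Finset.ne_of_mem_erase hi)]
      rw [this]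
      ring
    have hA : A = 1 ∨ A ∈ D := by
      have := hD (Finset.mem_insert_of_mem (Finset.mem_singleton_self A))
      rwa [Finset.mem_insert] at this
    have hupd : ∀ x : BVec k, evalB A (Function.update x y (x y + evalB A x)) = evalB A x :=
      fun x => evalB_update_of_notMem hyA _ _
    rcases hA with rfl | hA
    · have h1 : ∀ x, evalB (1 : BoolPoly k) x = 1 := fun x => map_one _
      refine forall₂_congr fun d hd => ?_
      obtain ⟨c, hc⟩ := key d hd
      rw [hc, hc, h1, h1, add_left_inj]
    · constructor
      · intro h d hd
        obtain ⟨c, hc⟩ := key d hd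
        rw [hc, hc, h d hd, h A hA]
      · intro h d hd
        obtain ⟨c, hc⟩ := key d hd
        have e := h A hA
        rw [hupd, hupd] at e
        have e' := h d hd
        rwa [hc, hc, e, add_left_inj] at e'

/-! ### Soundness of the rewrite rules -/

section soundness

variable {n m : ℕ}

theorem sound (t t' : SOPTerm n m) (h : SOPStep t t') (ht : ∀ d ∈ t.D, d.totalDegree ≤ 1) :
    t.den.sem = t'.den.sem := by
  cases h with
  | @alpha k π s P O D I =>
    rw [den_sem, den_sem]
    refine (cpEntry_equiv (Equiv.arrowCongr π.symm (.refl _)) (fun x => _root_.funext fun i => ?_) (fun x x' => ?_)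
      fun x => ?_).symm
    · rcases i with i | i <;> exact evalB_rename _ _ _
    · simp only [Finset.forall_mem_image, evalB_rename]
      rfl
    · rw [evalP_rename]
      rfl
  | @phase k s P P' O D I h =>
    rw [den_sem, den_sem]
    refine cpEntry_congr (fun x => ?_) (fun x => rfl) fun x x' => Iff.rfl
    obtain ⟨z, hz⟩ := int_of_mem_phaseNull h x
    congr 2
    rw [evalP_sub] at hz
    rw [← sub_eq_zero, ← AddCircle.coe_sub, hz]
    exact (AddCircle.coe_eq_zero_iff 1).2 ⟨z, by simp⟩
  | @elim k s P O D I =>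
    rw [den_sem, den_sem]
    refine cpEntry_tail (fun x => _root_.funext fun i => ?_) (fun x x' => ?_) fun x => ?_
    · rcases i with i | i <;> exact evalB_upB _ _
    · simp only [Finset.forall_mem_image, evalB_upB]
    · change ((2 * s : ℝ) : ℂ) * phase (evalP P x : ℝ) =
        s * phase (evalP (upP P) _ : ℝ) + s * phase (evalP (upP P) _ : ℝ)
      rw [evalP_upP, evalP_upP, Fin.tail_cons, Fin.tail_cons]
      push_cast
      ring
  | @hh k s Q R O D I =>
    rw [den_sem, den_sem]
    have h1 : ∀ x : BVec (k + 1), (evalP (C (1 / 2) * X 0 * (X 1 + hat (upB (upB Q))) + upP R)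
        (Fin.cons 0 x) : UnitAddCircle) = (evalP R x : ℝ) := by
      intro x
      simp only [evalP_add, evalP_mul, evalP_X, Fin.cons_zero, bit01_zero, mul_zero, zero_mul,
        zero_add, evalP_upP, Fin.tail_cons]
    have h2 : ∀ x : BVec (k + 1), (evalP (C (1 / 2) * X 0 * (X 1 + hat (upB (upB Q))) + upP R)
        (Fin.cons 1 x) : UnitAddCircle) = (evalP R x : ℝ) +
          ((1 / 2 * bit01 (x 0 + evalB Q (Fin.tail x)) : ℝ) : UnitAddCircle) := by
      intro x
      rw [← AddCircle.coe_add, ← sub_eq_zero, ← AddCircle.coe_sub, AddCircle.coe_eq_zero_iff]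
      simp only [evalP_add, evalP_mul, evalP_X, Fin.cons_zero, bit01_one, evalP_C, mul_one,
        evalP_upP, Fin.tail_cons, evalP_hat, evalB_upB, bit01_add]
      rw [show (Fin.cons 1 x : BVec (k + 2)) 1 = x 0 from rfl]
      rcases zmod2_cases (x 0) with e | e <;> rcases zmod2_cases (evalB Q (Fin.tail x)) with e' | e' <;>
        rw [e, e']
      · exact ⟨0, by simp [bit01_zero]⟩
      · exact ⟨0, by simp [bit01_zero, bit01_one]; ring⟩
      · exact ⟨0, by simp [bit01_zero, bit01_one]; ring⟩
      · exact ⟨1, by simp [bit01_one]; norm_num⟩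
    -- Summing out `y_0` leaves twice the indicator of `y_0' = Q`, and its support is parametrized
    -- by the remaining variables.
    refine (cpEntry_tail (w' := fun x : BVec (k + 1) =>
        if x 0 = evalB Q (Fin.tail x) then ((2 * s : ℝ) : ℂ) * phase (evalP R x : ℝ) else 0)
        (L' := fun x => Sum.elim (fun i => evalB (O i) x) (fun i => evalB (I i) x))
        (R' := fun x x' => ∀ d ∈ D, evalB d x = evalB d x')
        (fun x => _root_.funext fun i => ?_) (fun x x' => ?_) fun x => ?_).trans
      (cpEntry_incl (fun x : BVec k => (Fin.cons (evalB Q x) x : BVec (k + 1)))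
        (fun x x' h => by simpa using congrArg Fin.tail h) ?_ ?_ ?_ ?_)
    · rcases i with i | i <;> exact evalB_upB _ _
    · simp only [Finset.forall_mem_image, evalB_upB]
    · have h3 : ∀ a b : ZMod 2, a + b = 0 ↔ a = b := by decide
      change _ = (s : ℂ) * phase _ + s * phase _
      rw [h1, h2, phase_add, phase_mul_bit01, phase_half]
      simp only [h3]
      split <;> push_cast <;> ring
    · intro x
      refine _root_.funext fun i => ?_
      rcases i with i | i <;> exact (evalB_removeB _ _ _).symm
    · intro x x'
      simp only [Finset.forall_mem_image, evalB_removeB]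
    · intro x
      rw [Fin.cons_zero, Fin.tail_cons, if_pos rfl]
      rw [evalP_removeP]
    · intro x h
      rw [if_neg]
      intro h'
      exact h (Fin.tail x) (by rw [← h', Fin.cons_self_tail])
  | @omega k s Q R O D I =>
    rw [den_sem, den_sem]
    refine cpEntry_tail (fun x => _root_.funext fun i => ?_) (fun x x' => ?_) fun x => ?_
    · rcases i with i | i <;> exact evalB_upB _ _
    · simp only [Finset.forall_mem_image, evalB_upB]
    · change ((√2 * s : ℝ) : ℂ) * phase (evalP _ x : ℝ) =
        s * phase (evalP _ _ : ℝ) + s * phase (evalP _ _ : ℝ)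
      simp only [evalP_add, evalP_sub, evalP_mul, evalP_X, evalP_C, evalP_upP, Fin.tail_cons,
        evalP_hat, evalB_upB, Fin.cons_zero, bit01_zero, bit01_one, mul_zero, zero_mul, add_zero,
        zero_add, mul_one]
      have h2 := sqrt_two_sq
      have h0 := sqrt_two_ne
      have hI := Complex.I_sq
      rcases zmod2_cases (evalB Q x) with e | e <;>
        simp only [e, bit01_zero, bit01_one, mul_zero, mul_one, sub_zero, add_zero,
          AddCircle.coe_add, phase_add, phase_quarter, phase_half]
      · rw [phase_eighth, omega8]
        push_cast
        field_simp
      · rw [show ((1 / 8 - 1 / 4 : ℝ) : UnitAddCircle) = ((-(1 / 8) : ℝ) : UnitAddCircle) by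
          congr 1; norm_num]
        -- For `Q = 1` the two summands give `1 - i = √2 ω⁻¹`, with `ω` the eighth root `omega8`.
        have h8 : phase ((-(1 / 8) : ℝ) : UnitAddCircle) * omega8 = 1 := by
          rw [← phase_eighth, ← phase_add, ← AddCircle.coe_add, neg_add_cancel, AddCircle.coe_zero,
            phase_zero]
        have h9 : phase ((-(1 / 8) : ℝ) : UnitAddCircle) = (1 - Complex.I) / √2 := by
          have : omega8 ≠ 0 := right_ne_zero_of_mul_eq_one h8
          refine mul_right_cancel₀ this (h8.trans ?_)
          rw [omega8]
          field_simp
          linear_combination h2 + hI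
        rw [h9]
        push_cast
        field_simp
        ring
  | @zGround k s P α T O D I hT =>
    rw [den_sem, den_sem]
    refine cpEntry_phase _ (fun x : BVec k => ((α * bit01 (evalB (∏ d ∈ T, d) x) : ℝ) : UnitAddCircle))
      (fun x => ?_) fun x x' h => ?_
    · change (s : ℂ) * phase (evalP (P + C α * hat (∏ d ∈ T, d)) x : ℝ) =
        s * phase (evalP P x : ℝ) * _
      rw [evalP_add, evalP_mul, evalP_C, evalP_hat, AddCircle.coe_add, phase_add, mul_assoc]
    · congr 3
      simp only [evalB, map_prod]
      exact Finset.prod_congr rfl fun d hd => h d (hT hd)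
  | @hGround k s Q P O D I =>
    rw [den_sem, den_sem]
    refine cpEntry_discard (evalB Q) (R₀ := fun x x' => ∀ d ∈ D, evalB d x = evalB d x')
      (fun x => _root_.funext fun i => ?_) (fun x x' => ?_) (fun x x' => ?_) (fun x => ?_) fun x => ?_
    · rcases i with i | i <;> exact evalB_upB _ _
    · simp only [Finset.forall_mem_insert, Finset.forall_mem_image, evalB_upB, evalB_X]
    · simp only [Finset.forall_mem_insert]
    · change ((√2 * s : ℝ) : ℂ) * phase (evalP _ x : ℝ) = √2 * (s * phase (evalP _ _ : ℝ))
      simp only [evalP_add, evalP_mul, evalP_X, evalP_upP, Fin.tail_cons, Fin.cons_zero,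
        bit01_zero, mul_zero, zero_mul, add_zero]
      push_cast
      ring
    · change (s : ℂ) * phase (evalP _ _ : ℝ) = if _ then (s * phase (evalP _ _ : ℝ)) else
        -(s * phase (evalP _ _ : ℝ))
      simp only [evalP_add, evalP_mul, evalP_X, evalP_upP, evalP_C, evalP_hat, evalB_upB,
        Fin.tail_cons, Fin.cons_zero, bit01_zero, bit01_one, mul_one, mul_zero, zero_mul, add_zero,
        AddCircle.coe_add, phase_add, phase_mul_bit01, phase_half]
      split <;> simp
  | @xorGround k s P d T O D I hT =>
    rw [den_sem, den_sem]
    refine cpEntry_congr (fun _ => rfl) (fun _ => rfl) fun x x' => ?_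
    simp only [Finset.forall_mem_insert]
    refine and_congr_left fun h => ?_
    rw [evalB_add, evalB_add]
    have : evalB (∏ e ∈ T, e) x = evalB (∏ e ∈ T, e) x' := by
      simp only [evalB, map_prod]
      exact Finset.prod_congr rfl fun d hd => h d (hT hd)
    rw [this, add_right_inj]
  | @cstGround k s P c O D I =>
    rw [den_sem, den_sem]
    refine cpEntry_congr (fun _ => rfl) (fun _ => rfl) fun x x' => ?_
    simp only [Finset.forall_mem_insert, evalB_C, true_and]
  | @disc k s P y D' O D I hy hD hmon =>
    rw [den_sem, den_sem]
    have hA : ∀ x b, evalB D' (Function.update x y b) = evalB D' x :=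
      fun x b => evalB_update_of_notMem hy x b
    refine (cpEntry_equiv (substVec_involutive y (evalB D') hA).toPerm (fun x => _root_.funext fun i => ?_)
      (fun x x' => ?_) fun x => ?_).symm
    · rcases i with i | i <;>
        exact (evalB_substB _ _ _ _).trans (by rw [evalB_add, evalB_X]; rfl)
    · simp only [Finset.forall_mem_image, evalB_substB]
      simp only [evalB_add, evalB_X]
      rfl
    · rw [evalP_substP, evalB_add, evalB_X]
      rfl
  | @ket k s P i y A B O D I hi hA hyO hyA hyB hD =>
    rw [den_sem, den_sem]
    have hA : ∀ x b, evalB A (Function.update x y b) = evalB A x :=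
      fun x b => evalB_update_of_notMem hyA x b
    refine (cpEntry_equiv (substVec_involutive y (evalB A) hA).toPerm (fun x => _root_.funext fun i => ?_)
      (fun x x' => ?_) fun x => ?_).symm
    · rcases i with i | i <;>
        exact (evalB_substB _ _ _ _).trans (by rw [evalB_add, evalB_X]; rfl)
    · exact sameDisc_substVec D ht hyA hD x x'
    · rw [evalP_substP, evalB_add, evalB_X]
      rfl
  | @bra k s P i y A B O D I hi hA hyO hyI hyA hyB hD =>
    rw [den_sem, den_sem]
    have hA : ∀ x b, evalB A (Function.update x y b) = evalB A x :=
      fun x b => evalB_update_of_notMem hyA x b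
    refine (cpEntry_equiv (substVec_involutive y (evalB A) hA).toPerm (fun x => _root_.funext fun i => ?_)
      (fun x x' => ?_) fun x => ?_).symm
    · rcases i with i | i
      · exact (evalB_update_of_notMem (hyO i) _ _).symm
      · exact (evalB_substB _ _ _ _).trans (by rw [evalB_add, evalB_X]; rfl)
    · exact sameDisc_substVec D ht hyA hD x x'
    · rw [evalP_substP, evalB_add, evalB_X]
      rfl
  | @zero k s R O D I h =>
    rw [den_sem, den_sem]
    -- On both sides the two values of the summed-out variable cancel; the two zero matrices are
    -- compared through a sum over no variables.
    refine (cpEntry_tail (w' := fun _ => 0)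
        (L' := fun x => Sum.elim (fun i => evalB (O i) x) (fun i => evalB (I i) x))
        (R' := fun x x' => ∀ d ∈ D, evalB d x = evalB d x')
        (fun x => _root_.funext fun i => ?_) (fun x x' => ?_) fun x => ?_).trans
      ((cpEntry_zero _ _).trans ((cpEntry_zero (fun (_ : BVec 0) (_ : Fin m ⊕ Fin n) => (0 : ZMod 2)) (fun _ _ => True)).symm.trans
        (cpEntry_tail (fun x => _root_.funext fun i => ?_) (fun x x' => ?_) fun x => ?_).symm))
    · rcases i with i | i <;> exact evalB_upB _ _
    · simp only [Finset.forall_mem_image, evalB_upB]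
    · change (0 : ℂ) = (s : ℂ) * phase (evalP _ _ : ℝ) + s * phase (evalP _ _ : ℝ)
      simp only [evalP_add, evalP_mul, evalP_X, evalP_upP, evalP_C,
        Fin.tail_cons, Fin.cons_zero, bit01_zero, bit01_one, mul_one, mul_zero, zero_add,
        AddCircle.coe_add, phase_add, phase_half]
      ring
    · rcases i with i | i <;> exact map_zero (eval (x : BVec 1))
    · simp
    · change (0 : ℂ) = ((1 : ℝ) : ℂ) * phase (evalP _ _ : ℝ) + ((1 : ℝ) : ℂ) * phase (evalP _ _ : ℝ)
      simp only [evalP_mul, evalP_X, evalP_C, Fin.cons_zero, bit01_zero, bit01_one, mul_one, mul_zero,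
        phase_half, AddCircle.coe_zero, phase_zero]
      ring

end soundness

/-! ## Affine and quadratic functions -/

section functions

variable {k l : ℕ}

/-- Affine Boolean functions. -/
def IsAff (A : BVec k → ZMod 2) : Prop := ∀ x y, A (x + y) = A x + A y + A 0

/-- Affine maps between Boolean vectors. -/
def AffMap (g : BVec l → BVec k) : Prop := ∀ i, IsAff fun x => g x i

theorem two_self (a : ZMod 2) : a + a = 0 := CharTwo.add_self_eq_zero a

theorem IsAff.const (c : ZMod 2) : IsAff fun _ : BVec k => c := fun _ _ => by
  rw [two_self, zero_add]

theorem IsAff.coord (i : Fin k) : IsAff fun x : BVec k => x i := fun x y => by simp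

theorem IsAff.add {A B : BVec k → ZMod 2} (hA : IsAff A) (hB : IsAff B) :
    IsAff fun x => A x + B x := fun x y => by
  simp only [hA x y, hB x y]
  ring

theorem IsAff.comp {A : BVec k → ZMod 2} (hA : IsAff A) {g : BVec l → BVec k} (hg : AffMap g) :
    IsAff fun x => A (g x) := by
  intro x y
  have h : g (x + y) = g x + g y + g 0 := funext fun i => hg i x y
  simp only [h]
  rw [hA, hA (g x)]
  linear_combination two_self (A 0)

theorem AffMap.id : AffMap fun x : BVec k => x := IsAff.coord

theorem AffMap.tail : AffMap (Fin.tail : BVec (k + 1) → BVec k) := fun i => IsAff.coord i.succ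

theorem AffMap.cons {g : BVec l → BVec k} (hg : AffMap g) {A : BVec l → ZMod 2} (hA : IsAff A) :
    AffMap (fun x => (Fin.cons (A x) (g x) : BVec (k + 1))) := fun i => by
  refine Fin.cases ?_ (fun i => ?_) i
  · exact hA
  · exact hg i

theorem AffMap.comp_fun (e : Fin k → Fin l) : AffMap fun x : BVec l => x ∘ e :=
  fun i => IsAff.coord (e i)

theorem AffMap.update {i : Fin k} {A : BVec k → ZMod 2} (hA : IsAff A) :
    AffMap fun x : BVec k => Function.update x i (A x) := fun j => by
  by_cases h : j = i
  · subst h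
    simpa using hA
  · simpa [h] using IsAff.coord j

/-- The linear Boolean polynomial with the values of an affine function. -/
noncomputable def linPoly (A : BVec k → ZMod 2) : BoolPoly k :=
  C (A 0) + ∑ i, C (A (Pi.single i 1) + A 0) * X i

theorem IsAff.expand {A : BVec k → ZMod 2} (hA : IsAff A) (x : BVec k) :
    A x = A 0 + ∑ i, (A (Pi.single i 1) + A 0) * x i := by
  let f : BVec k →+ ZMod 2 :=
    { toFun := fun x => A x + A 0
      map_zero' := two_self _
      map_add' := fun x y => by rw [hA]; ring }
  have h : f x = ∑ i, f (Pi.single i 1) * x i := by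
    conv_lhs => rw [← Finset.univ_sum_single x, map_sum]
    refine Finset.sum_congr rfl fun i _ => ?_
    rcases zmod2_cases (x i) with e | e <;> rw [e]
    · rw [Pi.single_zero, map_zero, mul_zero]
    · rw [mul_one]
  change A x + A 0 = ∑ i, (A (Pi.single i 1) + A 0) * x i at h
  rw [← h]
  linear_combination -two_self (A 0)

theorem evalB_linPoly {A : BVec k → ZMod 2} (hA : IsAff A) : evalB (linPoly A) = A := by
  refine _root_.funext fun x => ?_
  rw [hA.expand x, linPoly, evalB_add, evalB_C]
  congr 1
  simp [evalB]

theorem totalDegree_linPoly (A : BVec k → ZMod 2) : (linPoly A).totalDegree ≤ 1 := by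
  refine (totalDegree_add _ _).trans (max_le ((totalDegree_C _).trans_le zero_le_one) ?_)
  refine totalDegree_finsetSum_le fun i _ => (totalDegree_mul _ _).trans ?_
  rw [totalDegree_C, totalDegree_X]

theorem isAff_evalB {Q : BoolPoly k} (hQ : Q.totalDegree ≤ 1) : IsAff (evalB Q) := by
  obtain ⟨c, a, h⟩ := exists_affine Q hQ
  intro x y
  simp only [h, Pi.add_apply, mul_add, Finset.sum_add_distrib, Pi.zero_apply, mul_zero,
    Finset.sum_const_zero]
  linear_combination -two_self c

/-- A polynomial of degree at most one has all exponents below the number of elements of the field,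
so it is determined by its values. -/
theorem eq_of_evalB_eq {Q Q' : BoolPoly k} (hQ : Q.totalDegree ≤ 1) (hQ' : Q'.totalDegree ≤ 1)
    (h : evalB Q = evalB Q') : Q = Q' := by
  rw [← sub_eq_zero]
  refine eq_zero_of_eval_eq_zero _ _ _ (fun x => ?_) ?_
  · rw [map_sub]
    exact sub_eq_zero.2 (congrFun h x)
  · have : Fintype.card (ZMod 2) - 1 = 1 := rfl
    rw [this, mem_restrictDegree]
    intro s hs i
    have h1 : (Q - Q').totalDegree ≤ 1 := (totalDegree_sub _ _).trans (max_le hQ hQ')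
    have h2 := (le_totalDegree hs).trans h1
    exact (Finsupp.le_degree i s).trans h2

theorem totalDegree_bind₁_le {Q : BoolPoly k} (hQ : Q.totalDegree ≤ 1) (f : Fin k → BoolPoly l)
    (hf : ∀ i, (f i).totalDegree ≤ 1) : (bind₁ f Q).totalDegree ≤ 1 := by
  obtain ⟨⟨c, L⟩, rfl⟩ := LinCode.exists_toPoly Q hQ
  rw [LinCode.toPoly, map_add, algHom_C, map_list_sum, List.map_map]
  refine (totalDegree_add _ _).trans (max_le ((totalDegree_C _).trans_le zero_le_one) ?_)
  refine totalDegree_listSum_le 1 _ (fun i => ?_) _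
  rw [Function.comp_apply, bind₁_X_right]
  exact hf i

theorem totalDegree_removeB {Q : BoolPoly k} (hQ : Q.totalDegree ≤ 1) {A : BoolPoly (k + 1)}
    (hA : A.totalDegree ≤ 1) : (removeB Q A).totalDegree ≤ 1 :=
  totalDegree_bind₁_le hA _ fun i => by
    refine Fin.cases hQ (fun i => ?_) i
    rw [Fin.cons_succ, totalDegree_X]

/-- The multiple `r A` of a Boolean function modulo `1`. -/
noncomputable def frac (r : ℝ) (A : BVec k → ZMod 2) (x : BVec k) : UnitAddCircle :=
  ((r * bit01 (A x) : ℝ) : UnitAddCircle)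

theorem coe_int_circle (z : ℤ) : ((z : ℝ) : UnitAddCircle) = 0 :=
  (AddCircle.coe_eq_zero_iff 1).2 ⟨z, by simp⟩

/-- The term `2 a b` in the value of `a ⊕ b` doubles the coefficient: quarters produce halves of
products, and halves produce integers. Therefore affine substitutions preserve the Clifford phases.
-/
theorem frac_add (r : ℝ) (A B : BVec k → ZMod 2) :
    frac r (fun x => A x + B x) = frac r A + frac r B - frac (2 * r) (fun x => A x * B x) := by
  refine _root_.funext fun x => ?_
  rw [Pi.sub_apply, Pi.add_apply, frac, frac, frac, frac, bit01_add, bit01_mul, ← AddCircle.coe_add,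
    ← AddCircle.coe_sub]
  congr 1
  ring

theorem frac_one (A : BVec k → ZMod 2) : frac 1 A = 0 := by
  refine _root_.funext fun x => ?_
  rw [frac, one_mul]
  exact coe_int_circle ((A x).val : ℤ)

theorem frac_half_add (A B : BVec k → ZMod 2) :
    frac (1 / 2) (fun x => A x + B x) = frac (1 / 2) A + frac (1 / 2) B := by
  rw [frac_add, show (2 * (1 / 2) : ℝ) = 1 by norm_num, frac_one, sub_zero]

theorem frac_quarter_add (A B : BVec k → ZMod 2) : frac (1 / 4) (fun x => A x + B x) =
    frac (1 / 4) A + frac (1 / 4) B - frac (1 / 2) (fun x => A x * B x) := by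
  rw [frac_add, show (2 * (1 / 4) : ℝ) = 1 / 2 by norm_num]

theorem frac_add_left (r r' : ℝ) (A : BVec k → ZMod 2) : frac (r + r') A = frac r A + frac r' A := by
  refine _root_.funext fun x => ?_
  rw [Pi.add_apply, frac, frac, frac, add_mul, AddCircle.coe_add]

theorem frac_half_two (A : BVec k → ZMod 2) : frac (1 / 2) A + frac (1 / 2) A = 0 := by
  rw [← frac_add_left, show (1 / 2 + 1 / 2 : ℝ) = 1 by norm_num, frac_one]

theorem frac_half_neg (A : BVec k → ZMod 2) : -frac (1 / 2) A = frac (1 / 2) A :=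
  neg_eq_of_add_eq_zero_left (frac_half_two A)

/-- The generators of the quadratic phases. -/
inductive QuadGen : (BVec k → UnitAddCircle) → Prop
  | const : QuadGen fun _ => ((1 / 8 : ℝ) : UnitAddCircle)
  | lin (A : BVec k → ZMod 2) (hA : IsAff A) : QuadGen (frac (1 / 4) A)
  | quad (A B : BVec k → ZMod 2) (hA : IsAff A) (hB : IsAff B) :
      QuadGen (frac (1 / 2) fun x => A x * B x)

/-- The quadratic phases. -/
def quadPhases (k : ℕ) : AddSubgroup (BVec k → UnitAddCircle) := AddSubgroup.closure {φ | QuadGen φ}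

theorem QuadGen.mem {φ : BVec k → UnitAddCircle} (h : QuadGen φ) : φ ∈ quadPhases k :=
  AddSubgroup.subset_closure h

theorem QuadGen.comp {φ : BVec k → UnitAddCircle} (h : QuadGen φ) {g : BVec l → BVec k}
    (hg : AffMap g) : QuadGen fun x => φ (g x) := by
  cases h with
  | const => exact .const
  | lin A hA => exact .lin _ (hA.comp hg)
  | quad A B hA hB => exact .quad _ _ (hA.comp hg) (hB.comp hg)

theorem quadPhases_comp {φ : BVec k → UnitAddCircle} (h : φ ∈ quadPhases k) {g : BVec l → BVec k}
    (hg : AffMap g) : (fun x => φ (g x)) ∈ quadPhases l := by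
  induction h using AddSubgroup.closure_induction with
  | mem φ h => exact (h.comp hg).mem
  | zero => exact zero_mem _
  | add φ ψ _ _ h h' => exact add_mem h h'
  | neg φ _ h => exact neg_mem h

theorem quadPhases_half {A : BVec k → ZMod 2} (hA : IsAff A) : frac (1 / 2) A ∈ quadPhases k := by
  have := (QuadGen.quad A _ hA (IsAff.const 1)).mem
  simpa only [mul_one] using this

theorem frac_coord_cliffPhase (P₀ : ℤ) (P₁ P₂ : MvPolynomial (Fin k) ℤ) (x : BVec k) :
    evalP (cliffPhase P₀ P₁ P₂) x = 1 / 8 * P₀ +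
      1 / 4 * eval (fun i => bit01 (x i)) (MvPolynomial.map (Int.castRingHom ℝ) P₁) +
      1 / 2 * eval (fun i => bit01 (x i)) (MvPolynomial.map (Int.castRingHom ℝ) P₂) := by
  simp [evalP, cliffPhase]

theorem quadPhases_cliffPhase (P₀ : ℤ) (P₁ P₂ : MvPolynomial (Fin k) ℤ)
    (h₁ : P₁.totalDegree ≤ 1) (h₂ : P₂.totalDegree ≤ 2) :
    (fun x => (evalP (cliffPhase P₀ P₁ P₂) x : UnitAddCircle)) ∈ quadPhases k := by
  obtain ⟨z, l, q, h⟩ := cliffPhase_exists_lists P₀ P₁ P₂ h₁ h₂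
  rw [← h]
  clear h
  have key : (fun x => (evalP (cliffPhase z (l.map fun a => C a.1 * X a.2).sum
      (q.map fun a => C a.1 * (X a.2.1 * X a.2.2)).sum) x : UnitAddCircle)) =
      z • (fun _ => ((1 / 8 : ℝ) : UnitAddCircle)) +
      (l.map fun a => a.1 • frac (1 / 4) fun x : BVec k => x a.2).sum +
      (q.map fun a => a.1 • frac (1 / 2) fun x : BVec k => x a.2.1 * x a.2.2).sum := by
    refine _root_.funext fun x => ?_
    rw [frac_coord_cliffPhase, AddCircle.coe_add, AddCircle.coe_add, Pi.add_apply, Pi.add_apply]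
    congr 1
    · congr 1
      · rw [Pi.smul_apply, ← AddCircle.coe_zsmul, zsmul_eq_mul]
        congr 1
        ring
      · induction l with
        | nil => simp
        | cons a l ih =>
          rw [List.map_cons, List.map_cons, List.sum_cons, List.sum_cons, map_add, map_add, mul_add,
            AddCircle.coe_add, ih, Pi.add_apply, Pi.smul_apply, frac, ← AddCircle.coe_zsmul,
            zsmul_eq_mul]
          congr 2
          simp
          ring
    · induction q with
      | nil => simp
      | cons a l ih =>
        rw [List.map_cons, List.map_cons, List.sum_cons, List.sum_cons, map_add, map_add, mul_add,
          AddCircle.coe_add, ih, Pi.add_apply, Pi.smul_apply, frac, ← AddCircle.coe_zsmul,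
          zsmul_eq_mul]
        congr 2
        simp [bit01_mul]
        ring
  rw [key]
  refine add_mem (add_mem (zsmul_mem QuadGen.const.mem _) (list_sum_mem ?_)) (list_sum_mem ?_)
  · intro ψ hψ
    obtain ⟨a, -, rfl⟩ := List.mem_map.1 hψ
    exact zsmul_mem (QuadGen.lin _ (IsAff.coord _)).mem _
  · intro ψ hψ
    obtain ⟨a, -, rfl⟩ := List.mem_map.1 hψ
    exact zsmul_mem (QuadGen.quad _ _ (IsAff.coord _) (IsAff.coord _)).mem _

/-- The phases of Clifford terms. -/
def cliffPhases (k : ℕ) : AddSubgroup (BVec k → UnitAddCircle) where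
  carrier := {φ | ∃ (P₀ : ℤ) (P₁ P₂ : MvPolynomial (Fin k) ℤ), P₁.totalDegree ≤ 1 ∧
    P₂.totalDegree ≤ 2 ∧ ∀ x, (evalP (cliffPhase P₀ P₁ P₂) x : UnitAddCircle) = φ x}
  zero_mem' := ⟨0, 0, 0, by simp, by simp, fun x => by simp [evalP, cliffPhase]⟩
  add_mem' := by
    rintro φ ψ ⟨a, b, c, hb, hc, h⟩ ⟨a', b', c', hb', hc', h'⟩
    refine ⟨a + a', b + b', c + c', (totalDegree_add _ _).trans (max_le hb hb'),
      (totalDegree_add _ _).trans (max_le hc hc'), fun x => ?_⟩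
    rw [Pi.add_apply, ← h, ← h', ← AddCircle.coe_add]
    congr 1
    simp only [frac_coord_cliffPhase, map_add, Int.cast_add]
    ring
  neg_mem' := by
    rintro φ ⟨a, b, c, hb, hc, h⟩
    refine ⟨-a, -b, -c, by rwa [totalDegree_neg], by rwa [totalDegree_neg], fun x => ?_⟩
    rw [Pi.neg_apply, ← h, ← AddCircle.coe_neg]
    congr 1
    simp only [frac_coord_cliffPhase, map_neg, Int.cast_neg]
    ring

theorem cliffPhases_const : (fun _ => ((1 / 8 : ℝ) : UnitAddCircle)) ∈ cliffPhases k :=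
  ⟨1, 0, 0, by simp, by simp, fun x => by rw [frac_coord_cliffPhase]; simp⟩

theorem cliffPhases_lin (i : Fin k) : frac (1 / 4) (fun x => x i) ∈ cliffPhases k :=
  ⟨0, X i, 0, (totalDegree_X _).le, by simp, fun x => by rw [frac_coord_cliffPhase, frac]; simp⟩

theorem cliffPhases_quad (i j : Fin k) : frac (1 / 2) (fun x => x i * x j) ∈ cliffPhases k :=
  ⟨0, 0, X i * X j, by simp, (totalDegree_mul _ _).trans (by rw [totalDegree_X, totalDegree_X]),
    fun x => by rw [frac_coord_cliffPhase, frac]; simp [bit01_mul]⟩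

/-- An induction principle for affine functions. -/
theorem IsAff.induction {p : (BVec k → ZMod 2) → Prop} (h0 : p fun _ => 0) (h1 : p fun _ => 1)
    (hX : ∀ i, p fun x => x i) (hadd : ∀ A B, IsAff A → IsAff B → p A → p B → p fun x => A x + B x)
    {A : BVec k → ZMod 2} (hA : IsAff A) : p A := by
  have hc : ∀ c : ZMod 2, p fun _ => c := fun c => by
    rcases zmod2_cases c with rfl | rfl
    exacts [h0, h1]
  have key : ∀ S : Finset (Fin k), IsAff (fun x => ∑ i ∈ S, (A (Pi.single i 1) + A 0) * x i) ∧
      p fun x => ∑ i ∈ S, (A (Pi.single i 1) + A 0) * x i := by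
    intro S
    induction S using Finset.induction_on with
    | empty => simpa using ⟨IsAff.const 0, h0⟩
    | insert i S hi ih =>
      simp only [Finset.sum_insert hi]
      have h : IsAff (fun x : BVec k => (A (Pi.single i 1) + A 0) * x i) ∧
          p fun x : BVec k => (A (Pi.single i 1) + A 0) * x i := by
        rcases zmod2_cases (A (Pi.single i 1) + A 0) with e | e <;> rw [e]
        · simpa using ⟨IsAff.const 0, h0⟩
        · simpa using ⟨IsAff.coord i, hX i⟩
      exact ⟨h.1.add ih.1, hadd _ _ h.1 ih.1 h.2 ih.2⟩
  have := hadd _ _ (IsAff.const (A 0)) (key Finset.univ).1 (hc _) (key Finset.univ).2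
  rwa [← show A = fun x => A 0 + ∑ i, (A (Pi.single i 1) + A 0) * x i from
    _root_.funext hA.expand] at this

/-- The description of `quadPhases` by affine functions makes its invariance under affine maps
evident. Expanding the affine functions additively leads back to polynomials in the coordinates with
the prescribed degrees. -/
theorem quadPhases_le_cliffPhases : quadPhases k ≤ cliffPhases k := by
  have hz : ∀ r : ℝ, frac r (fun _ : BVec k => (0 : ZMod 2)) = 0 := fun r => _root_.funext fun x => by
    rw [frac, bit01_zero, mul_zero, AddCircle.coe_zero]
    rfl
  have h4 : frac (1 / 4) (fun _ : BVec k => (1 : ZMod 2)) ∈ cliffPhases k := by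
    convert add_mem cliffPhases_const (cliffPhases_const (k := k)) using 1
    refine _root_.funext fun x => ?_
    rw [frac, bit01_one, Pi.add_apply, ← AddCircle.coe_add]
    congr 1
    norm_num
  have h2 : frac (1 / 2) (fun _ : BVec k => (1 : ZMod 2)) ∈ cliffPhases k := by
    convert add_mem h4 h4 using 1
    rw [← frac_add_left]
    norm_num
  have h2X : ∀ i, frac (1 / 2) (fun x : BVec k => x i) ∈ cliffPhases k := fun i => by
    convert add_mem (cliffPhases_lin i) (cliffPhases_lin i) using 1
    rw [← frac_add_left]
    norm_num
  -- Reduction of one affine factor to coordinates; it is applied to each of the two factors in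
  -- turn.
  have hmul : ∀ F : BVec k → ZMod 2,
      frac (1 / 2) (fun x => F x * 1) ∈ cliffPhases k →
      (∀ i, frac (1 / 2) (fun x => F x * x i) ∈ cliffPhases k) →
      ∀ B, IsAff B → frac (1 / 2) (fun x => F x * B x) ∈ cliffPhases k := by
    intro F h1 hX B hB
    refine IsAff.induction (p := fun B => frac (1 / 2) (fun x => F x * B x) ∈ cliffPhases k)
      ?_ h1 hX ?_ hB
    · simp only [mul_zero, hz, zero_mem]
    · intro A B _ _ hA hB
      simp only [mul_add]
      rw [frac_half_add]
      exact add_mem hA hB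
  have hone : ∀ B : BVec k → ZMod 2, IsAff B → frac (1 / 2) B ∈ cliffPhases k := fun B hB => by
    simpa only [one_mul] using
      hmul (fun _ => 1) (by simpa using h2) (fun i => by simpa using h2X i) B hB
  have hq : ∀ A B : BVec k → ZMod 2, IsAff A → IsAff B →
      frac (1 / 2) (fun x => A x * B x) ∈ cliffPhases k := fun A B hA hB =>
    hmul A (by simpa using hone A hA) (fun i => by
      simpa only [mul_comm] using hmul (fun x => x i) (by simpa using h2X i)
        (fun j => cliffPhases_quad i j) A hA) B hB
  refine (AddSubgroup.closure_le _).2 fun φ hφ => ?_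
  cases hφ with
  | const => exact cliffPhases_const
  | quad A B hA hB => exact hq A B hA hB
  | lin A hA =>
    refine IsAff.induction (p := fun A => frac (1 / 4) A ∈ cliffPhases k) ?_ h4 cliffPhases_lin ?_ hA
    · rw [hz]
      exact zero_mem _
    · intro A B hA hB h h'
      rw [frac_quarter_add]
      exact sub_mem (add_mem h h') (hq A B hA hB)

end functions

/-! ## Classes of sums -/

namespace SumData

variable {n m k l : ℕ}

/-- The sums of the Clifford fragment. -/
structure IsCliff (f : SumData n m k) : Prop where
  scalar : ∃ p : ℤ, f.s = (1 / √2) ^ p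
  phase : f.φ ∈ quadPhases k
  lin : ∀ i, IsAff (f.L i)
  disc : ∀ d ∈ f.D, IsAff d

/-- Reparametrization of a sum. -/
def comap (f : SumData n m k) (g : BVec l → BVec k) : SumData n m l :=
  ⟨f.s, fun x => f.φ (g x), fun i x => f.L i (g x), (fun d x => d (g x)) '' f.D⟩

/-- Addition of a phase. -/
noncomputable def addPhase (f : SumData n m k) (ψ : BVec k → UnitAddCircle) : SumData n m k :=
  ⟨f.s, f.φ + ψ, f.L, f.D⟩

/-- Multiplication by a scalar. -/
noncomputable def scale (r : ℝ) (f : SumData n m k) : SumData n m k := ⟨r * f.s, f.φ, f.L, f.D⟩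

/-- Addition of a discarded function. -/
def addDisc (f : SumData n m k) (d : BVec k → ZMod 2) : SumData n m k :=
  ⟨f.s, f.φ, f.L, insert d f.D⟩

theorem IsCliff.comap {f : SumData n m k} (hf : f.IsCliff) {g : BVec l → BVec k} (hg : AffMap g) :
    (f.comap g).IsCliff where
  scalar := hf.scalar
  phase := quadPhases_comp hf.phase hg
  lin i := (hf.lin i).comp hg
  disc := by
    rintro _ ⟨d, hd, rfl⟩
    exact (hf.disc d hd).comp hg

theorem IsCliff.addPhase {f : SumData n m k} (hf : f.IsCliff) {ψ : BVec k → UnitAddCircle}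
    (hψ : ψ ∈ quadPhases k) : (f.addPhase ψ).IsCliff :=
  ⟨hf.scalar, add_mem hf.phase hψ, hf.lin, hf.disc⟩

theorem IsCliff.addDisc {f : SumData n m k} (hf : f.IsCliff) {d : BVec k → ZMod 2} (hd : IsAff d) :
    (f.addDisc d).IsCliff :=
  ⟨hf.scalar, hf.phase, hf.lin, Set.forall_mem_insert.2 ⟨hd, hf.disc⟩⟩

theorem IsCliff.scale_two {f : SumData n m k} (hf : f.IsCliff) : (f.scale 2).IsCliff := by
  obtain ⟨p, hp⟩ := hf.scalar
  refine ⟨⟨p - 2, ?_⟩, hf.phase, hf.lin, hf.disc⟩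
  rw [scale, hp, zpow_sub₀ (by positivity), one_div, inv_zpow' √2 2, zpow_neg]
  norm_num
  ring

theorem IsCliff.scale_sqrt {f : SumData n m k} (hf : f.IsCliff) : (f.scale √2).IsCliff := by
  obtain ⟨p, hp⟩ := hf.scalar
  refine ⟨⟨p - 1, ?_⟩, hf.phase, hf.lin, hf.disc⟩
  rw [scale, hp, zpow_sub₀ (by positivity), zpow_one, one_div, div_inv_eq_mul, mul_comm]

/-- Polynomials with the values that a sum consists of. -/
structure Reps (f : SumData n m k) (P : PhasePoly k) (O : Fin m → BoolPoly k)
    (D : Finset (BoolPoly k)) (I : Fin n → BoolPoly k) : Prop where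
  phase : ∀ x, (evalP P x : UnitAddCircle) = f.φ x
  ket : ∀ i, evalB (O i) = f.L (.inl i)
  bra : ∀ i, evalB (I i) = f.L (.inr i)
  disc : evalB '' (D : Set (BoolPoly k)) = f.D
  degO : ∀ i, (O i).totalDegree ≤ 1
  degD : ∀ d ∈ D, d.totalDegree ≤ 1
  degI : ∀ i, (I i).totalDegree ≤ 1

variable {f : SumData n m k} {P : PhasePoly k} {O : Fin m → BoolPoly k}
    {D : Finset (BoolPoly k)} {I : Fin n → BoolPoly k}

theorem Reps.isClifford (h : f.Reps P O D I) (hf : f.IsCliff) :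
    (⟨k, f.s, P, O, D, I⟩ : SOPTerm n m).IsClifford := by
  obtain ⟨P₀, P₁, P₂, h₁, h₂, hP⟩ := quadPhases_le_cliffPhases hf.phase
  refine ⟨hf.scalar, ⟨P₀, P₁, P₂, h₁, h₂, mem_phaseNull_of_int _ fun x => ?_⟩, h.degO, h.degD, h.degI⟩
  have e := (h.phase x).trans (hP x).symm
  rw [← sub_eq_zero, ← AddCircle.coe_sub, AddCircle.coe_eq_zero_iff] at e
  obtain ⟨z, hz⟩ := e
  refine ⟨z, ?_⟩
  rw [evalP_sub, ← hz]
  simp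

theorem IsCliff.exists_reps (hf : f.IsCliff) : ∃ P O D I, f.Reps P O D I := by
  obtain ⟨P₀, P₁, P₂, h₁, h₂, hP⟩ := quadPhases_le_cliffPhases hf.phase
  refine ⟨cliffPhase P₀ P₁ P₂, fun i => linPoly (f.L (.inl i)),
    f.D.toFinite.toFinset.image linPoly, fun i => linPoly (f.L (.inr i)), hP,
    fun i => evalB_linPoly (hf.lin _), fun i => evalB_linPoly (hf.lin _), ?_,
    fun i => totalDegree_linPoly _, ?_, fun i => totalDegree_linPoly _⟩
  · rw [Finset.coe_image, Set.image_image, Set.Finite.coe_toFinset]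
    refine (Set.image_congr fun d hd => evalB_linPoly (hf.disc d hd)).trans (Set.image_id' _)
  · intro d hd
    obtain ⟨a, -, rfl⟩ := Finset.mem_image.1 hd
    exact totalDegree_linPoly a

/-- The morphism denoted by a sum. -/
def HasClass (f : SumData n m k) (q : CliffQuot n m) : Prop :=
  ∃ P O D I, ∃ h : (⟨k, f.s, P, O, D, I⟩ : SOPTerm n m).IsClifford,
    f.Reps P O D I ∧ Quot.mk CliffStep ⟨_, h⟩ = q

/-- Affine Boolean polynomials are determined by their values, and phase polynomials by theirs up to
`phaseNull`, which is one of the steps. From here on only functions matter. -/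
theorem HasClass.unique {q q' : CliffQuot n m} (hq : f.HasClass q) (hq' : f.HasClass q') :
    q = q' := by
  obtain ⟨P, O, D, I, h, hr, rfl⟩ := hq
  obtain ⟨P', O', D', I', h', hr', rfl⟩ := hq'
  obtain rfl : O = O' := _root_.funext fun i => eq_of_evalB_eq (hr.degO i) (hr'.degO i)
    ((hr.ket i).trans (hr'.ket i).symm)
  obtain rfl : I = I' := _root_.funext fun i => eq_of_evalB_eq (hr.degI i) (hr'.degI i)
    ((hr.bra i).trans (hr'.bra i).symm)
  have hsub : ∀ D₁ D₂ : Finset (BoolPoly k), (∀ d ∈ D₁, d.totalDegree ≤ 1) →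
      (∀ d ∈ D₂, d.totalDegree ≤ 1) → evalB '' (D₁ : Set (BoolPoly k)) = evalB '' (D₂ : Set (BoolPoly k)) →
      D₁ ⊆ D₂ := by
    intro D₁ D₂ h₁ h₂ h d hd
    obtain ⟨e, he, hde⟩ := (Set.ext_iff.1 h (evalB d)).1 ⟨d, hd, rfl⟩
    rwa [eq_of_evalB_eq (h₁ d hd) (h₂ e he) hde.symm]
  obtain rfl : D = D' := (hsub D D' hr.degD hr'.degD (hr.disc.trans hr'.disc.symm)).antisymm
    (hsub D' D hr'.degD hr.degD (hr'.disc.trans hr.disc.symm))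
  refine Quot.sound (SOPStep.phase f.s P P' O D I (mem_phaseNull_of_int _ fun x => ?_))
  have e := (hr.phase x).trans (hr'.phase x).symm
  rw [← sub_eq_zero, ← AddCircle.coe_sub, AddCircle.coe_eq_zero_iff] at e
  obtain ⟨z, hz⟩ := e
  refine ⟨z, ?_⟩
  rw [evalP_sub, ← hz]
  simp

/-- Two sums denote the same morphism. -/
def Rel (f : SumData n m k) (g : SumData n m l) : Prop := ∃ q, f.HasClass q ∧ g.HasClass q

theorem IsCliff.refl (hf : f.IsCliff) : Rel f f := by
  obtain ⟨P, O, D, I, h⟩ := hf.exists_reps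
  exact ⟨_, ⟨P, O, D, I, h.isClifford hf, h, rfl⟩, ⟨P, O, D, I, h.isClifford hf, h, rfl⟩⟩

theorem Rel.symm {g : SumData n m l} (h : Rel f g) : Rel g f := by
  obtain ⟨q, h, h'⟩ := h
  exact ⟨q, h', h⟩

theorem Rel.trans {j : ℕ} {g : SumData n m l} {e : SumData n m j} (h : Rel f g) (h' : Rel g e) :
    Rel f e := by
  obtain ⟨q, h₁, h₂⟩ := h
  obtain ⟨q', h₃, h₄⟩ := h'
  obtain rfl := h₂.unique h₃
  exact ⟨q, h₁, h₄⟩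

theorem HasClass.isCliff {q : CliffQuot n m} (hq : f.HasClass q) : f.IsCliff := by
  obtain ⟨P, O, D, I, h, hr, rfl⟩ := hq
  refine ⟨h.scalar, ?_, ?_, ?_⟩
  · obtain ⟨P₀, P₁, P₂, h₁, h₂, hP⟩ := h.phase
    convert quadPhases_cliffPhase P₀ P₁ P₂ h₁ h₂ using 1
    refine _root_.funext fun x => ?_
    obtain ⟨z, hz⟩ := int_of_mem_phaseNull hP x
    rw [evalP_sub] at hz
    rw [← hr.phase, ← sub_eq_zero, ← AddCircle.coe_sub, hz, coe_int_circle]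
  · rintro (i | i)
    · rw [← hr.ket]
      exact isAff_evalB (hr.degO i)
    · rw [← hr.bra]
      exact isAff_evalB (hr.degI i)
  · intro d hd
    rw [← hr.disc] at hd
    obtain ⟨e, he, rfl⟩ := hd
    exact isAff_evalB (hr.degD e he)

theorem Rel.left {g : SumData n m l} (h : Rel f g) : f.IsCliff := h.choose_spec.1.isCliff

theorem Rel.right {g : SumData n m l} (h : Rel f g) : g.IsCliff := h.choose_spec.2.isCliff

/-- The bridge between the two levels: a rule is applied to polynomials chosen to represent the
given functions. -/
theorem Reps.rel {g : SumData n m l} {P' : PhasePoly l} {O' : Fin m → BoolPoly l}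
    {D' : Finset (BoolPoly l)} {I' : Fin n → BoolPoly l} (h : f.Reps P O D I)
    (h' : g.Reps P' O' D' I') (hf : f.IsCliff) (hg : g.IsCliff)
    (hs : SOPStep (⟨k, f.s, P, O, D, I⟩ : SOPTerm n m) ⟨l, g.s, P', O', D', I'⟩) : Rel f g :=
  ⟨_, ⟨P, O, D, I, h.isClifford hf, h, Quot.sound (show CliffStep ⟨_, h.isClifford hf⟩ ⟨_, h'.isClifford hg⟩ from hs)⟩,
    ⟨P', O', D', I', h'.isClifford hg, h', rfl⟩⟩

/-! ### The rules -/

theorem Reps.addPhase (h : f.Reps P O D I) {P' : PhasePoly k} {ψ : BVec k → UnitAddCircle}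
    (hψ : ∀ x, (evalP P' x : UnitAddCircle) = evalP P x + ψ x) : (f.addPhase ψ).Reps P' O D I :=
  { h with phase := fun x => (hψ x).trans (by rw [h.phase]; rfl) }

theorem Reps.scale (h : f.Reps P O D I) (r : ℝ) : (f.scale r).Reps P O D I := { h with }

theorem Reps.addDisc (h : f.Reps P O D I) {Q : BoolPoly k} (hQ : Q.totalDegree ≤ 1) :
    (f.addDisc (evalB Q)).Reps P O (insert Q D) I :=
  { h with
    disc := by rw [Finset.coe_insert, Set.image_insert_eq, h.disc]; rfl
    degD := (Finset.forall_mem_insert _ _ _).2 ⟨hQ, h.degD⟩ }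

theorem Reps.rename (h : f.Reps P O D I) (e : Fin k → Fin l) :
    (f.comap fun x => x ∘ e).Reps (rename e P) (fun i => rename e (O i)) (D.image (rename e))
      fun i => rename e (I i) where
  phase x := by rw [evalP_rename, h.phase]; rfl
  ket i := _root_.funext fun x => by rw [evalB_rename, h.ket]; rfl
  bra i := _root_.funext fun x => by rw [evalB_rename, h.bra]; rfl
  disc := by
    rw [comap, ← h.disc, Finset.coe_image, Set.image_image, Set.image_image]
    exact Set.image_congr fun d hd => _root_.funext fun x => evalB_rename _ _ _
  degO i := (totalDegree_rename_le _ _).trans (h.degO i)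
  degD := Finset.forall_mem_image.2 fun d hd => (totalDegree_rename_le _ _).trans (h.degD d hd)
  degI i := (totalDegree_rename_le _ _).trans (h.degI i)

theorem Reps.up (h : f.Reps P O D I) :
    (f.comap Fin.tail).Reps (upP P) (fun i => upB (O i)) (D.image upB) fun i => upB (I i) :=
  h.rename Fin.succ

theorem Reps.remove {f : SumData n m (k + 1)} {P : PhasePoly (k + 1)} {O : Fin m → BoolPoly (k + 1)}
    {D : Finset (BoolPoly (k + 1))} {I : Fin n → BoolPoly (k + 1)} (h : f.Reps P O D I)
    {Q : BoolPoly k} (hQ : Q.totalDegree ≤ 1) :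
    (f.comap fun x => (Fin.cons (evalB Q x) x : BVec (k + 1))).Reps (removeP Q P)
      (fun i => removeB Q (O i)) (D.image (removeB Q)) fun i => removeB Q (I i) where
  phase x := by rw [evalP_removeP, h.phase]; rfl
  ket i := _root_.funext fun x => by rw [evalB_removeB, h.ket]; rfl
  bra i := _root_.funext fun x => by rw [evalB_removeB, h.bra]; rfl
  disc := by
    rw [comap, ← h.disc, Finset.coe_image, Set.image_image, Set.image_image]
    exact Set.image_congr fun d hd => _root_.funext fun x => evalB_removeB _ _ _
  degO i := totalDegree_removeB hQ (h.degO i)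
  degD := Finset.forall_mem_image.2 fun d hd => totalDegree_removeB hQ (h.degD d hd)
  degI i := totalDegree_removeB hQ (h.degI i)

theorem rel_perm (hf : f.IsCliff) (π : Equiv.Perm (Fin k)) : Rel f (f.comap fun x => x ∘ π) := by
  obtain ⟨P, O, D, I, h⟩ := hf.exists_reps
  exact h.rel (h.rename π) hf (hf.comap (AffMap.comp_fun π)) (.alpha π f.s P O D I)

theorem rel_elim (hf : f.IsCliff) : Rel (f.comap Fin.tail) (f.scale 2) := by
  obtain ⟨P, O, D, I, h⟩ := hf.exists_reps
  exact h.up.rel (h.scale 2) (hf.comap AffMap.tail) hf.scale_two (.elim f.s P O D I)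

theorem rel_hh {f : SumData n m (k + 1)} (hf : f.IsCliff) {q : BVec k → ZMod 2} (hq : IsAff q) :
    Rel ((f.comap Fin.tail).addPhase (frac (1 / 2) fun x => x 0 * (x 1 + q (Fin.tail (Fin.tail x)))))
      ((f.comap fun x => (Fin.cons (q x) x : BVec (k + 1))).scale 2) := by
  obtain ⟨P, O, D, I, h⟩ := hf.exists_reps
  have h1 : ∀ x : BVec (k + 2), (evalP (C (1 / 2) * X 0 * (X 1 + hat (upB (upB (linPoly q)))) + upP P) x :
      UnitAddCircle) = evalP (upP P) x +
        frac (1 / 2) (fun x : BVec (k + 2) => x 0 * (x 1 + q (Fin.tail (Fin.tail x)))) x := by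
    intro x
    rw [frac, ← AddCircle.coe_add, ← sub_eq_zero, ← AddCircle.coe_sub, AddCircle.coe_eq_zero_iff]
    simp only [evalP_add, evalP_mul, evalP_X, evalP_C, evalP_hat, evalB_upB, evalB_linPoly hq,
      bit01_add, bit01_mul]
    -- The value of `x 1 ⊕ q` contains `- 2 x 1 q`, so after multiplication by `x 0 / 2` the two
    -- phases differ by the integer `x 0 * x 1 * q`.
    refine ⟨(x 0).val * (x 1).val * (q (Fin.tail (Fin.tail x))).val, ?_⟩
    simp only [bit01]
    push_cast
    rw [zsmul_eq_mul]
    push_cast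
    ring
  have h2 := h.remove (Q := linPoly q) (totalDegree_linPoly q)
  rw [evalB_linPoly hq] at h2
  refine (h.up.addPhase h1).rel (h2.scale 2) ?_ ?_ (.hh f.s (linPoly q) P O D I)
  · exact (hf.comap AffMap.tail).addPhase
      (QuadGen.quad _ _ (IsAff.coord 0) ((IsAff.coord 1).add (hq.comp (AffMap.comp_fun _)))).mem
  · exact (hf.comap (AffMap.cons AffMap.id hq)).scale_two

theorem rel_omega (hf : f.IsCliff) {q : BVec k → ZMod 2} (hq : IsAff q) :
    Rel ((f.comap Fin.tail).addPhase
        (frac (1 / 4) (fun x => x 0) + frac (1 / 2) fun x => x 0 * q (Fin.tail x)))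
      ((f.addPhase ((fun _ => ((1 / 8 : ℝ) : UnitAddCircle)) - frac (1 / 4) q)).scale √2) := by
  obtain ⟨P, O, D, I, h⟩ := hf.exists_reps
  refine (h.up.addPhase (P' := C (1 / 4) * X 0 + C (1 / 2) * X 0 * hat (upB (linPoly q)) + upP P)
    fun x => ?_).rel ((h.addPhase (P' := C (1 / 8) - C (1 / 4) * hat (linPoly q) + P)
    fun x => ?_).scale √2) ?_ ?_ (.omega f.s (linPoly q) P O D I)
  · rw [Pi.add_apply, frac, frac, ← AddCircle.coe_add, ← AddCircle.coe_add]
    congr 1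
    simp only [evalP_add, evalP_mul, evalP_X, evalP_C, evalP_hat, evalB_upB, evalB_linPoly hq,
      bit01_mul]
    ring
  · rw [Pi.sub_apply, frac, ← AddCircle.coe_sub, ← AddCircle.coe_add]
    congr 1
    simp only [evalP_add, evalP_sub, evalP_mul, evalP_C, evalP_hat, evalB_linPoly hq]
    ring
  · exact (hf.comap AffMap.tail).addPhase (add_mem (QuadGen.lin _ (IsAff.coord 0)).mem
      (QuadGen.quad _ _ (IsAff.coord 0) (hq.comp AffMap.tail)).mem)
  · exact (hf.addPhase (sub_mem QuadGen.const.mem (QuadGen.lin _ hq).mem)).scale_sqrt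

theorem rel_hGround (hf : f.IsCliff) {q : BVec k → ZMod 2} (hq : IsAff q) :
    Rel (((f.comap Fin.tail).addDisc fun x => x 0).addPhase
        (frac (1 / 2) fun x => x 0 * q (Fin.tail x)))
      ((f.addDisc q).scale √2) := by
  obtain ⟨P, O, D, I, h⟩ := hf.exists_reps
  have h1 := h.up.addDisc (Q := X 0) (totalDegree_X _).le
  have h2 := h.addDisc (Q := linPoly q) (totalDegree_linPoly q)
  rw [evalB_linPoly hq] at h2
  have e : evalB (X 0 : BoolPoly (k + 1)) = fun x => x 0 := _root_.funext fun x => evalB_X _ _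
  rw [e] at h1
  refine (h1.addPhase (P' := upP P + C (1 / 2) * X 0 * hat (upB (linPoly q)))
    fun x => ?_).rel (h2.scale √2) ?_ ?_ (.hGround f.s (linPoly q) P O D I)
  · rw [frac, ← AddCircle.coe_add]
    congr 1
    simp only [evalP_add, evalP_mul, evalP_X, evalP_C, evalP_hat, evalB_upB, evalB_linPoly hq,
      bit01_mul]
    ring
  · exact ((hf.comap AffMap.tail).addDisc (IsAff.coord 0)).addPhase
      (QuadGen.quad _ _ (IsAff.coord 0) (hq.comp AffMap.tail)).mem
  · exact (hf.addDisc hq).scale_sqrt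

theorem rel_zGround (hf : f.IsCliff) (r : ℝ) {A B : BVec k → ZMod 2} (hA : A ∈ f.D) (hB : B ∈ f.D)
    (hq : frac r (fun x => A x * B x) ∈ quadPhases k) :
    Rel (f.addPhase (frac r fun x => A x * B x)) f := by
  obtain ⟨P, O, D, I, h⟩ := hf.exists_reps
  have hAB : A ∈ evalB '' (D : Set (BoolPoly k)) ∧ B ∈ evalB '' (D : Set (BoolPoly k)) := by
    rw [h.disc]
    exact ⟨hA, hB⟩
  obtain ⟨⟨a, ha, rfl⟩, b, hb, rfl⟩ := hAB
  refine (h.addPhase (P' := P + C r * hat (∏ d ∈ {a, b}, d)) fun x => ?_).rel h (hf.addPhase hq) hf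
    (.zGround f.s P r {a, b} O D I ?_)
  · rw [frac, ← AddCircle.coe_add]
    congr 1
    rw [evalP_add, evalP_mul, evalP_C, evalP_hat]
    congr 3
    -- The rule takes a set of discards, so for `a = b` the product has a single factor; on bits it
    -- equals its square.
    by_cases hab : a = b
    · subst hab
      rw [Finset.insert_eq_of_mem (Finset.mem_singleton_self a), Finset.prod_singleton]
      rcases zmod2_cases (evalB a x) with e | e <;> rw [e] <;> rfl
    · rw [Finset.prod_pair hab]
      exact map_mul (eval x) a b
  · intro d hd
    rw [Finset.mem_insert, Finset.mem_singleton] at hd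
    rcases hd with rfl | rfl
    exacts [ha, hb]

/-- The empty product of discards is `1`, so a global phase can be removed even if nothing is
discarded. -/
theorem rel_const (hf : f.IsCliff) (r : ℝ) (hq : (fun _ => (r : UnitAddCircle)) ∈ quadPhases k) :
    Rel (f.addPhase fun _ => (r : UnitAddCircle)) f := by
  obtain ⟨P, O, D, I, h⟩ := hf.exists_reps
  refine (h.addPhase (P' := P + C r * hat (∏ d ∈ ∅, d)) fun x => ?_).rel h (hf.addPhase hq) hf
    (.zGround f.s P r ∅ O D I (Finset.empty_subset _))
  rw [← AddCircle.coe_add, evalP_add, evalP_mul, evalP_C, evalP_hat, Finset.prod_empty]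
  have : evalB (1 : BoolPoly k) x = 1 := map_one (eval x)
  rw [this, bit01_one, mul_one]

/-- Adding the constant `1` is also covered, as the instance of the rule with an empty product. -/
theorem rel_xorGround (hf : f.IsCliff) {A d : BVec k → ZMod 2} (hA : A ∈ f.D ∨ A = fun _ => 1)
    (hd : IsAff d) : Rel (f.addDisc fun x => A x + d x) (f.addDisc d) := by
  obtain ⟨P, O, D, I, h⟩ := hf.exists_reps
  have key : ∀ T ⊆ D, IsAff A → A = evalB (∏ e ∈ T, e) → (∏ e ∈ T, e).totalDegree ≤ 1 →
      Rel (f.addDisc fun x => A x + d x) (f.addDisc d) := by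
    intro T hT hAff hA hdeg
    have h1 := h.addDisc (Q := ∏ e ∈ T, e + linPoly d)
      ((totalDegree_add _ _).trans (max_le hdeg (totalDegree_linPoly d)))
    have h2 := h.addDisc (Q := linPoly d) (totalDegree_linPoly d)
    have e : evalB (∏ e ∈ T, e + linPoly d) = fun x => A x + d x := _root_.funext fun x => by
      rw [evalB_add, ← hA, evalB_linPoly hd]
    rw [e] at h1
    rw [evalB_linPoly hd] at h2
    exact h1.rel h2 (hf.addDisc (hAff.add hd)) (hf.addDisc hd)
      (.xorGround f.s P (linPoly d) T O D I hT)
  rcases hA with hA | rfl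
  · have hA' := hA
    rw [← h.disc] at hA'
    obtain ⟨a, ha, rfl⟩ := hA'
    refine key {a} (Finset.singleton_subset_iff.2 ha) (hf.disc _ hA) ?_ ?_
    · rw [Finset.prod_singleton]
    · rw [Finset.prod_singleton]
      exact h.degD a ha
  · refine key ∅ (Finset.empty_subset _) (IsAff.const 1) ?_ ?_
    · rw [Finset.prod_empty]
      exact _root_.funext fun x => (map_one (eval x)).symm
    · rw [Finset.prod_empty, totalDegree_one]
      exact zero_le_one

theorem rel_cstGround (hf : f.IsCliff) (c : ZMod 2) : Rel (f.addDisc fun _ => c) f := by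
  obtain ⟨P, O, D, I, h⟩ := hf.exists_reps
  have h1 := h.addDisc (Q := C c) ((totalDegree_C _).trans_le zero_le_one)
  have e : evalB (C c : BoolPoly k) = fun _ => c := _root_.funext fun x => evalB_C c x
  rw [e] at h1
  exact h1.rel h (hf.addDisc (IsAff.const c)) hf (.cstGround f.s P c O D I)

/-- The zero morphism. -/
noncomputable def zeroData (n m : ℕ) : SumData n m 1 :=
  ⟨1, frac (1 / 2) fun x => x 0, fun _ _ => 0, ∅⟩

theorem isCliff_zeroData : (zeroData n m).IsCliff :=
  ⟨⟨0, by simp [zeroData]⟩, quadPhases_half (IsAff.coord 0), fun _ => IsAff.const 0,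
    fun d hd => hd.elim⟩

/-- Rule (Z) requires something nonzero besides the phase `y_0 / 2`. If the phase `f.φ` vanishes, a
global phase `1/8` is first inserted with `rel_const`, which makes the rule applicable. -/
theorem rel_zero (hf : f.IsCliff) :
    Rel ((f.comap Fin.tail).addPhase (frac (1 / 2) fun x => x 0)) (zeroData n m) := by
  have key : ∀ f : SumData n m k, f.IsCliff → f.φ ≠ 0 →
      Rel ((f.comap Fin.tail).addPhase (frac (1 / 2) fun x => x 0)) (zeroData n m) := by
    intro f hf hne
    obtain ⟨P, O, D, I, h⟩ := hf.exists_reps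
    have h0 : (zeroData n m).Reps (C (1 / 2) * X 0) (fun _ => 0) ∅ fun _ => 0 :=
      { phase := fun x => by
          rw [evalP_mul, evalP_C, evalP_X]
          rfl
        ket := fun i => _root_.funext fun x => map_zero (eval x)
        bra := fun i => _root_.funext fun x => map_zero (eval x)
        disc := by simp [zeroData]
        degO := fun i => by simp
        degD := by simp
        degI := fun i => by simp }
    refine (h.up.addPhase (P' := C (1 / 2) * X 0 + upP P) fun x => ?_).rel h0
      ((hf.comap AffMap.tail).addPhase (quadPhases_half (IsAff.coord 0))) isCliff_zeroData
      (.zero f.s P O D I (.inl fun hP => hne (_root_.funext fun x => ?_)))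
    · rw [frac, ← AddCircle.coe_add, evalP_add, evalP_mul, evalP_C, evalP_X, add_comm]
    · obtain ⟨z, hz⟩ := int_of_mem_phaseNull hP x
      rw [← h.phase, hz, coe_int_circle]
      rfl
  by_cases h0 : f.φ = 0
  · have hc := QuadGen.const.mem (k := k + 1)
    have h1 := rel_const ((hf.comap AffMap.tail).addPhase (quadPhases_half (IsAff.coord 0))) (1 / 8) hc
    refine h1.symm.trans ?_
    have h2 := key (f.addPhase fun _ => ((1 / 8 : ℝ) : UnitAddCircle)) (hf.addPhase QuadGen.const.mem) ?_
    · convert h2 using 1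
      simp only [addPhase, comap, SumData.mk.injEq, true_and, and_true]
      refine _root_.funext fun x => ?_
      simp only [Pi.add_apply]
      exact add_right_comm _ _ _
    · intro h
      have := congrFun h 0
      rw [addPhase, h0, zero_add] at this
      have h8 : phase ((1 / 8 : ℝ) : UnitAddCircle) = 1 := by
        rw [show ((1 / 8 : ℝ) : UnitAddCircle) = 0 from this, phase_zero]
      rw [phase_eighth] at h8
      have h9 := omega8_sq
      rw [h8] at h9
      have := congrArg Complex.re h9
      simp at this
  · exact key f hf h0

end SumData

namespace SumData

variable {n m k l : ℕ}

/-! ### Changes of variables -/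

theorem comap_comap {j : ℕ} (f : SumData n m k) (g : BVec l → BVec k) (h : BVec j → BVec l) :
    (f.comap g).comap h = f.comap fun x => g (h x) := by
  simp only [comap, Set.image_image]

theorem comap_congr (f : SumData n m k) {g h : BVec l → BVec k} (e : ∀ x, g x = h x) :
    f.comap g = f.comap h := congrArg f.comap (_root_.funext e)

theorem comap_id (f : SumData n m k) : f.comap (fun x => x) = f := by
  simp only [comap, Set.image_id']

theorem addPhase_comap (f : SumData n m k) (ψ : BVec k → UnitAddCircle) (g : BVec l → BVec k) :
    (f.addPhase ψ).comap g = (f.comap g).addPhase fun x => ψ (g x) := rfl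

theorem scale_comap (f : SumData n m k) (r : ℝ) (g : BVec l → BVec k) :
    (f.scale r).comap g = (f.comap g).scale r := rfl

theorem scale_scale (f : SumData n m k) (r r' : ℝ) (h : r * r' = 1) :
    (f.scale r').scale r = f := by
  simp only [scale, ← mul_assoc, h, one_mul]

theorem addPhase_add (f : SumData n m k) (ψ ψ' : BVec k → UnitAddCircle) :
    (f.addPhase ψ).addPhase ψ' = f.addPhase (ψ + ψ') := by
  simp only [addPhase, add_assoc]

theorem addPhase_zero (f : SumData n m k) : f.addPhase 0 = f := by
  simp only [addPhase, add_zero]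

variable {f : SumData n m k}

theorem IsCliff.scale_half (hf : f.IsCliff) : (f.scale (1 / 2)).IsCliff := by
  obtain ⟨p, hp⟩ := hf.scalar
  refine ⟨⟨p + 2, ?_⟩, hf.phase, hf.lin, hf.disc⟩
  rw [scale, hp, zpow_add₀ (by positivity), mul_comm]
  rw [one_div, inv_zpow' √2 2, zpow_neg]
  norm_num

/-- Two new variables are introduced by (HH) with the phase `x 0 * (x 1 + x 2 + A) / 2`, which is
symmetric in `x 1` and `x 2`. Eliminating `x 1` gives back `f` or its sheared form according to
whether `f` reads `x 2` or `x 1`, and the transposition of the two variables identifies the starting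
points. Both results carry the factor `2`, hence the passage through `f.scale (1 / 2)`. -/
theorem rel_shear_zero {f : SumData n m (k + 1)} (hf : f.IsCliff) {A : BVec k → ZMod 2}
    (hA : IsAff A) :
    Rel f (f.comap fun x => (Fin.cons (x 0 + A (Fin.tail x)) (Fin.tail x) : BVec (k + 1))) := by
  have key : ∀ f : SumData n m (k + 1), f.IsCliff → Rel (f.scale 2)
      ((f.comap fun x => (Fin.cons (x 0 + A (Fin.tail x)) (Fin.tail x) : BVec (k + 1))).scale 2) := by
    intro f hf
    have hq : IsAff fun w : BVec (k + 1) => w 0 + A (Fin.tail w) :=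
      (IsAff.coord 0).add (hA.comp AffMap.tail)
    have hz : AffMap fun w : BVec (k + 2) => (Fin.cons (w 0) (Fin.tail (Fin.tail w)) : BVec (k + 1)) :=
      AffMap.cons (AffMap.comp_fun (fun i : Fin k => i.succ.succ)) (IsAff.coord 0)
    have h1 := rel_hh (hf.comap hz) hq
    have h2 := rel_hh (hf.comap (AffMap.tail (k := k + 1))) hq
    have h3 := rel_perm h1.left (Equiv.swap 1 2)
    have e1 : ∀ x : BVec (k + 3), Fin.tail (Fin.tail (Fin.tail (x ∘ Equiv.swap 1 2))) =
        Fin.tail (Fin.tail (Fin.tail x)) := fun x => _root_.funext fun i => by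
      change x (Equiv.swap 1 2 i.succ.succ.succ) = x i.succ.succ.succ
      rw [Equiv.swap_apply_of_ne_of_ne]
      · intro h
        have := congrArg Fin.val h
        simp only [Fin.val_succ, Fin.val_one, Fin.val_zero] at this
        omega
      · intro h
        have := congrArg Fin.val h
        simp only [Fin.val_succ, Fin.val_two, Fin.val_zero] at this
        omega
    have e2 : ∀ x : BVec (k + 3), (x ∘ Equiv.swap 1 2) 1 = x 2 := fun x => by
      rw [Function.comp_apply, Equiv.swap_apply_left]
    have e3 : ∀ x : BVec (k + 3), (x ∘ Equiv.swap 1 2) 2 = x 1 := fun x => by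
      rw [Function.comp_apply, Equiv.swap_apply_right]
    have e4 : ∀ x : BVec (k + 3), (x ∘ Equiv.swap 1 2) 0 = x 0 := fun x => by
      rw [Function.comp_apply, Equiv.swap_apply_of_ne_of_ne]
      · intro h
        have := congrArg Fin.val h
        simp only [Fin.val_succ, Fin.val_one, Fin.val_zero] at this
        omega
      · intro h
        have := congrArg Fin.val h
        simp only [Fin.val_succ, Fin.val_two, Fin.val_zero] at this
        omega
    have e5 : ∀ x : BVec (k + 3), Fin.tail x 0 = x 1 := fun x => rfl
    have e6 : ∀ x : BVec (k + 3), Fin.tail (Fin.tail x) 0 = x 2 := fun x => rfl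
    rw [addPhase_comap, comap_comap, comap_comap] at h3
    simp only [e1, e2, e5, e6] at h3
    rw [comap_comap] at h1 h2
    simp only [comap_comap, Fin.cons_zero, Fin.tail_cons, comap_id, e6] at h1 h2
    refine h2.symm.trans (Rel.trans ?_ h1)
    simp only [e5]
    convert h3.symm using 2
    · exact comap_congr f fun x => (Fin.cons_self_tail (Fin.tail (Fin.tail x))).symm
    · refine _root_.funext fun x => ?_
      rw [frac, frac, e1, e2, e3, e4, add_left_comm]
  have := key _ hf.scale_half
  rwa [scale_comap, scale_scale _ _ _ (by norm_num), scale_scale _ _ _ (by norm_num)] at this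

theorem rel_shear (hf : f.IsCliff) (i : Fin k) {A : BVec k → ZMod 2} (hA : IsAff A)
    (hi : ∀ x b, A (Function.update x i b) = A x) :
    Rel f (f.comap fun x => Function.update x i (x i + A x)) := by
  obtain ⟨k, rfl⟩ : ∃ j, k = j + 1 := ⟨k - 1, by have := i.2; omega⟩
  have h0 := AffMap.cons (AffMap.id (k := k)) (IsAff.const 0)
  have h1 := rel_perm hf (Equiv.swap 0 i)
  have h2 := rel_shear_zero h1.right (A := fun w : BVec k =>
    A ((Fin.cons 0 w : BVec (k + 1)) ∘ Equiv.swap 0 i))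
    ((hA.comp (AffMap.comp_fun (Equiv.swap 0 i))).comp h0)
  have h3 := rel_perm h2.right (Equiv.swap 0 i)
  refine h1.trans (h2.trans (h3.trans ?_))
  rw [comap_comap, comap_comap]
  convert (hf.comap (AffMap.update (i := i) ((IsAff.coord i).add hA))).refl using 1
  refine comap_congr f fun x => _root_.funext fun j => ?_
  have e : (Fin.cons 0 (Fin.tail (x ∘ Equiv.swap 0 i)) : BVec (k + 1)) ∘ Equiv.swap 0 i =
      Function.update x i 0 := by
    refine _root_.funext fun j => ?_
    by_cases hj : j = i
    · subst hj
      simp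
    · rw [Function.update_of_ne hj]
      by_cases hj0 : j = 0
      · subst hj0
        obtain ⟨i', rfl⟩ := Fin.exists_succ_eq.2 (Ne.symm hj)
        simp [Fin.tail]
      · obtain ⟨j', rfl⟩ := Fin.exists_succ_eq.2 hj0
        simp [Equiv.swap_apply_of_ne_of_ne hj0 hj, Fin.tail]
  rw [e, hi]
  by_cases hj : j = i
  · subst hj
    simp
  · rw [Function.update_of_ne hj, Function.comp_apply]
    by_cases hj0 : j = 0
    · subst hj0
      obtain ⟨i', rfl⟩ := Fin.exists_succ_eq.2 (Ne.symm hj)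
      simp [Fin.tail]
    · obtain ⟨j', rfl⟩ := Fin.exists_succ_eq.2 hj0
      simp [Equiv.swap_apply_of_ne_of_ne hj0 hj, Fin.tail]

theorem rel_translate (hf : f.IsCliff) (b : BVec k) : Rel f (f.comap fun x => x + b) := by
  have key : ∀ S : Finset (Fin k), Rel f (f.comap fun x => x + ∑ i ∈ S, Pi.single i (b i)) := by
    intro S
    induction S using Finset.induction_on with
    | empty => simpa only [Finset.sum_empty, add_zero, comap_id] using hf.refl
    | insert i S hi ih =>
      refine ih.trans ?_
      convert rel_shear ih.right i (IsAff.const (b i)) (fun _ _ => rfl) using 1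
      rw [comap_comap]
      refine comap_congr f fun x => ?_
      rw [Finset.sum_insert hi, ← add_assoc]
      congr 1
      refine _root_.funext fun j => ?_
      by_cases hj : j = i
      · subst hj
        simp
      · simp [hj]
  have := key Finset.univ
  rwa [Finset.univ_sum_single] at this

/-- Over the field with two elements an invertible diagonal matrix is the identity, so invertible
matrices are products of transvections, and these are shears. -/
theorem rel_mulVec (M : Matrix (Fin k) (Fin k) (ZMod 2)) (hM : M.det ≠ 0) :
    ∀ f : SumData n m k, f.IsCliff → Rel f (f.comap M.mulVec) := by
  refine Matrix.diagonal_transvection_induction_of_det_ne_zero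
    (fun M => ∀ f : SumData n m k, f.IsCliff → Rel f (f.comap M.mulVec)) M hM ?_ ?_ ?_
  · intro D hD f hf
    have : D = fun _ => 1 := _root_.funext fun i => by
      rw [Matrix.det_diagonal, Finset.prod_ne_zero_iff] at hD
      exact (zmod2_cases _).resolve_left (hD i (Finset.mem_univ i))
    rw [this, Matrix.diagonal_one]
    convert hf.refl using 1
    conv_rhs => rw [← comap_id f]
    exact comap_congr f fun x => Matrix.one_mulVec x
  · intro t f hf
    have hA : IsAff fun x : BVec k => t.c * x t.j := fun x y => by
      simp [mul_add]
    convert rel_shear hf t.i hA ?_ using 1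
    · refine comap_congr f fun x => ?_
      rw [Matrix.TransvectionStruct.toMatrix, Matrix.transvection, Matrix.add_mulVec, Matrix.one_mulVec]
      refine _root_.funext fun j => ?_
      by_cases hj : j = t.i
      · subst hj
        simp [Matrix.single_mulVec]
      · simp [Matrix.single_mulVec, hj]
    · intro x b
      rw [Function.update_of_ne t.hij.symm]
  · intro A B _ _ hA hB f hf
    refine (hA f hf).trans ?_
    convert hB _ (hA f hf).right using 1
    rw [comap_comap]
    exact comap_congr f fun x => (Matrix.mulVec_mulVec x A B).symm

theorem rel_comap (hf : f.IsCliff) {τ : BVec k → BVec k} (hτ : AffMap τ)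
    (hinj : Function.Injective τ) : Rel f (f.comap τ) := by
  let M : Matrix (Fin k) (Fin k) (ZMod 2) := Matrix.of fun i j => τ (Pi.single j 1) i + τ 0 i
  have hM : ∀ x, τ x = M.mulVec x + τ 0 := fun x => _root_.funext fun i => by
    rw [Pi.add_apply, add_comm]
    exact (hτ i).expand x
  have hdet : M.det ≠ 0 := by
    have : Function.Injective M.mulVec := fun x y h => hinj (by rw [hM, hM y, h])
    rw [Matrix.mulVec_injective_iff_isUnit, Matrix.isUnit_iff_isUnit_det] at this
    exact this.ne_zero
  refine (rel_translate hf (τ 0)).trans ?_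
  convert rel_mulVec M hdet _ (rel_translate hf (τ 0)).right using 1
  rw [comap_comap]
  exact comap_congr f hM

/-! ### Changes of the discarded functions -/

/-- Up to constants `e` is a linear form vanishing on the common kernel of the discarded forms, so
by duality it lies in their span. The rule `⊕_!` subtracts the summands one by one, and the constant
that is left is dropped. -/
theorem rel_addDisc (hf : f.IsCliff) {e : BVec k → ZMod 2} (he : IsAff e)
    (h : ∀ x x', f.SameDisc x x' → e x = e x') : Rel (f.addDisc e) f := by
  let lin (A : BVec k → ZMod 2) (hA : IsAff A) : BVec k →ₗ[ZMod 2] ZMod 2 :=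
    AddMonoidHom.toZModLinearMap 2
      { toFun := fun x => A x + A 0
        map_zero' := two_self _
        map_add' := fun x y => by rw [hA]; ring }
  have hlin : ∀ A hA x, lin A hA x = A x + A 0 := fun A hA x => rfl
  have : Finite f.D := f.D.toFinite
  have : Fintype f.D := Fintype.ofFinite _
  have hadd0 : ∀ a b : ZMod 2, a + b = 0 → a = b := by decide
  have hspan : lin e he ∈ Submodule.span (ZMod 2)
      (Set.range fun d : f.D => lin d.1 (hf.disc d.1 d.2)) := by
    refine mem_span_of_iInf_ker_le_ker fun v hv => ?_
    rw [Submodule.mem_iInf] at hv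
    rw [LinearMap.mem_ker, hlin e he, h v 0 fun d hd => hadd0 _ _ (hv ⟨d, hd⟩), two_self]
  have key : ∀ K ∈ Submodule.span (ZMod 2) (Set.range fun d : f.D => lin d.1 (hf.disc d.1 d.2)),
      ∀ d, IsAff d → Rel (f.addDisc fun x => K x + d x) (f.addDisc d) := by
    intro K hK
    have hone : ∀ (c : ZMod 2) (d : BVec k → ZMod 2), IsAff d →
        Rel (f.addDisc fun x => c + d x) (f.addDisc d) := fun c d hd => by
      rcases zmod2_cases c with rfl | rfl
      · simpa only [zero_add] using (hf.addDisc hd).refl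
      · exact rel_xorGround hf (.inr rfl) hd
    induction hK using Submodule.span_induction with
    | mem K hK =>
      obtain ⟨a, rfl⟩ := hK
      intro d hd
      simp only [hlin, add_assoc]
      exact (rel_xorGround hf (.inl a.2) ((IsAff.const _).add hd)).trans (hone _ d hd)
    | zero =>
      intro d hd
      simpa only [LinearMap.zero_apply, zero_add] using (hf.addDisc hd).refl
    | add K K' _ _ hK hK' =>
      intro d hd
      have h1 := hK' d hd
      simp only [LinearMap.add_apply, add_assoc]
      refine (hK _ ?_).trans h1
      exact h1.left.disc _ (Set.mem_insert _ _)
    | smul c K _ hK =>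
      intro d hd
      rcases zmod2_cases c with rfl | rfl
      · simpa only [zero_smul, LinearMap.zero_apply, zero_add] using (hf.addDisc hd).refl
      · simpa only [one_smul] using hK d hd
  have h1 := key _ hspan (fun _ => e 0) (IsAff.const _)
  simp only [hlin, add_assoc, two_self, add_zero] at h1
  exact h1.trans (rel_cstGround hf (e 0))

/-- Both sets of discards are compared with their union, which is obtained from either of them by
adding functions already determined by it. -/
theorem rel_disc_congr (hf : f.IsCliff) {D : Set (BVec k → ZMod 2)} (hD : ∀ d ∈ D, IsAff d)
    (h : ∀ x x', f.SameDisc x x' ↔ ∀ d ∈ D, d x = d x') : Rel f ⟨f.s, f.φ, f.L, D⟩ := by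
  have key : ∀ f : SumData n m k, f.IsCliff → ∀ S : Set (BVec k → ZMod 2), (∀ d ∈ S, IsAff d) →
      (∀ x x', f.SameDisc x x' → ∀ d ∈ S, d x = d x') → Rel ⟨f.s, f.φ, f.L, S ∪ f.D⟩ f := by
    intro f hf S
    refine Set.Finite.induction_on _ S.toFinite (fun _ _ => ?_) fun {a S} _ _ ih hS hinv => ?_
    · rw [Set.empty_union]
      exact hf.refl
    · have h1 := ih (fun d hd => hS d (Set.mem_insert_of_mem _ hd))
        fun x x' hx d hd => hinv x x' hx d (Set.mem_insert_of_mem _ hd)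
      refine Rel.trans ?_ h1
      rw [Set.insert_union]
      refine rel_addDisc h1.left (hS a (Set.mem_insert _ _)) fun x x' hx => ?_
      exact hinv x x' (fun d hd => hx d (Or.inr hd)) a (Set.mem_insert _ _)
  have h1 := key f hf D hD fun x x' => (h x x').1
  have hg : (⟨f.s, f.φ, f.L, D⟩ : SumData n m k).IsCliff := ⟨hf.scalar, hf.phase, hf.lin, hD⟩
  have h2 := key _ hg f.D hf.disc fun x x' => (h x x').2
  rw [Set.union_comm] at h2
  exact h1.symm.trans h2

/-- The factors are temporarily added to the discards, which changes nothing, so that `Z_!` applies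
to their product. -/
theorem rel_addPhase (hf : f.IsCliff) (r : ℝ) {A B : BVec k → ZMod 2} (hA : IsAff A) (hB : IsAff B)
    (hq : frac r (fun x => A x * B x) ∈ quadPhases k) (hA' : ∀ x x', f.SameDisc x x' → A x = A x')
    (hB' : ∀ x x', f.SameDisc x x' → B x = B x') :
    Rel (f.addPhase (frac r fun x => A x * B x)) f := by
  have key : ∀ f : SumData n m k, f.IsCliff → (∀ x x', f.SameDisc x x' → A x = A x') →
      (∀ x x', f.SameDisc x x' → B x = B x') → Rel ((f.addDisc A).addDisc B) f := by
    intro f hf hA' hB'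
    have h1 := rel_addDisc hf hA hA'
    refine (rel_addDisc h1.left hB fun x x' hx => hB' x x' fun d hd => ?_).trans h1
    exact hx d (Set.mem_insert_of_mem _ hd)
  have h1 := key f hf hA' hB'
  refine (key (f.addPhase _) (hf.addPhase hq) hA' hB').symm.trans (Rel.trans ?_ h1)
  exact rel_zGround h1.left r (Set.mem_insert_of_mem _ (Set.mem_insert _ _)) (Set.mem_insert _ _) hq

end SumData

/-! ### Dependence of affine functions and quadratic phases on one variable -/

section split

variable {k : ℕ}

theorem IsAff.split {A : BVec (k + 1) → ZMod 2} (hA : IsAff A) :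
    ∃ c : ZMod 2, ∀ x, A x = c * x 0 + A (Fin.cons 0 (Fin.tail x)) := by
  refine ⟨A (Pi.single 0 1) + A 0, fun x => ?_⟩
  have h : x = Pi.single 0 (x 0) + (Fin.cons 0 (Fin.tail x) : BVec (k + 1)) :=
    _root_.funext fun i => by
      refine Fin.cases ?_ (fun i => ?_) i <;> simp [Fin.tail]
  conv_lhs => rw [h, hA]
  rcases zmod2_cases (x 0) with e | e <;> rw [e]
  · rw [Pi.single_zero]
    linear_combination two_self (A 0)
  · ring

theorem frac_zero_fun (r : ℝ) : frac r (fun _ : BVec k => (0 : ZMod 2)) = 0 :=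
  _root_.funext fun x => by
    rw [frac, bit01_zero, mul_zero, AddCircle.coe_zero]
    rfl

/-- Expansion in the variable `0`: on bits `x 0 ^ 2 = x 0`, so a quadratic phase is its restriction
to `x 0 = 0` plus a number of quarters of `x 0` plus half of `x 0` times an affine function of the
others. -/
theorem quad_split_int {φ : BVec (k + 1) → UnitAddCircle} (h : φ ∈ quadPhases (k + 1)) :
    ∃ (z : ℤ) (q : BVec k → ZMod 2), IsAff q ∧
      φ = (fun x => φ (Fin.cons 0 (Fin.tail x))) + (z • frac (1 / 4) (fun x => x 0) +
        frac (1 / 2) fun x => x 0 * q (Fin.tail x)) := by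
  have hc : AffMap fun x : BVec k => (Fin.cons 0 x : BVec (k + 1)) :=
    AffMap.cons AffMap.id (IsAff.const 0)
  induction h using AddSubgroup.closure_induction with
  | mem φ h =>
    cases h with
    | const =>
      refine ⟨0, fun _ => 0, IsAff.const 0, ?_⟩
      simp only [mul_zero, frac_zero_fun, zero_smul, add_zero]
    | lin A hA =>
      obtain ⟨c, h⟩ := hA.split
      rcases zmod2_cases c with rfl | rfl
      · refine ⟨0, fun _ => 0, IsAff.const 0, ?_⟩
        simp only [mul_zero, frac_zero_fun, zero_smul, add_zero]
        refine _root_.funext fun x => ?_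
        rw [frac, frac, h x, zero_mul, zero_add]
      · refine ⟨1, fun x => A (Fin.cons 0 x), hA.comp hc, ?_⟩
        have e : A = fun x => x 0 + A (Fin.cons 0 (Fin.tail x)) :=
          _root_.funext fun x => by rw [h x, one_mul]
        conv_lhs => rw [e]
        rw [frac_quarter_add, sub_eq_add_neg, frac_half_neg, one_smul]
        change _ = frac (1 / 4) (fun x => A (Fin.cons 0 (Fin.tail x))) + _
        abel
    | quad A B hA hB =>
      obtain ⟨a, h⟩ := hA.split
      obtain ⟨b, h'⟩ := hB.split
      refine ⟨0, fun x => a * b + (a * B (Fin.cons 0 x) + b * A (Fin.cons 0 x)), ?_, ?_⟩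
      · have hmul : ∀ (c : ZMod 2) {A : BVec k → ZMod 2}, IsAff A → IsAff fun x => c * A x := by
          intro c A hA
          rcases zmod2_cases c with rfl | rfl
          · simpa only [zero_mul] using IsAff.const 0
          · simpa only [one_mul] using hA
        exact (IsAff.const _).add ((hmul a (hB.comp hc)).add (hmul b (hA.comp hc)))
      · rw [zero_smul, zero_add]
        have e : (fun x => A x * B x) = fun x => A (Fin.cons 0 (Fin.tail x)) * B (Fin.cons 0 (Fin.tail x)) +
            x 0 * (a * b + (a * B (Fin.cons 0 (Fin.tail x)) + b * A (Fin.cons 0 (Fin.tail x)))) :=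
          _root_.funext fun x => by
            have h2 : x 0 * x 0 = x 0 := by rcases zmod2_cases (x 0) with e | e <;> rw [e] <;> rfl
            rw [h x, h' x]
            linear_combination a * b * h2
        conv_lhs => rw [e]
        rw [frac_half_add]
        rfl
  | zero =>
    refine ⟨0, fun _ => 0, IsAff.const 0, ?_⟩
    simp only [mul_zero, frac_zero_fun, zero_smul, add_zero]
    rfl
  | add φ ψ _ _ h h' =>
    obtain ⟨z, q, hq, h⟩ := h
    obtain ⟨z', q', hq', h'⟩ := h'
    refine ⟨z + z', fun x => q x + q' x, hq.add hq', ?_⟩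
    conv_lhs => rw [h, h']
    simp only [mul_add]
    rw [frac_half_add, add_smul]
    have : (fun x : BVec (k + 1) => (φ + ψ) (Fin.cons 0 (Fin.tail x))) =
      (fun x => φ (Fin.cons 0 (Fin.tail x))) + fun x => ψ (Fin.cons 0 (Fin.tail x)) := rfl
    rw [this]
    abel
  | neg φ _ h =>
    obtain ⟨z, q, hq, h⟩ := h
    refine ⟨-z, q, hq, ?_⟩
    conv_lhs => rw [h, ← frac_half_neg]
    have : (fun x : BVec (k + 1) => (-φ) (Fin.cons 0 (Fin.tail x))) =
      -fun x => φ (Fin.cons 0 (Fin.tail x)) := rfl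
    rw [this, neg_smul]
    abel

/-- An even number of quarters is a half-integer coefficient and is absorbed into `q`. The parity
separates the shapes suited to (Elim), (HH) and (Z) from the one suited to (ω). -/
theorem quad_split {φ : BVec (k + 1) → UnitAddCircle} (h : φ ∈ quadPhases (k + 1)) :
    ∃ q : BVec k → ZMod 2, IsAff q ∧
      (φ = (fun x => φ (Fin.cons 0 (Fin.tail x))) + (frac (1 / 2) fun x => x 0 * q (Fin.tail x)) ∨
      φ = (fun x => φ (Fin.cons 0 (Fin.tail x))) + (frac (1 / 4) (fun x => x 0) +
        frac (1 / 2) fun x => x 0 * q (Fin.tail x))) := by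
  obtain ⟨z, q, hq, h⟩ := quad_split_int h
  have h2 : ∀ w : ℤ, w • frac (1 / 2) (fun x : BVec (k + 1) => x 0) =
      frac (1 / 2) fun x => x 0 * (w : ZMod 2) := by
    intro w
    rcases Int.even_or_odd' w with ⟨v, rfl | rfl⟩
    · have : ((2 * v : ℤ) : ZMod 2) = 0 := by push_cast; rw [show (2 : ZMod 2) = 0 from rfl, zero_mul]
      simp only [this, mul_zero, frac_zero_fun]
      rw [mul_comm, mul_smul, two_zsmul, frac_half_two, smul_zero]
    · have : ((2 * v + 1 : ℤ) : ZMod 2) = 1 := by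
        push_cast; rw [show (2 : ZMod 2) = 0 from rfl, zero_mul, zero_add]
      simp only [this, mul_one]
      rw [add_smul, mul_comm, mul_smul, two_zsmul, frac_half_two, smul_zero, zero_add, one_smul]
  have h4 : ∀ w : ℤ, (2 * w) • frac (1 / 4) (fun x : BVec (k + 1) => x 0) =
      frac (1 / 2) fun x => x 0 * (w : ZMod 2) := by
    intro w
    rw [← h2, mul_comm, mul_smul, two_zsmul, ← frac_add_left]
    norm_num
  rcases Int.even_or_odd' z with ⟨w, rfl | rfl⟩
  · refine ⟨fun x => w + q x, (IsAff.const _).add hq, .inl ?_⟩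
    simp only [mul_add]
    rwa [frac_half_add, ← h4]
  · refine ⟨fun x => w + q x, (IsAff.const _).add hq, .inr ?_⟩
    simp only [mul_add]
    rw [frac_half_add, ← h4]
    conv_lhs => rw [h, add_smul, one_smul]
    abel

end split

namespace SumData

variable {n m k l : ℕ}

/-! ### Normal forms -/

/-- Since `x 0` itself is discarded, the other discards can be freed of it, and a phase `x 0 / 4` is
removed by `Z_!`. What remains is the pattern of `H_!`, which removes the variable. -/
theorem exists_rel_of_disc {f : SumData n m (k + 1)} (hf : f.IsCliff)
    (hL : ∀ i x, f.L i x = f.L i (Fin.cons 0 (Fin.tail x))) (h0 : (fun x => x 0) ∈ f.D) :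
    ∃ g : SumData n m k, Rel f g := by
  have hc : AffMap fun x : BVec k => (Fin.cons 0 x : BVec (k + 1)) :=
    AffMap.cons AffMap.id (IsAff.const 0)
  have hct : AffMap fun x : BVec (k + 1) => (Fin.cons 0 (Fin.tail x) : BVec (k + 1)) :=
    AffMap.cons AffMap.tail (IsAff.const 0)
  have hf0 := hf.comap hc
  obtain ⟨q, hq, hφ⟩ := quad_split hf.phase
  have h1 : Rel f ⟨f.s, f.φ, f.L, insert (fun x => x 0)
      ((fun d (x : BVec (k + 1)) => d (Fin.cons 0 (Fin.tail x))) '' f.D)⟩ := by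
    refine rel_disc_congr hf ?_ fun x x' => ?_
    · rw [Set.forall_mem_insert, Set.forall_mem_image]
      exact ⟨IsAff.coord 0, fun d hd => (hf.disc d hd).comp hct⟩
    · rw [Set.forall_mem_insert, Set.forall_mem_image]
      constructor
      · intro h
        refine ⟨h _ h0, fun d hd => ?_⟩
        obtain ⟨c, hc⟩ := (hf.disc d hd).split
        have h2 := h d hd
        rw [hc x, hc x', show x 0 = x' 0 from h _ h0] at h2
        exact add_left_cancel h2
      · rintro ⟨h2, h3⟩ d hd
        obtain ⟨c, hc⟩ := (hf.disc d hd).split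
        rw [hc x, hc x', show x 0 = x' 0 from h2, show d _ = d _ from h3 hd]
  have hg := rel_hGround hf0 hq
  have e : ∀ ψ, (⟨f.s, (fun x => f.φ (Fin.cons 0 (Fin.tail x))) + ψ, f.L, insert (fun x => x 0)
      ((fun d (x : BVec (k + 1)) => d (Fin.cons 0 (Fin.tail x))) '' f.D)⟩ : SumData n m (k + 1)) =
      (((f.comap fun x => (Fin.cons 0 x : BVec (k + 1))).comap Fin.tail).addDisc
        (fun x => x 0)).addPhase ψ := by
    intro ψ
    rw [comap_comap]
    simp only [addPhase, addDisc, comap, SumData.mk.injEq, true_and, and_true]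
    exact _root_.funext fun i => _root_.funext fun x => hL i x
  rcases hφ with hφ | hφ
  · rw [hφ, e] at h1
    exact ⟨_, h1.trans hg⟩
  · rw [hφ, e, add_comm (frac _ _), ← addPhase_add] at h1
    refine ⟨_, (h1.trans ?_).trans hg⟩
    have h2 : ∀ x : BVec (k + 1), x 0 * x 0 = x 0 := fun x => by
      rcases zmod2_cases (x 0) with e | e <;> rw [e] <;> rfl
    have h3 := rel_addPhase hg.left (1 / 4) (IsAff.coord 0) (IsAff.coord 0)
      (by simpa only [h2] using (QuadGen.lin _ (IsAff.coord 0)).mem)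
      (fun x x' h => h _ (Set.mem_insert _ _)) (fun x x' h => h _ (Set.mem_insert _ _))
    simpa only [h2] using h3

/-- If `q` is constant, its value decides between (Elim) and (Z). Otherwise `q` contains a variable;
a transposition moves it next to `x 0`, and (HH) removes both. -/
theorem exists_rel_of_phase {f : SumData n m k} (hf : f.IsCliff) {q : BVec k → ZMod 2}
    (hq : IsAff q) :
    Rel ((f.comap Fin.tail).addPhase (frac (1 / 2) fun x => x 0 * q (Fin.tail x))) (zeroData n m) ∨
      ∃ j ≤ k, ∃ g : SumData n m j,
        Rel ((f.comap Fin.tail).addPhase (frac (1 / 2) fun x => x 0 * q (Fin.tail x))) g := by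
  by_cases hconst : ∀ i, q (Pi.single i 1) + q 0 = 0
  · have hq0 : ∀ x, q x = q 0 := fun x => by
      rw [hq.expand x]
      simp [hconst]
    have hq0' : ∀ x : BVec (k + 1), q (Fin.tail x) = q 0 := fun x => hq0 _
    rcases zmod2_cases (q 0) with e | e
    · refine .inr ⟨k, le_rfl, f.scale 2, ?_⟩
      simp only [hq0', e, mul_zero, frac_zero_fun]
      rw [addPhase_zero]
      exact rel_elim hf
    · left
      simp only [hq0', e, mul_one]
      exact rel_zero hf
  · push Not at hconst
    obtain ⟨i, hi⟩ := hconst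
    obtain ⟨k, rfl⟩ : ∃ j, k = j + 1 := ⟨k - 1, by have := i.2; omega⟩
    let π := Equiv.swap 0 i
    have hτ : AffMap fun x : BVec (k + 2) => (Fin.cons (x 0) (Fin.tail x ∘ π) : BVec (k + 2)) :=
      AffMap.cons (AffMap.comp_fun (fun j : Fin (k + 1) => (π j).succ)) (IsAff.coord 0)
    have hinj : Function.Injective fun x : BVec (k + 2) =>
        (Fin.cons (x 0) (Fin.tail x ∘ π) : BVec (k + 2)) := by
      intro x y h
      obtain ⟨h1, h2⟩ := Fin.cons_injective2 h
      have h3 : Fin.tail x = Fin.tail y := _root_.funext fun j => by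
        have := congrFun h2 (π j)
        simpa [π] using this
      rw [← Fin.cons_self_tail x, ← Fin.cons_self_tail y, h1, h3]
    have hq' : IsAff fun x : BVec (k + 1) => q (x ∘ π) := hq.comp (AffMap.comp_fun π)
    have h0 : ((f.comap Fin.tail).addPhase
        (frac (1 / 2) fun x => x 0 * q (Fin.tail x))).IsCliff :=
      (hf.comap AffMap.tail).addPhase
        (QuadGen.quad _ _ (IsAff.coord 0) (hq.comp AffMap.tail)).mem
    have h1 := rel_comap h0 hτ hinj
    have h2 := rel_hh (hf.comap (AffMap.comp_fun π)) (hq'.comp (AffMap.cons AffMap.id (IsAff.const 0)))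
    have e : ((f.comap Fin.tail).addPhase (frac (1 / 2) fun x => x 0 * q (Fin.tail x))).comap
        (fun x : BVec (k + 2) => (Fin.cons (x 0) (Fin.tail x ∘ π) : BVec (k + 2))) =
        ((f.comap fun x => x ∘ π).comap Fin.tail).addPhase (frac (1 / 2) fun x : BVec (k + 2) =>
          x 0 * (x 1 + q ((Fin.cons 0 (Fin.tail (Fin.tail x)) : BVec (k + 1)) ∘ π))) := by
      rw [addPhase_comap, comap_comap, comap_comap]
      change addPhase _ _ = addPhase _ _
      congr 1
      refine _root_.funext fun x => ?_
      obtain ⟨c, hc⟩ := hq'.split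
      have hc1 : c = 1 := by
        have e1 := hc (Pi.single 0 1)
        have e2 : (Pi.single 0 1 : BVec (k + 1)) ∘ π = Pi.single i 1 := by
          refine _root_.funext fun j => ?_
          by_cases hj : j = i
          · subst hj
            simp [π]
          · by_cases hj0 : j = 0
            · subst hj0
              simp [π, Ne.symm hj, hj]
            · simp [π, Equiv.swap_apply_of_ne_of_ne hj0 hj, hj, hj0]
        have e3 : (Fin.cons 0 (Fin.tail (Pi.single 0 1 : BVec (k + 1))) : BVec (k + 1)) ∘ π = 0 := by
          refine _root_.funext fun j => ?_
          rw [Function.comp_apply]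
          refine Fin.cases ?_ (fun j => ?_) (π j) <;> simp [Fin.tail]
        rw [e2, e3, Pi.single_eq_same, mul_one] at e1
        rw [e1, add_assoc, two_self, add_zero] at hi
        exact (zmod2_cases c).resolve_left hi
      rw [frac, frac, Fin.cons_zero, Fin.tail_cons, hc, hc1, one_mul]
      rfl
    rw [e] at h1
    exact .inr ⟨k, Nat.le_succ k, _, h1.trans h2⟩

/-- A variable invisible to ket and bra either occurs in no discard, and then the shape of the phase
selects a rule, or it occurs in some discard, which a shear turns into the variable itself. -/
theorem exists_rel {f : SumData n m (k + 1)} (hf : f.IsCliff)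
    (hL : ∀ i x, f.L i x = f.L i (Fin.cons 0 (Fin.tail x))) :
    Rel f (zeroData n m) ∨ ∃ j ≤ k, ∃ g : SumData n m j, Rel f g := by
  have hc : AffMap fun x : BVec k => (Fin.cons 0 x : BVec (k + 1)) :=
    AffMap.cons AffMap.id (IsAff.const 0)
  have hf0 := hf.comap hc
  by_cases hD : ∀ d ∈ f.D, ∀ x, d x = d (Fin.cons 0 (Fin.tail x))
  · obtain ⟨q, hq, hφ⟩ := quad_split hf.phase
    have e : ∀ ψ, f.φ = (fun x => f.φ (Fin.cons 0 (Fin.tail x))) + ψ →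
        f = ((f.comap fun x => (Fin.cons 0 x : BVec (k + 1))).comap Fin.tail).addPhase ψ := by
      intro ψ hψ
      rw [comap_comap]
      ext1
      · rfl
      · exact hψ
      · exact _root_.funext fun i => _root_.funext fun x => hL i x
      · refine (Set.image_id' _).symm.trans (Set.image_congr fun d hd => _root_.funext fun x => ?_)
        exact hD d hd x
    rcases hφ with hφ | hφ
    · rw [e _ hφ]
      exact exists_rel_of_phase hf0 hq
    · rw [e _ hφ]
      exact .inr ⟨k, le_rfl, _, rel_omega hf0 hq⟩
  · push Not at hD
    obtain ⟨d, hd, x, hx⟩ := hD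
    obtain ⟨c, h⟩ := (hf.disc d hd).split
    have hc1 : c = 1 := by
      rcases zmod2_cases c with rfl | rfl
      · exact absurd (by rw [h x, zero_mul, zero_add]) hx
      · rfl
    subst hc1
    let A : BVec k → ZMod 2 := fun x => d (Fin.cons 0 x)
    have hA : IsAff A := (hf.disc d hd).comp hc
    have h1 := rel_shear_zero hf hA
    suffices h2 : ∃ g : SumData n m k, Rel _ g by
      obtain ⟨g, hg⟩ := h2
      exact .inr ⟨k, le_rfl, g, h1.trans hg⟩
    refine exists_rel_of_disc h1.right (fun i x => ?_) ⟨d, hd, _root_.funext fun x => ?_⟩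
    · have h2 : ∀ b y, f.L i (Fin.cons b y) = f.L i (Fin.cons 0 y) := fun b y => by
        rw [hL, Fin.tail_cons]
      exact (h2 _ _).trans (h2 _ _).symm
    · dsimp only
      rw [h, Fin.cons_zero, Fin.tail_cons, one_mul]
      change x 0 + A (Fin.tail x) + A (Fin.tail x) = x 0
      rw [add_assoc, two_self, add_zero]

/-- Every sum is zero or has jointly injective ket and bra functions, up to the rules. -/
theorem exists_normalForm : ∀ (k : ℕ) (f : SumData n m k), f.IsCliff →
    Rel f (zeroData n m) ∨ ∃ j, ∃ g : SumData n m j, Rel f g ∧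
      Function.Injective fun x i => g.L i x := by
  intro k
  induction k using Nat.strong_induction_on with
  | _ k ih =>
    intro f hf
    by_cases hinj : Function.Injective fun x i => f.L i x
    · exact .inr ⟨k, f, hf.refl, hinj⟩
    · simp only [Function.Injective, not_forall] at hinj
      obtain ⟨a, b, hab, hne⟩ := hinj
      obtain ⟨i, hi⟩ : ∃ i, (a + b) i ≠ 0 := by
        by_contra! h
        refine hne (_root_.funext fun i => ?_)
        have := h i
        revert this
        rw [Pi.add_apply]
        generalize a i = u
        generalize b i = v
        revert u v
        decide
      have hi1 : (a + b) i = 1 := (zmod2_cases _).resolve_left hi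
      obtain ⟨k, rfl⟩ : ∃ j, k = j + 1 := ⟨k - 1, by have := i.2; omega⟩
      set v := a + b with hv
      -- `v` is the difference of two assignments that ket and bra do not separate; by affinity they
      -- are invariant under all translations by `v`.
      have hvL : ∀ j x, f.L j (x + v) = f.L j x := fun j x => by
        have h1 : f.L j a = f.L j b := congrFun hab j
        rw [hf.lin j, hv, hf.lin j a, h1]
        linear_combination two_self (f.L j b) + two_self (f.L j 0)
      -- In the new coordinates the variable `0` moves along `v`. The others fill the positions
      -- different from `i`; since `v i = 1`, the map is injective.
      let τ : BVec (k + 1) → BVec (k + 1) := fun x =>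
        (i.insertNth 0 (Fin.tail x) : BVec (k + 1)) + x 0 • v
      have hτi : ∀ x, τ x i = x 0 := fun x => by simp [τ, hi1]
      have hτ : AffMap τ := fun j => by
        refine Fin.succAboveCases i ?_ (fun j => ?_) j
        · simp only [hτi]
          exact IsAff.coord 0
        · intro x y
          simp [τ, Fin.tail]
          ring
      have hinj : Function.Injective τ := fun x y h => by
        have h0 : x 0 = y 0 := by rw [← hτi x, h, hτi]
        have h1 : (i.insertNth 0 (Fin.tail x) : BVec (k + 1)) = i.insertNth 0 (Fin.tail y) := by
          have h' : (i.insertNth 0 (Fin.tail x) : BVec (k + 1)) + x 0 • v =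
            (i.insertNth 0 (Fin.tail y) : BVec (k + 1)) + y 0 • v := h
          rw [h0] at h'
          exact add_right_cancel h'
        have h2 : Fin.tail x = Fin.tail y := _root_.funext fun j => by
          simpa using congrFun h1 (i.succAbove j)
        rw [← Fin.cons_self_tail x, ← Fin.cons_self_tail y, h0, h2]
      have h1 := rel_comap hf hτ hinj
      have hind : ∀ j x, (f.comap τ).L j x = (f.comap τ).L j (Fin.cons 0 (Fin.tail x)) := by
        intro j x
        change f.L j (_ + x 0 • v) = f.L j (_ + _ • v)
        rw [Fin.cons_zero, zero_smul, add_zero, Fin.tail_cons]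
        rcases zmod2_cases (x 0) with e | e <;> rw [e]
        · rw [zero_smul, add_zero]
        · rw [one_smul, hvL]
      rcases exists_rel h1.right hind with h2 | ⟨j, hj, g, hg⟩
      · exact .inl (h1.trans h2)
      · rcases ih j (by omega) g hg.right with h3 | ⟨j', g', h3, h4⟩
        · exact .inl (h1.trans (hg.trans h3))
        · exact .inr ⟨j', g', h1.trans (hg.trans h3), h4⟩

end SumData

namespace SumData

variable {n m k l : ℕ}

/-! ### Uniqueness of normal forms -/

theorem Reps.den_eq {f : SumData n m k} {P : PhasePoly k} {O : Fin m → BoolPoly k}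
    {D : Finset (BoolPoly k)} {I : Fin n → BoolPoly k} (h : f.Reps P O D I) :
    (⟨k, f.s, P, O, D, I⟩ : SOPTerm n m).den = f := by
  ext1
  · rfl
  · exact _root_.funext h.phase
  · refine _root_.funext fun i => ?_
    rcases i with i | i
    exacts [h.ket i, h.bra i]
  · exact h.disc

/-- The interpretation of a morphism. -/
noncomputable def quotSem : CliffQuot n m → (Fin m ⊕ Fin n → ZMod 2) → (Fin m ⊕ Fin n → ZMod 2) → ℂ :=
  Quot.lift (fun t => t.1.den.sem) fun t t' h => sound t.1 t'.1 h t.2.disc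

theorem HasClass.sem_eq {f : SumData n m k} {q : CliffQuot n m} (h : f.HasClass q) :
    f.sem = quotSem q := by
  obtain ⟨P, O, D, I, h, hr, rfl⟩ := h
  exact congrArg sem hr.den_eq.symm

theorem Rel.sem_eq {f : SumData n m k} {g : SumData n m l} (h : Rel f g) : f.sem = g.sem := by
  obtain ⟨q, h₁, h₂⟩ := h
  rw [h₁.sem_eq, h₂.sem_eq]

theorem weight_zeroData (x : BVec 1) : (zeroData n m).weight x = if x 0 = 0 then 1 else -1 := by
  simp only [weight, zeroData, frac, phase_mul_bit01, phase_half, Complex.ofReal_one, one_mul]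

theorem sem_zeroData : (zeroData n m).sem = 0 := by
  have h1 : (zeroData n m).sem = cpEntry (zeroData n m).weight
      (fun (_ : BVec (0 + 1)) (_ : Fin m ⊕ Fin n) => (0 : ZMod 2)) (fun _ _ => True) :=
    cpEntry_congr (fun _ => rfl) (fun _ => rfl) fun _ _ => iff_of_true (fun _ h => h.elim) trivial
  have h2 : cpEntry (zeroData n m).weight
      (fun (_ : BVec (0 + 1)) (_ : Fin m ⊕ Fin n) => (0 : ZMod 2)) (fun _ _ => True) =
      cpEntry (fun _ : BVec 0 => 0) (fun (_ : BVec 0) (_ : Fin m ⊕ Fin n) => (0 : ZMod 2))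
        (fun _ _ => True) := by
    refine cpEntry_tail (fun _ => rfl) (fun _ _ => Iff.rfl) fun x => ?_
    refine Eq.trans ?_ (congrArg₂ (· + ·) (weight_zeroData _).symm (weight_zeroData _).symm)
    rw [Fin.cons_zero, Fin.cons_zero, if_pos rfl, if_neg one_ne_zero]
    exact (add_neg_cancel 1).symm
  exact h1.trans (h2.trans (cpEntry_zero _ _))

theorem sameDisc_refl (f : SumData n m k) (x : BVec k) : f.SameDisc x x := fun _ _ => rfl

open Classical in
-- A single pair of assignments contributes, so the matrix displays the relation `SameDisc` and the
-- weights up to a common phase on each class.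
theorem sem_of_injective {f : SumData n m k} (hinj : Function.Injective fun x i => f.L i x)
    (x x' : BVec k) : f.sem (fun i => f.L i x) (fun i => f.L i x') =
      if f.SameDisc x x' then f.weight x * (starRingEnd ℂ) (f.weight x') else 0 := by
  rw [sem, cpEntry, Finset.sum_eq_single x, Finset.sum_eq_single x']
  · simp
  · intro y _ hy
    rw [if_neg]
    exact fun h => hy (hinj h.2.1)
  · simp
  · intro y _ hy
    refine Finset.sum_eq_zero fun z _ => ?_
    rw [if_neg]
    exact fun h => hy (hinj h.1)
  · simp

theorem sem_eq_zero_of_notMem {f : SumData n m k} {a b : Fin m ⊕ Fin n → ZMod 2}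
    (h : ∀ x, (fun i => f.L i x) ≠ a) : f.sem a b = 0 := by
  refine Finset.sum_eq_zero fun y _ => Finset.sum_eq_zero fun z _ => ?_
  rw [if_neg]
  exact fun h' => h y h'.1

theorem IsCliff.scalar_pos {f : SumData n m k} (hf : f.IsCliff) : 0 < f.s := by
  obtain ⟨p, hp⟩ := hf.scalar
  rw [hp]
  positivity

theorem weight_mul_conj (f : SumData n m k) (x x' : BVec k) :
    f.weight x * (starRingEnd ℂ) (f.weight x') = (f.s : ℂ) ^ 2 * phase (f.φ x - f.φ x') := by
  have h : phase (f.φ x) = phase (f.φ x - f.φ x') * phase (f.φ x') := by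
    rw [← phase_add, sub_add_cancel]
  rw [weight, weight, map_mul, Complex.conj_ofReal, h]
  linear_combination (f.s : ℂ) ^ 2 * phase (f.φ x - f.φ x') * phase_mul_conj (f.φ x')

theorem phase_injective : Function.Injective phase := fun _ _ h =>
  AddCircle.injective_toCircle one_ne_zero (Subtype.coe_injective h)

theorem phase_ne_zero (a : UnitAddCircle) : phase a ≠ 0 := Circle.coe_ne_zero _

/-- A quadratic phase that depends only on the discarded values can be removed. -/
theorem rel_of_invariant {f : SumData n m k} (hf : f.IsCliff) {ψ : BVec k → UnitAddCircle}
    (hψ : ψ ∈ quadPhases k) (h : ∀ x x', f.SameDisc x x' → ψ x = ψ x') :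
    Rel (f.addPhase ψ) f := by
  -- A linear section of the map formed by the linear parts of the discards yields an affine choice
  -- `π` of a representative in each class of `SameDisc`. The generators of `ψ` need not be
  -- invariant, but their composites with `π` are, and `ψ = ψ ∘ π`.
  obtain ⟨π, hπ, hπ1, hπ2⟩ : ∃ π : BVec k → BVec k, AffMap π ∧ (∀ x, f.SameDisc x (π x)) ∧
      ∀ x x', f.SameDisc x x' → π x = π x' := by
    let lin (d : f.D) : BVec k →ₗ[ZMod 2] ZMod 2 :=
      AddMonoidHom.toZModLinearMap 2
        { toFun := fun x => d.1 x + d.1 0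
          map_zero' := two_self _
          map_add' := fun x y => by rw [hf.disc d.1 d.2]; ring }
    let G : BVec k →ₗ[ZMod 2] (f.D → ZMod 2) := LinearMap.pi lin
    obtain ⟨S, hS⟩ := G.rangeRestrict.exists_rightInverse_of_surjective
      (LinearMap.range_eq_top.2 G.surjective_rangeRestrict)
    refine ⟨fun x => S (G.rangeRestrict x), fun i x y => ?_, fun x d hd => ?_, fun x x' hx => ?_⟩
    · simp
    · have h1 : G.rangeRestrict (S (G.rangeRestrict x)) = G.rangeRestrict x :=
        LinearMap.congr_fun hS _
      have h2 := congrFun (congrArg Subtype.val h1) ⟨d, hd⟩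
      exact (add_right_cancel (b := d 0) h2).symm
    · refine congrArg S (Subtype.ext (_root_.funext fun d => ?_))
      change d.1 x + d.1 0 = d.1 x' + d.1 0
      rw [hx d.1 d.2]
  have e : ψ = fun x => ψ (π x) := _root_.funext fun x => h _ _ (hπ1 x)
  rw [e]
  clear e h
  -- The sum has to vary in the induction, because the generators are removed one after the other.
  revert f
  induction hψ using AddSubgroup.closure_induction with
  | mem ψ hψ =>
    intro f hf _ hπ2
    have hinv : ∀ A : BVec k → ZMod 2, ∀ x x', f.SameDisc x x' → A (π x) = A (π x') :=
      fun A x x' hx => by rw [hπ2 x x' hx]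
    cases hψ with
    | const => exact rel_const hf _ QuadGen.const.mem
    | lin A hA =>
      have h2 : ∀ x, A (π x) * A (π x) = A (π x) := fun x => by
        rcases zmod2_cases (A (π x)) with e | e <;> rw [e] <;> rfl
      have h3 := rel_addPhase hf (1 / 4) (hA.comp hπ) (hA.comp hπ)
        (by simpa only [h2] using (QuadGen.lin _ (hA.comp hπ)).mem) (hinv A) (hinv A)
      simp only [h2] at h3
      exact h3
    | quad A B hA hB =>
      exact rel_addPhase hf (1 / 2) (hA.comp hπ) (hB.comp hπ)
        (QuadGen.quad _ _ (hA.comp hπ) (hB.comp hπ)).mem (hinv A) (hinv B)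
  | zero =>
    intro f hf _ _
    rw [show (fun x => (0 : BVec k → UnitAddCircle) (π x)) = 0 from rfl, addPhase_zero]
    exact hf.refl
  | add ψ ψ' hψ hψ' h h' =>
    intro f hf h1 h2
    have e1 := h hf h1 h2
    have e2 := h' (f := f.addPhase fun x => ψ (π x)) e1.left h1 h2
    rw [addPhase_add] at e2
    exact e2.trans e1
  | neg ψ hψ h =>
    intro f hf h1 h2
    have hn : (f.addPhase fun x => (-ψ) (π x)).IsCliff :=
      hf.addPhase (quadPhases_comp (neg_mem hψ) hπ)
    have e1 := h hn h1 h2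
    rw [addPhase_add, show (fun x => (-ψ) (π x)) + (fun x => ψ (π x)) = 0 from
      _root_.funext fun x => neg_add_cancel _, addPhase_zero] at e1
    exact e1.symm

/-- Diagonal entries are nonzero exactly at the labels, which gives a bijection `τ` of assignments
matching the labels. The support of the matrix matches the relations `SameDisc`, the diagonal
matches the scalars, and the entries at related pairs match the phase differences. Hence after
reparametrization the two phases differ by one that depends only on discarded values. -/
theorem rel_of_sem_eq_of_injective {f : SumData n m k} {g : SumData n m l} (hf : f.IsCliff)
    (hg : g.IsCliff) (hfi : Function.Injective fun x i => f.L i x)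
    (hgi : Function.Injective fun x i => g.L i x) (h : f.sem = g.sem) : Rel f g := by
  classical
  have hex : ∀ {k l : ℕ} (f : SumData n m k) (g : SumData n m l), f.IsCliff →
      Function.Injective (fun x i => f.L i x) → f.sem = g.sem →
      ∀ x, ∃ y, (fun i => g.L i y) = fun i => f.L i x := by
    intro k l f g hf hfi h x
    by_contra! hne
    have h1 := sem_eq_zero_of_notMem (b := fun i => f.L i x) hne
    rw [← h, sem_of_injective hfi, if_pos (sameDisc_refl _ _), weight_mul_conj] at h1
    rcases mul_eq_zero.1 h1 with h2 | h2
    · exact hf.scalar_pos.ne' (by simpa using h2)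
    · exact phase_ne_zero _ h2
  choose τ hτ using hex f g hf hfi h
  choose σ hσ using hex g f hg hgi h.symm
  have hτσ : ∀ y, τ (σ y) = y := fun y => hgi ((hτ _).trans (hσ y))
  have hστ : ∀ x, σ (τ x) = x := fun x => hfi ((hσ _).trans (hτ x))
  obtain rfl : k = l := by
    have := Fintype.card_congr (Equiv.mk τ σ hστ hτσ)
    simp only [BVec, Fintype.card_fun, ZMod.card, Fintype.card_fin] at this
    exact Nat.pow_right_injective le_rfl this
  have hinj : Function.Injective τ := fun x y h => by rw [← hστ x, h, hστ]
  have hL : ∀ x i, g.L i (τ x) = f.L i x := fun x i => congrFun (hτ x) i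
  -- Composed with the injective affine labels of `g`, the map `τ` gives the affine labels of `f`;
  -- hence it is affine itself.
  have hτa : ∀ x y, τ (x + y) = τ x + τ y + τ 0 := fun x y => hgi (_root_.funext fun i => by
    change g.L i _ = g.L i _
    rw [hL, hg.lin i (τ x + τ y), hg.lin i (τ x), hL, hL, hL, hf.lin i]
    linear_combination -two_self (g.L i 0))
  refine Rel.trans ?_ (rel_comap hg (fun i x y => congrFun (hτa x y) i) hinj).symm
  have hsem : ∀ x x', (if f.SameDisc x x' then f.weight x * (starRingEnd ℂ) (f.weight x') else 0) =
      if g.SameDisc (τ x) (τ x') then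
        g.weight (τ x) * (starRingEnd ℂ) (g.weight (τ x')) else 0 := by
    intro x x'
    rw [← sem_of_injective hfi, ← sem_of_injective hgi, h]
    simp only [hL]
  have hne : ∀ {f : SumData n m k}, f.IsCliff → ∀ x x',
      f.weight x * (starRingEnd ℂ) (f.weight x') ≠ 0 := by
    intro f hf x x'
    rw [weight_mul_conj]
    exact mul_ne_zero (pow_ne_zero 2 (Complex.ofReal_ne_zero.2 hf.scalar_pos.ne')) (phase_ne_zero _)
  have hR : ∀ x x', f.SameDisc x x' ↔ g.SameDisc (τ x) (τ x') := by
    intro x x'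
    have h1 := hsem x x'
    by_cases hf' : f.SameDisc x x' <;> by_cases hg' : g.SameDisc (τ x) (τ x')
    · simp [hf', hg']
    · rw [if_pos hf', if_neg hg'] at h1
      exact absurd h1 (hne hf _ _)
    · rw [if_neg hf', if_pos hg'] at h1
      exact absurd h1.symm (hne hg _ _)
    · simp [hf', hg']
  have hs : f.s = g.s := by
    have h1 := hsem 0 0
    rw [if_pos (sameDisc_refl _ _), if_pos (sameDisc_refl _ _), weight_mul_conj, weight_mul_conj, sub_self,
      sub_self, phase_zero, mul_one, mul_one] at h1
    -- Only the squares are visible on the diagonal; Clifford scalars are positive, so this is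
    -- enough.
    have h2 : f.s ^ 2 = g.s ^ 2 := by exact_mod_cast h1
    exact (pow_left_inj₀ hf.scalar_pos.le hg.scalar_pos.le two_ne_zero).1 h2
  have hφ : ∀ x x', f.SameDisc x x' → f.φ x - f.φ x' = g.φ (τ x) - g.φ (τ x') := by
    intro x x' hx
    have h1 := hsem x x'
    rw [if_pos hx, if_pos ((hR x x').1 hx), weight_mul_conj, weight_mul_conj, hs] at h1
    exact phase_injective (mul_left_cancel₀
      (pow_ne_zero 2 (Complex.ofReal_ne_zero.2 hg.scalar_pos.ne')) h1)
  have hg' : (g.comap τ).IsCliff := hg.comap fun i x y => congrFun (hτa x y) i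
  have h1 := rel_of_invariant (ψ := (fun x => g.φ (τ x)) - f.φ) hf (sub_mem hg'.phase hf.phase)
    fun x x' hx => by
      have h2 := hφ x x' hx
      rw [sub_eq_sub_iff_add_eq_add] at h2
      rw [Pi.sub_apply, Pi.sub_apply, sub_eq_sub_iff_add_eq_add, ← h2, add_comm]
  refine h1.symm.trans ((rel_disc_congr h1.left hg'.disc fun x x' => ?_).trans ?_)
  · refine (hR x x').trans ?_
    simp only [comap, Set.forall_mem_image]
    rfl
  · convert hg'.refl using 1
    simp only [addPhase, comap, SumData.mk.injEq, and_true, hs, true_and]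
    refine ⟨add_sub_cancel _ _, _root_.funext fun i => _root_.funext fun x => (hL x i).symm⟩

/-- Sums with the same interpretation are equal up to the rules. -/
theorem rel_of_sem_eq {f : SumData n m k} {g : SumData n m l} (hf : f.IsCliff)
    (hg : g.IsCliff) (h : f.sem = g.sem) : Rel f g := by
  have hne : ∀ {j : ℕ} {g : SumData n m j}, g.IsCliff → (Function.Injective fun x i => g.L i x) →
      g.sem ≠ 0 := by
    classical
    intro j g hg hgi h
    have h1 := sem_of_injective hgi 0 0
    rw [h, if_pos (sameDisc_refl _ _), weight_mul_conj, sub_self, phase_zero, mul_one] at h1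
    exact hg.scalar_pos.ne' (by simpa using h1.symm)
  rcases exists_normalForm k f hf with h1 | ⟨j, f', h1, hfi⟩ <;>
    rcases exists_normalForm l g hg with h2 | ⟨j', g', h2, hgi⟩
  · exact h1.trans h2.symm
  · exact absurd (h2.symm.sem_eq.trans (h.symm.trans (h1.sem_eq.trans sem_zeroData))) (hne h2.right hgi)
  · exact absurd (h1.symm.sem_eq.trans (h.trans (h2.sem_eq.trans sem_zeroData))) (hne h1.right hfi)
  · exact h1.trans ((rel_of_sem_eq_of_injective h1.right h2.right hfi hgi
      (h1.symm.sem_eq.trans (h.trans h2.sem_eq))).trans h2.symm)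

end SumData

theorem SOPTerm.reps_den {n m : ℕ} (t : SOPTerm n m) (ht : t.IsClifford) :
    t.den.Reps t.P t.O t.D t.I :=
  ⟨fun _ => rfl, fun _ => rfl, fun _ => rfl, rfl, ht.ket, ht.disc, ht.bra⟩

/-- Two terms of the Clifford fragment are equal up to the rules if and only if they have the same
interpretation. -/
theorem mk_eq_iff_sem {n m : ℕ} (t t' : CliffMor n m) :
    (Quot.mk CliffStep t : CliffQuot n m) = Quot.mk CliffStep t' ↔ t.1.den.sem = t'.1.den.sem := by
  have hc : ∀ t : CliffMor n m, t.1.den.HasClass (Quot.mk CliffStep t) := fun t =>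
    ⟨t.1.P, t.1.O, t.1.D, t.1.I, t.2, t.1.reps_den t.2, rfl⟩
  constructor
  · intro h
    rw [(hc t).sem_eq, (hc t').sem_eq, h]
  · intro h
    obtain ⟨q, h₁, h₂⟩ := SumData.rel_of_sem_eq (hc t).isCliff (hc t').isCliff h
    rw [(hc t).unique h₁, (hc t').unique h₂]


/-! ## Values of the quadratic forms -/

section forms

variable {J : Type} [Fintype J] [DecidableEq J]

/-- A list of products of linear forms represents a function. -/
structure IsForm (nm : J → VarName) (S : List RankOne) (v : (J → ZMod 2) → ZMod 4) : Prop where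
  symm : ∀ i j, entry S i j = entry S j i
  names : ∀ p ∈ varNames S, ∃ j, nm j = p
  val : ∀ x, quadVal (fun i j => entry S (nm i) (nm j)) x = v x

theorem entry_append (S S' : List RankOne) (i j : VarName) :
    entry (S ++ S') i j = entry S i j + entry S' i j := by
  simp only [entry_eq, List.map_append, List.sum_append]

theorem quadVal_add (M M' : J → J → ZMod 4) (x : J → ZMod 2) :
    quadVal (fun i j => M i j + M' i j) x = quadVal M x + quadVal M' x := by
  simp only [quadVal, linVal, add_mul, Finset.sum_add_distrib, mul_add]

namespace IsForm

variable {nm : J → VarName}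

theorem nil : IsForm nm [] fun _ => 0 where
  symm _ _ := rfl
  names p hp := by simp [varNames] at hp
  val x := by simp [quadVal, linVal, entry]

theorem append {S S' : List RankOne} {v v' : (J → ZMod 2) → ZMod 4} (h : IsForm nm S v)
    (h' : IsForm nm S' v') : IsForm nm (S ++ S') fun x => v x + v' x where
  symm i j := by rw [entry_append, entry_append, h.symm, h'.symm]
  names p hp := by
    rw [varNames, List.flatMap_append, List.mem_append] at hp
    exact hp.elim (h.names p) (h'.names p)
  val x := by
    simp only [entry_append]
    rw [quadVal_add, h.val, h'.val]

theorem flatMap {α : Type} (l : List α) {f : α → List RankOne} {v : α → (J → ZMod 2) → ZMod 4}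
    (h : ∀ a ∈ l, IsForm nm (f a) (v a)) :
    IsForm nm (l.flatMap f) fun x => (l.map fun a => v a x).sum := by
  induction l with
  | nil => exact nil
  | cons a l ih =>
    exact (h a (List.mem_cons_self ..)).append (ih fun b hb => h b (List.mem_cons_of_mem _ hb))

theorem look_single (p q : VarName) : look [(p, 1)] q = if p = q then 1 else 0 := rfl

theorem quadVal_monoForm (hnm : Function.Injective nm) (c : ZMod 4) (i j : J) (x : J → ZMod 2) :
    quadVal (fun a b => entry [monoForm c (nm i) (nm j)] (nm a) (nm b)) x =
      c * (lift4 (x i) * lift4 (x j)) := by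
  have h : ∀ i, linVal (fun a => look [(nm i, 1)] (nm a)) x = lift4 (x i) := by
    intro i
    simp [linVal, look_single, hnm.eq_iff]
  have h0 : quadVal (fun _ _ : J => 0) x = 0 := by simp [quadVal, linVal]
  rw [quadVal_add_rankOne (fun _ _ => 0) _ c (fun a => look [(nm i, 1)] (nm a))
    (fun a => look [(nm j, 1)] (nm a)) (fun a b => entry_cons _ _ _ _), h, h, h0, add_zero]

theorem names_monoForm (c : ZMod 4) (i j : J) (p : VarName)
    (hp : p ∈ varNames [monoForm c (nm i) (nm j)]) : ∃ j, nm j = p := by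
  simp only [varNames, monoForm, List.flatMap_cons, List.flatMap_nil, List.map_cons, List.map_nil,
    List.append_nil, List.mem_singleton] at hp
  exact ⟨i, hp.symm⟩

theorem diag (hnm : Function.Injective nm) (c : ZMod 4) (j : J) :
    IsForm nm [monoForm c (nm j) (nm j)] fun x => c * lift4 (x j) where
  symm a b := by
    simp only [entry_eq, monoForm, List.map_cons, List.map_nil]
    rw [mul_comm (look _ a)]
  names p hp := names_monoForm c j j p hp
  val x := by
    have h : ∀ b : ZMod 2, lift4 b * lift4 b = lift4 b := by decide
    rw [quadVal_monoForm hnm, h]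

theorem pair (hnm : Function.Injective nm) (c : ZMod 4) (i j : J) :
    IsForm nm [monoForm c (nm i) (nm j), monoForm c (nm j) (nm i)]
      fun x => 2 * (c * (lift4 (x i) * lift4 (x j))) where
  symm a b := by
    simp only [entry_eq, monoForm, List.map_cons, List.map_nil, List.sum_cons, List.sum_nil]
    ring
  names p hp := by
    rw [← List.singleton_append, varNames, List.flatMap_append, List.mem_append] at hp
    exact hp.elim (names_monoForm c i j p) (names_monoForm c j i p)
  val x := by
    have h : ∀ a b, entry [monoForm c (nm i) (nm j), monoForm c (nm j) (nm i)] a b =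
        entry [monoForm c (nm i) (nm j)] a b + entry [monoForm c (nm j) (nm i)] a b :=
      fun a b => entry_append [_] [_] a b
    simp only [h]
    rw [quadVal_add, quadVal_monoForm hnm, quadVal_monoForm hnm]
    ring

theorem congr {S : List RankOne} {v v' : (J → ZMod 2) → ZMod 4} (h : IsForm nm S v)
    (e : ∀ x, v x = v' x) : IsForm nm S v' :=
  ⟨h.symm, h.names, fun x => (h.val x).trans (e x)⟩

end IsForm

theorem evalB_toPoly {k : ℕ} (a : LinCode k) (x : BVec k) :
    evalB a.toPoly x = (if a.cst then 1 else 0) + (a.vars.map x).sum := by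
  rw [LinCode.toPoly, evalB_add, evalB_C]
  congr 1
  induction a.vars with
  | nil => exact map_zero (eval x)
  | cons i l ih => rw [List.map_cons, List.sum_cons, evalB_add, ih, evalB_X, List.map_cons, List.sum_cons]

/-- The carry in `lift4 (a + b)` is a multiple of `2` and is killed by doubling; so equations modulo
2 can be imposed by a form modulo 4. -/
theorem two_lift4_add (a b : ZMod 2) : 2 * lift4 (a + b) = 2 * lift4 a + 2 * lift4 b := by
  revert a b
  decide

variable {nm : J → VarName}

/-- Two symmetric unit entries contribute `2 u x_i`. The constant term sits on the diagonal because
`u ^ 2 = u`. -/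
theorem isForm_constraint (hnm : Function.Injective nm) {k t : ℕ} {y : Fin k → J} (hy : ∀ i, nm (y i) = (t, (i : ℕ)))
    (u : J) (a : LinCode k) :
    IsForm nm (constraint (nm u) t a.written)
      fun x => 2 * (lift4 (x u) * lift4 (evalB a.toPoly (x ∘ y))) := by
  have h1 := IsForm.flatMap a.vars (nm := nm) (f := fun i : Fin k =>
    [monoForm 1 (nm u) (t, i), monoForm 1 (t, i) (nm u)])
    (v := fun i x => 2 * (1 * (lift4 (x u) * lift4 (x (y i))))) fun i _ => by
      rw [← hy]
      exact IsForm.pair hnm 1 u (y i)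
  have h2 := (IsForm.diag hnm (if a.cst then 2 else 0) u).append h1
  have e : constraint (nm u) t a.written = [monoForm (if a.cst then 2 else 0) (nm u) (nm u)] ++
      a.vars.flatMap fun i : Fin k => [monoForm 1 (nm u) (t, (i : ℕ)), monoForm 1 (t, (i : ℕ)) (nm u)] := by
    rw [constraint, LinCode.written, List.flatMap_map]
    rfl
  rw [e]
  refine h2.congr fun x => ?_
  rw [evalB_toPoly, mul_left_comm, two_lift4_add, mul_add]
  congr 1
  · cases a.cst
    · simp [lift4]
    · rw [mul_comm]
      rfl
  · induction a.vars with
    | nil => simp [lift4]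
    | cons i l ih =>
      rw [List.map_cons, List.sum_cons, ih, List.map_cons, List.sum_cons, two_lift4_add, mul_add,
        Function.comp_apply]
      ring

theorem zipIdx_ofFn {α : Type} {N : ℕ} (f : Fin N → α) :
    (List.ofFn f).zipIdx = List.ofFn fun i => (f i, (i : ℕ)) := by
  refine List.ext_getElem (by simp) fun i h h' => ?_
  simp

theorem isForm_constraints (hnm : Function.Injective nm) {k t τ N : ℕ} {y : Fin k → J} (hy : ∀ i, nm (y i) = (t, (i : ℕ)))
    {u : Fin N → J} (hu : ∀ i, nm (u i) = (τ, (i : ℕ))) (g : Fin N → LinCode k) :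
    IsForm nm (constraints τ t (List.ofFn fun i => (g i).written))
      fun x => 2 * ∑ i, lift4 (x (u i)) * lift4 (evalB (g i).toPoly (x ∘ y)) := by
  have e : constraints τ t (List.ofFn fun i => (g i).written) =
      (List.finRange N).flatMap fun i => constraint (nm (u i)) t (g i).written := by
    rw [constraints, zipIdx_ofFn, List.ofFn_eq_map, List.flatMap_map]
    simp only [hu]
  rw [e]
  refine (IsForm.flatMap _ fun i _ => isForm_constraint hnm hy (u i) (g i)).congr fun x => ?_
  rw [← List.ofFn_eq_map, List.sum_ofFn, Finset.mul_sum]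

/-- The quadratic part of the phase of a written term, in fourths. -/
def CliffCode.quadFun {n m : ℕ} (c : CliffCode n m) (x : BVec c.k) : ZMod 4 :=
  (c.lin.map fun a => (a.1 : ZMod 4) * lift4 (x a.2)).sum +
    (c.quad.map fun a => 2 * ((a.1 : ZMod 4) * (lift4 (x a.2.1) * lift4 (x a.2.2)))).sum

theorem isForm_copyForm (hnm : Function.Injective nm) {n m : ℕ} (c : CliffCode n m) (sg : ZMod 4) (t tk td tb : ℕ)
    {y : Fin c.k → J} (hy : ∀ i, nm (y i) = (t, (i : ℕ)))
    {uk : Fin m → J} (huk : ∀ i, nm (uk i) = (tk, (i : ℕ)))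
    {ud : Fin c.disc.length → J} (hud : ∀ i, nm (ud i) = (td, (i : ℕ)))
    {ub : Fin n → J} (hub : ∀ i, nm (ub i) = (tb, (i : ℕ))) :
    IsForm nm (copyForm sg t tk td tb c.written) fun x => sg * c.quadFun (x ∘ y) +
      2 * (∑ i, lift4 (x (uk i)) * lift4 (evalB (c.ket i).toPoly (x ∘ y)) +
        (∑ i, lift4 (x (ud i)) * lift4 (evalB (c.disc.get i).toPoly (x ∘ y)) +
          ∑ i, lift4 (x (ub i)) * lift4 (evalB (c.bra i).toPoly (x ∘ y)))) := by
  have h1 : IsForm nm ((c.lin.map fun a => (a.1, (a.2 : ℕ))).flatMap fun a =>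
      [monoForm (sg * (a.1 : ZMod 4)) (t, a.2) (t, a.2)])
      fun x => (c.lin.map fun a => sg * (a.1 : ZMod 4) * lift4 (x (y a.2))).sum := by
    rw [List.flatMap_map]
    refine IsForm.flatMap _ fun a _ => ?_
    rw [← hy]
    exact IsForm.diag hnm _ _
  have h2 : IsForm nm ((c.quad.map fun a => (a.1, (a.2.1 : ℕ), (a.2.2 : ℕ))).flatMap fun a =>
      [monoForm (sg * (a.1 : ZMod 4)) (t, a.2.1) (t, a.2.2),
        monoForm (sg * (a.1 : ZMod 4)) (t, a.2.2) (t, a.2.1)])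
      fun x => (c.quad.map fun a =>
        2 * (sg * (a.1 : ZMod 4) * (lift4 (x (y a.2.1)) * lift4 (x (y a.2.2))))).sum := by
    rw [List.flatMap_map]
    refine IsForm.flatMap _ fun a _ => ?_
    rw [← hy, ← hy]
    exact IsForm.pair hnm _ _ _
  have ed : c.disc.map LinCode.written = List.ofFn fun i => (c.disc.get i).written := by
    conv_lhs => rw [← List.ofFn_get c.disc, List.map_ofFn]
    rfl
  have h3 := (isForm_constraints hnm hy huk c.ket).append
    ((isForm_constraints hnm hy hud c.disc.get).append (isForm_constraints hnm hy hub c.bra))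
  rw [← ed] at h3
  refine (h1.append (h2.append h3)).congr fun x => ?_
  have e1 : (c.lin.map fun a => sg * (a.1 : ZMod 4) * lift4 (x (y a.2))).sum =
      sg * (c.lin.map fun a => (a.1 : ZMod 4) * lift4 ((x ∘ y) a.2)).sum := by
    rw [← List.sum_map_mul_left]
    simp only [mul_assoc, Function.comp_apply]
  have e2 : (c.quad.map fun a =>
        2 * (sg * (a.1 : ZMod 4) * (lift4 (x (y a.2.1)) * lift4 (x (y a.2.2))))).sum =
      sg * (c.quad.map fun a =>
        2 * ((a.1 : ZMod 4) * (lift4 ((x ∘ y) a.2.1) * lift4 ((x ∘ y) a.2.2)))).sum := by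
    rw [← List.sum_map_mul_left]
    congr 2
    funext a
    rw [Function.comp_apply, Function.comp_apply]
    ring
  rw [e1, e2, CliffCode.quadFun]
  ring

/-- Summing over one multiplier `b` gives `∑ (-1) ^ (b c)`, which is `2` if the equation `c = 0`
holds and `0` otherwise; the multipliers are independent, so these factors multiply. -/
theorem gaussSum_constraints {Y U : Type} [Fintype Y] [Fintype U] [DecidableEq Y] [DecidableEq U]
    (q : (Y → ZMod 2) → ZMod 4) (c : U → (Y → ZMod 2) → ZMod 2) :
    ∑ x : Y ⊕ U → ZMod 2, quarter (q (x ∘ Sum.inl) +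
      2 * ∑ u, lift4 (x (Sum.inr u)) * lift4 (c u (x ∘ Sum.inl))) =
    2 ^ Fintype.card U * ∑ y, if ∀ u, c u y = 0 then quarter (q y) else 0 := by
  have h1 : ∀ y, ∑ w : U → ZMod 2, quarter (q y + 2 * ∑ u, lift4 (w u) * lift4 (c u y)) =
      2 ^ Fintype.card U * if ∀ u, c u y = 0 then quarter (q y) else 0 := by
    intro y
    have h2 : ∀ d : ZMod 2, ∑ b : ZMod 2, quarter (2 * (lift4 b * lift4 d)) =
        if d = 0 then 2 else 0 := by
      have e2 : quarter 2 = -1 := by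
        rw [quarter, AddChar.zmodChar_apply]
        exact Complex.I_sq
      intro d
      rw [sum_zmod2]
      rcases zmod2_cases d with rfl | rfl
      · rw [if_pos rfl, show 2 * (lift4 0 * lift4 0) = 0 from rfl,
          show 2 * (lift4 1 * lift4 0) = 0 from rfl, AddChar.map_zero_eq_one]
        norm_num
      · rw [if_neg one_ne_zero, show 2 * (lift4 0 * lift4 1) = 0 from rfl,
          show 2 * (lift4 1 * lift4 1) = 2 from rfl, AddChar.map_zero_eq_one, e2, add_neg_cancel]
    have h3 : ∀ w : U → ZMod 2, quarter (q y + 2 * ∑ u, lift4 (w u) * lift4 (c u y)) =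
        quarter (q y) * ∏ u, quarter (2 * (lift4 (w u) * lift4 (c u y))) := by
      intro w
      rw [AddChar.map_add_eq_mul, Finset.mul_sum]
      congr 1
      exact map_prod quarter.toMonoidHom (fun u => Multiplicative.ofAdd (2 * (lift4 (w u) * lift4 (c u y))))
        Finset.univ
    simp only [h3]
    rw [← Finset.mul_sum, ← Fintype.piFinset_univ,
      ← Finset.prod_univ_sum (fun _ => Finset.univ) fun u b => quarter (2 * (lift4 b * lift4 (c u y)))]
    simp only [h2]
    split
    · rename_i h
      simp only [h, if_true, Finset.prod_const, Finset.card_univ]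
      ring
    · rename_i h
      push Not at h
      obtain ⟨u, hu⟩ := h
      rw [Finset.prod_eq_zero (Finset.mem_univ u) (if_neg hu)]
      ring
  rw [Finset.mul_sum, ← Finset.sum_congr rfl fun y _ => h1 y, ← Fintype.sum_prod_type']
  exact Fintype.sum_equiv (Equiv.sumArrowEquivProdArrow _ _ _) _ _ fun x => rfl

end forms

/-! ### Inner products of written terms as Gauss sums -/

section gram

variable {n m : ℕ}

/-- The summed variables of an inner product. -/
abbrev GramVar (c d : CliffCode n m) : Type := (Fin c.k ⊕ Fin c.k) ⊕ (Fin d.k ⊕ Fin d.k)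

/-- The constraints in an inner product. -/
abbrev GramCon (c d : CliffCode n m) : Type :=
  ((Fin m ⊕ Fin m) ⊕ (Fin n ⊕ Fin n)) ⊕ (Fin c.disc.length ⊕ Fin d.disc.length)

/-- Names of the variables of an inner product. -/
def gramName (c d : CliffCode n m) : GramVar c d ⊕ GramCon c d → VarName
  | .inl (.inl (.inl i)) => (0, i)
  | .inl (.inl (.inr i)) => (1, i)
  | .inl (.inr (.inl i)) => (2, i)
  | .inl (.inr (.inr i)) => (3, i)
  | .inr (.inl (.inl (.inl i))) => (4, i)
  | .inr (.inl (.inl (.inr i))) => (5, i)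
  | .inr (.inl (.inr (.inl i))) => (6, i)
  | .inr (.inl (.inr (.inr i))) => (7, i)
  | .inr (.inr (.inl i)) => (8, i)
  | .inr (.inr (.inr i)) => (9, i)

theorem gramName_injective (c d : CliffCode n m) : Function.Injective (gramName c d) := by
  rintro (((i | i) | (i | i)) | (((i | i) | (i | i)) | (i | i)))
    (((j | j) | (j | j)) | (((j | j) | (j | j)) | (j | j))) h <;>
  simp only [gramName, Prod.mk.injEq, Fin.val_inj, true_and] at h <;>
  first
  | rw [h]
  | exact absurd h.1 (by decide)

/-- The values of the constraints in an inner product. -/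
noncomputable def gramConVal (c d : CliffCode n m) : GramCon c d → (GramVar c d → ZMod 2) → ZMod 2
  | .inl (.inl (.inl i)), y => evalB (c.ket i).toPoly (y ∘ .inl ∘ .inl) +
      evalB (d.ket i).toPoly (y ∘ .inr ∘ .inl)
  | .inl (.inl (.inr i)), y => evalB (c.ket i).toPoly (y ∘ .inl ∘ .inr) +
      evalB (d.ket i).toPoly (y ∘ .inr ∘ .inr)
  | .inl (.inr (.inl i)), y => evalB (c.bra i).toPoly (y ∘ .inl ∘ .inl) +
      evalB (d.bra i).toPoly (y ∘ .inr ∘ .inl)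
  | .inl (.inr (.inr i)), y => evalB (c.bra i).toPoly (y ∘ .inl ∘ .inr) +
      evalB (d.bra i).toPoly (y ∘ .inr ∘ .inr)
  | .inr (.inl i), y => evalB (c.disc.get i).toPoly (y ∘ .inl ∘ .inl) +
      evalB (c.disc.get i).toPoly (y ∘ .inl ∘ .inr)
  | .inr (.inr i), y => evalB (d.disc.get i).toPoly (y ∘ .inr ∘ .inl) +
      evalB (d.disc.get i).toPoly (y ∘ .inr ∘ .inr)

/-- The tags `0`, `1` are the two copies of `c` and `2`, `3` those of `d`; conjugation makes the
signs `+ - - +`. Copies that use the same tag of multipliers add up to one equation: `4` and `6`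
equate ket and bra of copies `0` and `2`, `5` and `7` those of `1` and `3`, while `8` and `9` equate
the discards of the two copies of `c` and of `d`. -/
theorem isForm_gramForm (c d : CliffCode n m) :
    IsForm (gramName c d) (gramForm c.written d.written) fun x =>
      (c.quadFun (x ∘ .inl ∘ .inl ∘ .inl) - c.quadFun (x ∘ .inl ∘ .inl ∘ .inr) -
        d.quadFun (x ∘ .inl ∘ .inr ∘ .inl) + d.quadFun (x ∘ .inl ∘ .inr ∘ .inr)) +
      2 * ∑ u, lift4 (x (.inr u)) * lift4 (gramConVal c d u (x ∘ .inl)) := by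
  have hnm := gramName_injective c d
  have h0 := isForm_copyForm hnm c 1 0 4 8 6 (y := .inl ∘ .inl ∘ .inl) (fun _ => rfl)
    (uk := .inr ∘ .inl ∘ .inl ∘ .inl) (fun _ => rfl) (ud := .inr ∘ .inr ∘ .inl) (fun _ => rfl)
    (ub := .inr ∘ .inl ∘ .inr ∘ .inl) (fun _ => rfl)
  have h1 := isForm_copyForm hnm c (-1) 1 5 8 7 (y := .inl ∘ .inl ∘ .inr) (fun _ => rfl)
    (uk := .inr ∘ .inl ∘ .inl ∘ .inr) (fun _ => rfl) (ud := .inr ∘ .inr ∘ .inl) (fun _ => rfl)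
    (ub := .inr ∘ .inl ∘ .inr ∘ .inr) (fun _ => rfl)
  have h2 := isForm_copyForm hnm d (-1) 2 4 9 6 (y := .inl ∘ .inr ∘ .inl) (fun _ => rfl)
    (uk := .inr ∘ .inl ∘ .inl ∘ .inl) (fun _ => rfl) (ud := .inr ∘ .inr ∘ .inr) (fun _ => rfl)
    (ub := .inr ∘ .inl ∘ .inr ∘ .inl) (fun _ => rfl)
  have h3 := isForm_copyForm hnm d 1 3 5 9 7 (y := .inl ∘ .inr ∘ .inr) (fun _ => rfl)
    (uk := .inr ∘ .inl ∘ .inl ∘ .inr) (fun _ => rfl) (ud := .inr ∘ .inr ∘ .inr) (fun _ => rfl)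
    (ub := .inr ∘ .inl ∘ .inr ∘ .inr) (fun _ => rfl)
  refine (h0.append (h1.append (h2.append h3))).congr fun x => ?_
  have hadd : ∀ {N : ℕ} (w a b : Fin N → ZMod 2), 2 * ∑ i, lift4 (w i) * lift4 (a i + b i) =
      2 * ∑ i, lift4 (w i) * lift4 (a i) + 2 * ∑ i, lift4 (w i) * lift4 (b i) := by
    intro N w a b
    rw [Finset.mul_sum, Finset.mul_sum, Finset.mul_sum, ← Finset.sum_add_distrib]
    refine Finset.sum_congr rfl fun i _ => ?_
    rw [mul_left_comm, two_lift4_add]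
    ring
  simp only [Fintype.sum_sum_type, gramConVal, mul_add, hadd, Function.comp_apply]
  simp only [Function.comp_assoc]
  ring

open Classical in
/-- The Gauss sum of the quadratic form of an inner product. -/
theorem gaussSum_gramForm (c d : CliffCode n m) :
    gaussSum4 (fun i j => entry (gramForm c.written d.written) (gramName c d i) (gramName c d j)) =
      2 ^ Fintype.card (GramCon c d) * ∑ y, ∑ y', ∑ z, ∑ z',
        if (∀ i, evalB (c.ket i).toPoly y = evalB (d.ket i).toPoly z) ∧
          (∀ i, evalB (c.bra i).toPoly y = evalB (d.bra i).toPoly z) ∧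
          (∀ i, evalB (c.ket i).toPoly y' = evalB (d.ket i).toPoly z') ∧
          (∀ i, evalB (c.bra i).toPoly y' = evalB (d.bra i).toPoly z') ∧
          (∀ i, evalB (c.disc.get i).toPoly y = evalB (c.disc.get i).toPoly y') ∧
          (∀ i, evalB (d.disc.get i).toPoly z = evalB (d.disc.get i).toPoly z') then
          quarter (c.quadFun y - c.quadFun y' - d.quadFun z + d.quadFun z') else 0 := by
  rw [gaussSum4]
  simp only [(isForm_gramForm c d).val]
  refine (gaussSum_constraints (fun y : GramVar c d → ZMod 2 =>
    c.quadFun (y ∘ .inl ∘ .inl) - c.quadFun (y ∘ .inl ∘ .inr) -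
        d.quadFun (y ∘ .inr ∘ .inl) + d.quadFun (y ∘ .inr ∘ .inr)) (gramConVal c d)).trans ?_
  congr 1
  simp only [← Fintype.sum_prod_type']
  refine Fintype.sum_equiv (((Equiv.sumArrowEquivProdArrow _ _ _).trans (Equiv.prodCongr
    (Equiv.sumArrowEquivProdArrow _ _ _) (Equiv.sumArrowEquivProdArrow _ _ _))).trans
      ((Equiv.prodAssoc _ _ _).trans (Equiv.refl _))) _ _ fun y => ?_
  have h0 : ∀ a b : ZMod 2, a + b = 0 ↔ a = b := by decide
  simp only [Sum.forall, gramConVal, h0]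
  refine if_congr ?_ rfl rfl
  constructor
  · rintro ⟨⟨⟨a1, a2⟩, a3, a4⟩, a5, a6⟩
    exact ⟨a1, a3, a2, a4, a5, a6⟩
  · rintro ⟨a1, a3, a2, a4, a5, a6⟩
    exact ⟨⟨⟨a1, a2⟩, a3, a4⟩, a5, a6⟩

end gram


/-! ## Inner products of morphisms -/

theorem phase_zsmul (t : UnitAddCircle) (a : ℤ) : phase (a • t) = phase t ^ a := by
  rw [phase, AddCircle.toCircle_zsmul, Circle.coe_zpow]
  rfl

theorem quarter_intCast (a : ℤ) : quarter (a : ZMod 4) = Complex.I ^ a := by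
  have h := quarter.map_zsmul_eq_zpow a 1
  rwa [zsmul_one, show quarter 1 = Complex.I from (AddChar.zmodChar_apply _ _).trans (pow_one _)] at h

theorem phase_quarter_mul (a : ℤ) (b : ZMod 2) :
    phase ((1 / 4 * (a * bit01 b) : ℝ) : UnitAddCircle) = quarter ((a : ZMod 4) * lift4 b) := by
  rcases zmod2_cases b with rfl | rfl
  · rw [bit01_zero, show lift4 0 = 0 from rfl, mul_zero, mul_zero, mul_zero, AddCircle.coe_zero,
      phase_zero, AddChar.map_zero_eq_one]
  · rw [bit01_one, show lift4 1 = 1 from rfl, mul_one, mul_one, quarter_intCast, ← phase_quarter,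
      ← phase_zsmul, ← AddCircle.coe_zsmul, zsmul_eq_mul, mul_comm]

theorem phase_half_mul (a : ℤ) (b b' : ZMod 2) :
    phase ((1 / 2 * (a * (bit01 b * bit01 b')) : ℝ) : UnitAddCircle) =
      quarter (2 * ((a : ZMod 4) * (lift4 b * lift4 b'))) := by
  have h : ∀ b b' : ZMod 2, bit01 b * bit01 b' = bit01 (b * b') ∧
      lift4 b * lift4 b' = lift4 (b * b') := by
    intro b b'
    rcases zmod2_cases b with rfl | rfl
    · rw [zero_mul, bit01_zero, zero_mul]
      exact ⟨rfl, by rw [show lift4 0 = 0 from rfl, zero_mul]⟩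
    · rw [one_mul, bit01_one, one_mul]
      exact ⟨rfl, by rw [show lift4 1 = 1 from rfl, one_mul]⟩
  rw [(h b b').1, (h b b').2, show (2 : ZMod 4) * ((a : ZMod 4) * lift4 (b * b')) =
    ((2 * a : ℤ) : ZMod 4) * lift4 (b * b') by push_cast; ring, ← phase_quarter_mul]
  congr 2
  push_cast
  ring

namespace CliffCode

variable {n m : ℕ}

/-- The constant in eighths is split off: being a global phase it cancels in the inner products, so
powers of `i` suffice there. -/
theorem phase_toTerm (c : CliffCode n m) (x : BVec c.k) :
    phase (evalP (cliffPhase c.cst c.linPoly c.quadPoly) x : ℝ) =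
      phase ((1 / 8 * c.cst : ℝ) : UnitAddCircle) * quarter (c.quadFun x) := by
  rw [frac_coord_cliffPhase, AddCircle.coe_add, AddCircle.coe_add, phase_add, phase_add, quadFun,
    AddChar.map_add_eq_mul, mul_assoc]
  congr 2
  · rw [linPoly]
    induction c.lin with
    | nil => simp [phase_zero]
    | cons a l ih =>
      rw [List.map_cons, List.sum_cons, map_add, map_add, mul_add, AddCircle.coe_add, phase_add, ih,
        List.map_cons, List.sum_cons, AddChar.map_add_eq_mul, ← phase_quarter_mul]
      simp
  · rw [quadPoly]
    induction c.quad with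
    | nil => simp [phase_zero]
    | cons a l ih =>
      rw [List.map_cons, List.sum_cons, map_add, map_add, mul_add, AddCircle.coe_add, phase_add, ih,
        List.map_cons, List.sum_cons, AddChar.map_add_eq_mul, ← phase_half_mul]
      simp

theorem sem_toTerm (c : CliffCode n m) :
    c.toTerm.den.sem = cpEntry (fun x : BVec c.k => (((1 / √2 : ℝ) ^ c.p : ℝ) : ℂ) *
        phase ((1 / 8 * c.cst : ℝ) : UnitAddCircle) * quarter (c.quadFun x))
      (fun x => Sum.elim (fun i => evalB (c.ket i).toPoly x) fun i => evalB (c.bra i).toPoly x)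
      (fun x x' => ∀ i, evalB (c.disc.get i).toPoly x = evalB (c.disc.get i).toPoly x') := by
  refine (den_sem _ _ _ _ _).trans (cpEntry_congr (fun x => ?_) (fun _ => rfl) fun x x' => ?_)
  · rw [phase_toTerm, mul_assoc]
  · simp only [List.mem_toFinset, List.mem_map, forall_exists_index, and_imp,
      forall_apply_eq_imp_iff₂]
    exact List.forall_mem_iff_get

end CliffCode

/-! ### The inner product of matrices -/

section innerProduct

variable {Y Y' Z : Type} [Fintype Y] [Fintype Y'] [Fintype Z]

/-- The inner product of matrices. -/
noncomputable def matrixInner (f g : Z → Z → ℂ) : ℂ := ∑ a, ∑ b, f a b * (starRingEnd ℂ) (g a b)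

theorem matrixInner_self_eq_zero {f : Z → Z → ℂ} (h : matrixInner f f = 0) : f = 0 := by
  have h1 : matrixInner f f = ((∑ a, ∑ b, Complex.normSq (f a b) : ℝ) : ℂ) := by
    rw [matrixInner]
    push_cast
    simp only [Complex.mul_conj]
  rw [h1, Complex.ofReal_eq_zero] at h
  have hnn : ∀ a, 0 ≤ ∑ b, Complex.normSq (f a b) := fun a =>
    Finset.sum_nonneg fun b _ => Complex.normSq_nonneg _
  have h2 := (Finset.sum_eq_zero_iff_of_nonneg fun a _ => hnn a).1 h
  funext a b
  exact Complex.normSq_eq_zero.1 ((Finset.sum_eq_zero_iff_of_nonneg fun b _ =>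
    Complex.normSq_nonneg _).1 (h2 a (Finset.mem_univ a)) b (Finset.mem_univ b))

theorem matrixInner_conj (f g : Z → Z → ℂ) :
    (starRingEnd ℂ) (matrixInner f g) = matrixInner g f := by
  simp only [matrixInner, map_sum, map_mul, Complex.conj_conj, mul_comm]

/-- The two equations, with the conjugate of the second, make `⟨f - g, f - g⟩` vanish. -/
theorem eq_iff_matrixInner (f g : Z → Z → ℂ) :
    f = g ↔ matrixInner f f = matrixInner f g ∧ matrixInner f g = matrixInner g g := by
  refine ⟨fun h => by rw [h]; exact ⟨rfl, rfl⟩, fun ⟨h1, h2⟩ => sub_eq_zero.1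
    (matrixInner_self_eq_zero ?_)⟩
  have h3 : matrixInner g f = matrixInner g g := by
    rw [← matrixInner_conj, h2, matrixInner_conj]
  have h4 : matrixInner (f - g) (f - g) =
      matrixInner f f - matrixInner f g - matrixInner g f + matrixInner g g := by
    simp only [matrixInner, ← Finset.sum_sub_distrib, ← Finset.sum_add_distrib]
    refine Finset.sum_congr rfl fun a _ => Finset.sum_congr rfl fun b _ => ?_
    simp only [Pi.sub_apply, map_sub]
    ring
  rw [h4, h1, h3]
  ring

open Classical in
-- A matrix position contributes only if it carries the labels of both pairs; exchanging the sums
-- replaces positions by equations between labels.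
theorem matrixInner_cpEntry (w : Y → ℂ) (L : Y → Z) (R : Y → Y → Prop) (w' : Y' → ℂ) (L' : Y' → Z)
    (R' : Y' → Y' → Prop) :
    matrixInner (cpEntry w L R) (cpEntry w' L' R') = ∑ y, ∑ y', ∑ z, ∑ z',
      if L y = L' z ∧ L y' = L' z' ∧ R y y' ∧ R' z z' then
        w y * (starRingEnd ℂ) (w y') * ((starRingEnd ℂ) (w' z) * w' z') else 0 := by
  have e : matrixInner (cpEntry w L R) (cpEntry w' L' R') = ∑ q : Z × Z,
      (∑ p : Y × Y, if L p.1 = q.1 ∧ L p.2 = q.2 ∧ R p.1 p.2 then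
        w p.1 * (starRingEnd ℂ) (w p.2) else 0) *
      ∑ r : Y' × Y', if L' r.1 = q.1 ∧ L' r.2 = q.2 ∧ R' r.1 r.2 then
        (starRingEnd ℂ) (w' r.1) * w' r.2 else 0 := by
    rw [matrixInner, ← Fintype.sum_prod_type']
    refine Finset.sum_congr rfl fun q _ => ?_
    rw [cpEntry, cpEntry, ← Fintype.sum_prod_type', ← Fintype.sum_prod_type', map_sum]
    congr 1
    refine Finset.sum_congr rfl fun r _ => ?_
    rw [apply_ite (starRingEnd ℂ), map_zero, map_mul, Complex.conj_conj]
  have e' : (∑ y, ∑ y', ∑ z, ∑ z', if L y = L' z ∧ L y' = L' z' ∧ R y y' ∧ R' z z' then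
        w y * (starRingEnd ℂ) (w y') * ((starRingEnd ℂ) (w' z) * w' z') else 0) =
      ∑ p : Y × Y, ∑ r : Y' × Y',
        if L p.1 = L' r.1 ∧ L p.2 = L' r.2 ∧ R p.1 p.2 ∧ R' r.1 r.2 then
        w p.1 * (starRingEnd ℂ) (w p.2) * ((starRingEnd ℂ) (w' r.1) * w' r.2) else 0 := by
    simp only [Fintype.sum_prod_type]
  rw [e, e']
  simp only [Finset.sum_mul_sum]
  rw [Finset.sum_comm]
  refine Finset.sum_congr rfl fun p _ => ?_
  rw [Finset.sum_comm]
  refine Finset.sum_congr rfl fun r _ => ?_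
  rw [Finset.sum_eq_single (L p.1, L p.2)]
  · by_cases h : R p.1 p.2
    · simp only [h, true_and, if_true, mul_ite, mul_zero, and_self, eq_comm]
    · simp only [h, and_false, false_and, if_false, zero_mul]
  · intro q _ hq
    rw [if_neg fun h => hq (Prod.ext h.1.symm h.2.1.symm), zero_mul]
  · exact fun h => absurd (Finset.mem_univ _) h

end innerProduct

/-- Every nonzero residue modulo 8 has `4` among its multiples, and there the character takes the
value `-1`. -/
theorem eighth_injective : Function.Injective eighth := by
  intro a b h
  have h1 : eighth (a - b) = 1 := by
    rw [AddChar.map_sub_eq_div, h, div_self]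
    -- The value at `b` is nonzero because its product with the value at `-b` is `1`.
    exact (eighth.map_add_eq_mul b (-b) ▸ by simp : eighth b * eighth (-b) ≠ 0) |> left_ne_zero_of_mul
  have h2 : ∀ d : ZMod 8, d = 0 ∨ ∃ k : Fin 8, (k : ℕ) • d = 4 := by decide
  refine sub_eq_zero.1 ((h2 (a - b)).resolve_right fun ⟨k, hk⟩ => ?_)
  have h3 : eighth 4 = -1 := by
    rw [eighth, AddChar.zmodChar_apply]
    change omega8 ^ 4 = -1
    rw [show (4 : ℕ) = 2 * 2 from rfl, pow_mul, omega8_sq, Complex.I_sq]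
  rw [← hk, AddChar.map_nsmul_eq_pow, h1, one_pow] at h3
  norm_num at h3

theorem norm_eighth (a : ZMod 8) : ‖eighth a‖ = 1 := AddChar.norm_apply _ _

/-- Absolute values determine the exponent, and then the root of unity is determined as well. -/
theorem sqrtTwo_zpow_mul_eighth_inj (E E' : ℤ) (a a' : ZMod 8) :
    (√2 : ℂ) ^ E * eighth a = (√2 : ℂ) ^ E' * eighth a' ↔ E = E' ∧ a = a' := by
  refine ⟨fun h => ?_, fun ⟨h, h'⟩ => by rw [h, h']⟩
  have h1 := congrArg norm h
  have h2 : ‖(√2 : ℂ)‖ = √2 := by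
    rw [Complex.norm_real, Real.norm_of_nonneg (Real.sqrt_nonneg 2)]
  rw [norm_mul, norm_mul, norm_eighth, norm_eighth, mul_one, mul_one, norm_zpow, norm_zpow, h2] at h1
  have h3 : E = E' := zpow_right_injective₀ (Real.sqrt_pos.2 two_pos) (by
    rw [Ne, Real.sqrt_eq_one]
    norm_num) h1
  subst h3
  exact ⟨rfl, eighth_injective (mul_left_cancel₀ (zpow_ne_zero _ sqrt_two_ne) h)⟩

namespace CliffCode

variable {n m : ℕ}

/-- The inner product of two written terms, up to the scalars. -/
theorem matrixInner_toTerm (c d : CliffCode n m) :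
    matrixInner c.toTerm.den.sem d.toTerm.den.sem =
      (((1 / √2 : ℝ) ^ c.p : ℝ) : ℂ) ^ 2 * (((1 / √2 : ℝ) ^ d.p : ℝ) : ℂ) ^ 2 *
        ((2 ^ Fintype.card (GramCon c d))⁻¹ * gaussSum4 fun i j =>
          entry (gramForm c.written d.written) (gramName c d i) (gramName c d j)) := by
  classical
  rw [gaussSum_gramForm, inv_mul_cancel_left₀ (pow_ne_zero _ two_ne_zero), sem_toTerm, sem_toTerm,
    matrixInner_cpEntry]
  simp only [Finset.mul_sum]
  refine Finset.sum_congr rfl fun y _ => Finset.sum_congr rfl fun y' _ =>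
    Finset.sum_congr rfl fun z _ => Finset.sum_congr rfl fun z' _ => ?_
  rw [mul_ite, mul_zero]
  simp only [funext_iff, Sum.forall, Sum.elim_inl, Sum.elim_inr, and_assoc]
  split_ifs
  · simp only [map_mul, Complex.conj_ofReal, AddChar.map_add_eq_mul, sub_eq_add_neg,
      AddChar.map_neg_eq_conj]
    have h1 := phase_mul_conj ((1 / 8 * c.cst : ℝ) : UnitAddCircle)
    have h2 := phase_mul_conj ((1 / 8 * d.cst : ℝ) : UnitAddCircle)
    generalize phase ((1 / 8 * c.cst : ℝ) : UnitAddCircle) = u at *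
    generalize phase ((1 / 8 * d.cst : ℝ) : UnitAddCircle) = v at *
    generalize (((1 / √2 : ℝ) ^ c.p : ℝ) : ℂ) = s
    generalize (((1 / √2 : ℝ) ^ d.p : ℝ) : ℂ) = t
    generalize quarter (c.quadFun y) = a1
    generalize (starRingEnd ℂ) (quarter (c.quadFun y')) = a2
    generalize (starRingEnd ℂ) (quarter (d.quadFun z)) = a3
    generalize quarter (d.quadFun z') = a4
    linear_combination (s ^ 2 * t ^ 2 * a1 * a2 * a3 * a4) *
      ((v * (starRingEnd ℂ) v) * h1 + h2)
  · rfl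

/-- The powers of `2` coming from the constraint variables cancel against the normalization. Each
term has two copies of its summed variables, which contribute `2 = √2 ^ 2` per variable; the scalars
enter squared. -/
theorem matrixInner_eq (c d : CliffCode n m) :
    matrixInner c.toTerm.den.sem d.toTerm.den.sem =
      if (gaussEval (gramForm c.written d.written)).2.2.2 then 0 else
        (√2 : ℂ) ^ ((4 * c.k + 4 * d.k : ℕ) - 2 * c.p - 2 * d.p -
          (gaussEval (gramForm c.written d.written)).2.1 : ℤ) *
            eighth (gaussEval (gramForm c.written d.written)).2.2.1 := by
  have hf := isForm_gramForm c d
  rw [matrixInner_toTerm, gaussEval_spec _ _ hf.symm hf.names]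
  split
  · rw [mul_zero, mul_zero]
  have h2 := sqrt_two_sq
  have h0 := sqrt_two_ne
  have hc : Fintype.card (GramVar c d ⊕ GramCon c d) =
      2 * c.k + 2 * d.k + Fintype.card (GramCon c d) := by
    simp only [Fintype.card_sum, Fintype.card_fin]
    ring
  rw [hc, pow_add, zpow_sub₀ h0, zpow_sub₀ h0, zpow_sub₀ h0, zpow_natCast, zpow_natCast, zpow_mul',
    zpow_mul', show 4 * c.k + 4 * d.k = 2 * (2 * c.k + 2 * d.k) by ring, pow_mul, h2]
  have h3 : ∀ p : ℤ, (((1 / √2 : ℝ) ^ p : ℝ) : ℂ) = ((√2 : ℂ) ^ p)⁻¹ := fun p => by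
    push_cast
    rw [one_div, inv_zpow]
  rw [h3, h3]
  have h4 : ∀ p : ℤ, (√2 : ℂ) ^ p ≠ 0 := fun p => zpow_ne_zero _ h0
  have h5 := h4 c.p
  have h6 := h4 d.p
  rw [zpow_ofNat, zpow_ofNat, inv_pow (√2 : ℂ)]
  field_simp

/-- A vanishing norm means a zero matrix, so the flags settle the degenerate cases. Otherwise the
three values must be nonzero with equal arguments and exponents; in `expo` the negative
contributions are moved to the other side, so that only natural numbers are added and compared. -/
theorem sameMorphism_iff (c d : CliffCode n m) :
    sameMorphism (c.written, d.written) = true ↔ c.toTerm.den.sem = d.toTerm.den.sem := by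
  have hpos : ∀ z : ℤ, z = posInt z - negInt z := by
    intro z
    by_cases h : z < 0
    · rw [posInt, negInt, decide_eq_true h, if_pos rfl, if_pos rfl]
      omega
    · rw [posInt, negInt, decide_eq_false h, if_neg Bool.false_ne_true, if_neg Bool.false_ne_true]
      omega
  have hzero : ∀ e : CliffCode n m, (gaussEval (gramForm e.written e.written)).2.2.2 = true →
      e.toTerm.den.sem = 0 := fun e he =>
    matrixInner_self_eq_zero (by rw [matrixInner_eq, if_pos he])
  have hne : ∀ (E : ℤ) (a : ZMod 8), (√2 : ℂ) ^ E * eighth a ≠ 0 := fun E a => by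
    rw [← norm_ne_zero_iff, norm_mul, norm_eighth, mul_one, norm_ne_zero_iff]
    exact zpow_ne_zero _ sqrt_two_ne
  by_cases h1 : (gaussEval (gramForm c.written c.written)).2.2.2 = true <;>
  by_cases h2 : (gaussEval (gramForm d.written d.written)).2.2.2 = true
  · simp [sameMorphism, sameValues, h1, h2, hzero]
  · refine iff_of_false (by simp [sameMorphism, sameValues, h1, h2]) fun h => ?_
    have h3 := matrixInner_eq d d
    rw [← h, matrixInner_eq c c, if_pos h1, if_neg h2] at h3
    exact hne _ _ h3.symm
  · refine iff_of_false (by simp [sameMorphism, sameValues, h1, h2]) fun h => ?_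
    have h3 := matrixInner_eq d d
    rw [← h, matrixInner_eq c c, if_neg h1, if_pos h2] at h3
    exact hne _ _ h3
  · rw [eq_iff_matrixInner, matrixInner_eq, matrixInner_eq, matrixInner_eq, if_neg h1, if_neg h2]
    by_cases h3 : (gaussEval (gramForm c.written d.written)).2.2.2 = true
    · rw [if_pos h3]
      exact iff_of_false (by simp [sameMorphism, sameValues, h1, h2, h3]) fun h => hne _ _ h.1
    · rw [if_neg h3, sqrtTwo_zpow_mul_eighth_inj, sqrtTwo_zpow_mul_eighth_inj]
      rw [Bool.not_eq_true] at h1 h2 h3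
      simp only [sameMorphism, sameValues, h1, h2, h3, Bool.false_and, Bool.false_or, Bool.not_false,
        Bool.true_and, Bool.and_eq_true, decide_eq_true_eq]
      have h4 := hpos c.p
      have h5 := hpos d.p
      change (_ ∧ _) ∧ ((c.k + c.k) + (c.k + c.k) + (negInt c.p + negInt c.p) +
        (posInt d.p + posInt d.p) + _ = (d.k + d.k) + (d.k + d.k) + (negInt d.p + negInt d.p) +
        (posInt c.p + posInt c.p) + _ ∧ (c.k + c.k) + (c.k + c.k) + (negInt c.p + negInt c.p) +
        (posInt d.p + posInt d.p) + _ = (d.k + d.k) + (d.k + d.k) + (negInt d.p + negInt d.p) +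
        (posInt c.p + posInt c.p) + _) ↔ _
      push_cast
      constructor
      · rintro ⟨⟨a1, a2⟩, a3, a4⟩
        exact ⟨⟨by omega, a1⟩, by omega, a2⟩
      · rintro ⟨⟨a3, a1⟩, a4, a2⟩
        exact ⟨⟨a1, a2⟩, by omega, by omega⟩

/-! ## Sizes of trees -/

theorem _root_.BinTree.size_ofNat_le (a : ℕ) : (BinTree.ofNat a).size + 3 ≤ 4 * natSize a := by
  have h := PolyTime.tsize_nat_le a
  change (BinTree.ofNat a).size ≤ _ at h
  rw [natSize]
  omega

theorem _root_.BinTree.size_ofInt_le (a : ℤ) : (BinTree.ofInt a).size + 3 ≤ 4 * intSize a := by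
  have h := BinTree.size_ofNat_le a.natAbs
  have h2 := BinTree.size_ofBool_le (decide (a < 0))
  rw [BinTree.ofInt, BinTree.size, intSize]
  omega

theorem _root_.BinTree.size_ofList_map_le {α : Type*} (f : α → BinTree) (s : α → ℕ) (K : ℕ)
    (h : ∀ a, (f a).size + 1 ≤ K * s a) (l : List α) :
    (BinTree.ofList (l.map f)).size ≤ K * (l.map s).sum + 1 := by
  induction l with
  | nil => exact Nat.le_add_left _ _
  | cons a l ih =>
    have := h a
    rw [List.map_cons, List.map_cons, List.sum_cons, BinTree.ofList, BinTree.size, mul_add]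
    omega

theorem _root_.LinCode.size_toTree_le {k : ℕ} (a : LinCode k) : a.toTree.size + 1 ≤ 6 * a.size := by
  have e : (a.vars >>= fun i => pure (i : ℕ)) = a.vars.map fun i : Fin k => (i : ℕ) :=
    bind_pure_comp _ _
  have h : (BinTree.ofList ((a.vars.map fun i : Fin k => (i : ℕ)).map fun i => .ofNat i)).size ≤
      4 * ((a.vars.map fun i : Fin k => (i : ℕ)).map fun i => natSize i).sum + 1 :=
    BinTree.size_ofList_map_le _ _ 4
      (fun i => (Nat.add_le_add_left (by norm_num) _).trans (BinTree.size_ofNat_le i)) _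
  have h2 := BinTree.size_ofBool_le a.cst
  rw [LinCode.toTree, BinTree.size, LinCode.size, e]
  omega

theorem size_toTree_le (c : CliffCode n m) :
    c.toTree.size ≤ 6 * (c.phaseSize + c.polySize + c.headSize) + 14 := by
  have h1 := BinTree.size_ofNat_le c.k
  have h2 := BinTree.size_ofInt_le c.p
  have h3 := BinTree.size_ofInt_le c.cst
  have h4 := BinTree.size_ofList_map_le (fun a : ℤ × Fin c.k => .cons (.ofInt a.1) (.ofNat a.2))
    (fun a => intSize a.1 + natSize a.2) 4 (fun a => by
      have h1 := BinTree.size_ofInt_le a.1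
      have h2 := BinTree.size_ofNat_le a.2
      rw [BinTree.size]
      omega) c.lin
  have h5 := BinTree.size_ofList_map_le (fun a : ℤ × Fin c.k × Fin c.k =>
      .cons (.ofInt a.1) (.cons (.ofNat a.2.1) (.ofNat a.2.2)))
    (fun a => intSize a.1 + natSize a.2.1 + natSize a.2.2) 4 (fun a => by
      have h1 := BinTree.size_ofInt_le a.1
      have h2 := BinTree.size_ofNat_le a.2.1
      have h3 := BinTree.size_ofNat_le a.2.2
      rw [BinTree.size, BinTree.size]
      omega) c.quad
  have h6 : ∀ {N : ℕ} (f : Fin N → LinCode c.k),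
      (BinTree.ofList (List.ofFn fun i => (f i).toTree)).size ≤ 6 * ∑ i, (f i).size + 1 := by
    intro N f
    have h := BinTree.size_ofList_map_le LinCode.toTree LinCode.size 6 LinCode.size_toTree_le
      (List.ofFn f)
    rwa [List.map_ofFn, List.map_ofFn, List.sum_ofFn] at h
  have h7 := h6 c.ket
  have h8 := h6 c.bra
  have h9 := BinTree.size_ofList_map_le LinCode.toTree LinCode.size 6 LinCode.size_toTree_le c.disc
  simp only [CliffCode.toTree, BinTree.ofList, BinTree.size, phaseSize, polySize, headSize]
  omega

end CliffCode

/-- Equality of morphisms of the Clifford fragment with discards is decided in polynomial time. -/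
theorem mainTheorem9 :
    ∃ (M : Prog) (q : Polynomial ℕ), ∀ (n m : ℕ) (c₁ c₂ : CliffCode n m),
      ∃ (b : Bool) (T : ℕ),
        M.HaltsWith (.cons c₁.toTree c₂.toTree) (.ofBool b) T ∧
        T ≤ q.eval ((c₁.phaseSize + c₂.phaseSize) + (c₁.polySize + c₂.polySize) +
          (c₁.headSize + c₂.headSize)) ∧
        (b = true ↔
          (Quot.mk CliffStep c₁.toMor : CliffQuot n m) = Quot.mk CliffStep c₂.toMor) := by
  obtain ⟨q, -, hq⟩ := PolyTime.sameMorphism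
  obtain ⟨M, hM⟩ := hq 0
  -- The factor `6` and the constant `14` come from `size_toTree_le`; `29` counts both constants and
  -- the `cons` node that joins the two inputs.
  refine ⟨M, q.comp (6 * .X + 29), fun n m c₁ c₂ => ⟨sameMorphism (c₁.written, c₂.written), ?_⟩⟩
  have hin : enc (c₁.written, c₂.written) = .cons c₁.toTree c₂.toTree := by
    rw [← c₁.enc_written, ← c₂.enc_written]
    rfl
  obtain ⟨T, σ', hrun, hout, -, hT⟩ := hM
    (Function.update (fun _ => BinTree.nil) 0 (.cons c₁.toTree c₂.toTree)) (c₁.written, c₂.written)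
    ((Function.update_self ..).trans hin.symm)
  refine ⟨T, ⟨σ', hrun, hout⟩, hT.trans ?_, (c₁.sameMorphism_iff c₂).trans
    (mk_eq_iff_sem c₁.toMor c₂.toMor).symm⟩
  rw [Polynomial.eval_comp]
  refine q.eval_le_eval_nat ?_
  have h1 := c₁.size_toTree_le
  have h2 := c₂.size_toTree_le
  rw [tsize, hin, BinTree.size]
  simp only [Polynomial.eval_add, Polynomial.eval_mul, Polynomial.eval_X, Polynomial.eval_ofNat]
  omega
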